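/- A \emph{structural causal model} (SCM) $G$ consists of a finite nonempty directed acyclic graph on variables with finitely many states, a probability distribution with rational values for each root (exogenous) variable, and for each other (endogenous) variable a table (structural equation) giving its state for every instantiation of its parents. It defines observational probabilities $\Pr(\mathbf y)$ and counterfactual probabilities $\Pr(\mathbf y_{\mathbf x},\mathbf w_{\mathbf v},\mathbf e)$: the probability, over the exogenous variables, that $\mathbf Y=\mathbf y$ after setting $\mathbf X=\mathbf x$, that $\mathbf W=\mathbf w$ after setting $\mathbf V=\mathbf v$, and that $\mathbf E=\mathbf e$ without intervention. \emph{Reverse-MAP.} Given an SCM, disjoint sets $\mathbf U,\mathbf E_1,\mathbf E_2$ of its variables and instantiations $\mathbf e_1,\mathbf e_2$, compute $\arg\max_{\mathbf u}\Pr(\mathbf e_1\mid\mathbf u,\mathbf e_2)$. \emph{Unit selection.} Given an SCM, a set $\mathbf U$ of exogenous variables and an objective function $$L(\mathbf u)=\sum_{i=1}^n w_i\,\Pr(\mathbf y^i_{\mathbf x^i},\mathbf w^i_{\mathbf v^i}\mid \mathbf e^i,\mathbf u),\qquad w_i\ge 0,\quad \sum_{i=1}^n w_i=1,$$ with $w_i$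 rational, where all $\mathbf X^i,\mathbf Y^i,\mathbf V^i,\mathbf W^i,\mathbf E^i$ are sets of endogenous variables and $(\mathbf X^i\cup\mathbf V^i)\cap(\mathbf Y^i\cup\mathbf W^i)=\emptyset$, compute $\arg\max_{\mathbf u}L(\mathbf u)$. In both problems $\mathbf u$ ranges over the instantiations of $\mathbf U$ for which all the conditional probabilities are defined (the conditioning events have positive probability). \emph{Objective model} $G'$ of $\langle G,L\rangle$. For each $i\le n$ take three copies $G^i,[G^i],[[G^i]]$ of $G$ that share their exogenous variables; the unit variables $\mathbf U$ are moreover shared by all $i$. In $[G^i]$ the variables $[\mathbf X^i]$ lose their incoming edges and are set to $\mathbf x^i$; in $[[G^i]]$ the variables $[[\mathbf V^i]]$ lose theirs and are set to $\mathbf v^i$. Add a root $H$ with states $h_1,\dots,h_n$ and $\Pr'(h_i)=w_i$, and make it a parent of all variables $[\mathbf Y^i]$, $[[\mathbf W^i]]$; when $H=h_i$, these obey their original structural equations, and when $H\ne h_i$, they have their states in $\mathbf y^i,\mathbf w^i$. Let $\mathbf y,\mathbf w,\mathbf x,\mathbf v,\mathbf e$ be the instantiations of $\{[\mathbf Y^i]\}_i,\{[[\mathbf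 W^i]]\}_i,\{[\mathbf X^i]\}_i,\{[[\mathbf V^i]]\}_i,\{\mathbf E^i\}_i$ (the latter in the $G^i$) given by $L$. \emph{Size} $|G|$ of an SCM: the number of its variables, plus the number of its edges, plus the number of entries of its conditional probability tables. A root with $k$ states has $k$ entries; an endogenous variable with $k$ states has $k\cdot r$ entries, where $r$ is the least number of rows of a table of its structural equation, rows being allowed to describe a parent either by a state $s$ or by ``any state other than $s$''. \textbf{Statement.} There are polynomial-time reductions in both directions between Reverse-MAP and unit selection: 1. There is a polynomial-time map from Reverse-MAP instances to unit selection instances that preserves the set of optimal instantiations $\mathbf u$ (up to renaming of the target variables), the instantiations at which the objective is defined, and its values there. 2. The map that sends a unit selection instance $(G,\mathbf U,L)$ to the Reverse-MAP instance $\arg\max_{\mathbf u}\Pr'(\mathbf y,\mathbf w\mid\mathbf x,\mathbf v,\mathbf e,\mathbf u)$ on the objective model $G'$ is computable in polynomial time and has the same preservation properties. 3. The objective model has size $O(n\cdot|G|)$, with an absolute constant. Polynomial time refers to the length of the explicit input, in which all tables are listed with one row for each instantiation of the parents. -/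

import Mathlib

/-! ### Polynomial time: structured programs over binary trees, with a step count -/

/-- Binary trees, the data on which programs operate. -/
inductive Data where
  | nil : Data
  | cons : Data → Data → Data

namespace Data

/-- Number of nodes of a tree. -/
def size : Data → ℕ
  | nil => 1
  | cons a b => a.size + b.size + 1

def head : Data → Data
  | nil => nil
  | cons a _ => a

def tail : Data → Data
  | nil => nil
  | cons _ b => b

/-- Unary numbers. They are used for state numbers, for numbers of states and for the numbers in
variable names. -/
def ofNat : ℕ → Data
  | 0 => nil
  | n + 1 => cons nil (ofNat n)

def ofList {α : Type} (enc : α → Data) : List α → Data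
  | [] => nil
  | a :: l => cons (enc a) (ofList enc l)

/-- Binary numbers, least significant bit first. They are used for the probabilities. -/
def ofNatBinary (n : ℕ) : Data :=
  ofList (fun b : Bool => if b then cons nil nil else nil) (Nat.bits n)

def ofRat (q : ℚ≥0) : Data := cons (ofNatBinary q.num) (ofNatBinary q.den)

end Data

/-- Programs of a WHILE language over trees. A program transforms one tree into another:
`cons p q` runs `p` and `q` on the same input and joins the results, `seq p q` runs `p` and then
`q`, `ite c p q` runs `p` or `q` according to whether the result of `c` is different from `nil`,
`loop c p` repeats `p` as long as the result of `c` is different from `nil`. -/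
inductive Prog where
  | id : Prog
  | nil : Prog
  | head : Prog
  | tail : Prog
  | cons : Prog → Prog → Prog
  | seq : Prog → Prog → Prog
  | ite : Prog → Prog → Prog → Prog
  | loop : Prog → Prog → Prog

/-- `Runs p x y t`: on input `x` the program `p` halts with result `y` at cost `t`. Every step that
reads, copies or discards a tree is charged the size of that tree, so the cost also bounds the
memory that is used, and a Turing machine simulates a run in time polynomial in its cost. -/
inductive Runs : Prog → Data → Data → ℕ → Prop where
  | id (x : Data) : Runs Prog.id x x x.size
  | nil (x : Data) : Runs Prog.nil x Data.nil x.size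
  | head (x : Data) : Runs Prog.head x x.head x.size
  | tail (x : Data) : Runs Prog.tail x x.tail x.size
  | cons {p q : Prog} {x a b : Data} {s t : ℕ} :
      Runs p x a s → Runs q x b t → Runs (Prog.cons p q) x (Data.cons a b) (x.size + s + t + 1)
  | seq {p q : Prog} {x y z : Data} {s t : ℕ} :
      Runs p x y s → Runs q y z t → Runs (Prog.seq p q) x z (s + t + 1)
  | iteTrue {c p q : Prog} {x d y : Data} {s t : ℕ} :
      Runs c x d s → d ≠ Data.nil → Runs p x y t → Runs (Prog.ite c p q) x y (x.size + s + t + 1)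
  | iteFalse {c p q : Prog} {x y : Data} {s t : ℕ} :
      Runs c x Data.nil s → Runs q x y t → Runs (Prog.ite c p q) x y (x.size + s + t + 1)
  | loopStop {c p : Prog} {x : Data} {s : ℕ} :
      Runs c x Data.nil s → Runs (Prog.loop c p) x x (x.size + s + 1)
  | loopStep {c p : Prog} {x d y z : Data} {r s t : ℕ} :
      Runs c x d r → d ≠ Data.nil → Runs p x y s → Runs (Prog.loop c p) y z t →
      Runs (Prog.loop c p) x z (x.size + r + s + t + 1)

/-! ### Optimization problems and their reductions -/

/-- A maximization problem. A candidate solution is a list of numbers (for the two problems below,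
the list of the states of the target variables). -/
structure OptProblem where
  Input : Type
  encode : Input → Data
  Valid : Input → Prop
  /-- the candidates at which the objective is defined -/
  Feasible : Input → List ℕ → Prop
  value : Input → List ℕ → ℚ≥0

namespace OptProblem

/-- `u` belongs to the arg max. -/
def IsArgMax (P : OptProblem) (I : P.Input) (u : List ℕ) : Prop :=
  P.Feasible I u ∧ ∀ u', P.Feasible I u' → P.value I u' ≤ P.value I u

/-- `f` is computed in polynomial time, on the valid inputs of `P`. -/
def PolyTime (P Q : OptProblem) (f : P.Input → Q.Input) : Prop :=
  ∃ (p : Prog) (b : Polynomial ℕ), ∀ I, P.Valid I →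
    ∃ t ≤ b.eval (P.encode I).size, Runs p (P.encode I) (Q.encode (f I)) t

/-- `f` is a polynomial-time reduction from `P` to `Q`: it maps valid inputs to valid inputs with
the same optimal solutions; moreover the objective functions coincide. -/
def IsPolyReduction (P Q : OptProblem) (f : P.Input → Q.Input) : Prop :=
  PolyTime P Q f ∧
  ∀ I, P.Valid I →
    Q.Valid (f I) ∧
    (∀ u, Q.IsArgMax (f I) u ↔ P.IsArgMax I u) ∧
    (∀ u, Q.Feasible (f I) u ↔ P.Feasible I u) ∧
    (∀ u, P.Feasible I u → Q.value (f I) u = P.value I u)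

end OptProblem

/-! ### Structural causal models -/

/-- Names of variables. -/
abbrev Var := List ℕ

/-- What an SCM stores for a variable. The states of a variable with `k` states are `0, …, k - 1`.
* `exo θ`: an exogenous (root) variable whose `s`-th state has probability `θ[s]`;
* `endo pa k rows`: an endogenous variable with parents `pa` and `k` states; the structural equation
  is tabulated by `rows`, and a row `(p, s)` says that `s` is the state when the parents have
  states `p`. -/
inductive Mech where
  | exo (θ : List ℚ≥0) : Mech
  | endo (pa : List Var) (k : ℕ) (rows : List (List ℕ × ℕ)) : Mech

namespace Mech

def card : Mech → ℕ
  | exo θ => θ.length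
  | endo _ k _ => k

def IsExo : Mech → Bool
  | exo _ => true
  | endo _ _ _ => false

end Mech

/-- A (partial) instantiation: variables with their states. -/
abbrev Inst := List (Var × ℕ)

/-- The variables of an instantiation. -/
abbrev Inst.vars (e : Inst) : List Var := e.map Prod.fst

/-- Structural causal models (as raw data; see `SCM.WF`). -/
abbrev SCM := List (Var × Mech)

namespace SCM

def vars (G : SCM) : List Var := G.map Prod.fst

def exoVars (G : SCM) : Finset Var := ((G.filter fun n => n.2.IsExo).map Prod.fst).toFinset

def endoVars (G : SCM) : Finset Var := ((G.filter fun n => !n.2.IsExo).map Prod.fst).toFinset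

/-- The number of states of a variable. -/
def card (G : SCM) (v : Var) : ℕ :=
  match G.lookup v with
  | some m => m.card
  | none => 0

/-- The probability of a state of an exogenous variable. -/
def prior (G : SCM) (v : Var) (s : ℕ) : ℚ≥0 :=
  match G.lookup v with
  | some (Mech.exo θ) => θ.getD s 0
  | _ => 0

/-- `s` is a list of states of the variables `V`. -/
def IsStates (G : SCM) (s : List ℕ) (V : List Var) : Prop :=
  List.Forall₂ (fun a v => a < G.card v) s V

/-- `G` is a structural causal model: its variables are distinct, the parents of a variable are
distinct variables of the model, the graph is acyclic, the endogenous variables are those with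
parents, priors are probability distributions, and each table has exactly one row for each
instantiation of the parents. -/
def WF (G : SCM) : Prop :=
  G ≠ [] ∧
  G.vars.Nodup ∧
  (∀ v θ, (v, Mech.exo θ) ∈ G → θ.sum = 1) ∧
  (∀ v pa k rows, (v, Mech.endo pa k rows) ∈ G →
    pa ≠ [] ∧ pa.Nodup ∧ pa ⊆ G.vars ∧
    (rows.map Prod.fst).Nodup ∧ (∀ p, p ∈ rows.map Prod.fst ↔ G.IsStates p pa) ∧
    ∀ r ∈ rows, r.2 < k) ∧
  ∃ rank : Var → ℕ, ∀ v pa k rows, (v, Mech.endo pa k rows) ∈ G → ∀ p ∈ pa, rank p < rank v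

/-- `e` is an instantiation of a set of variables of `G`. -/
def IsInst (G : SCM) (e : Inst) : Prop :=
  e.vars.Nodup ∧ ∀ c ∈ e, c.1 ∈ G.vars ∧ c.2 < G.card c.1

/-- `e` is an instantiation of a set of endogenous variables of `G`. -/
def IsEndoInst (G : SCM) (e : Inst) : Prop :=
  G.IsInst e ∧ ∀ c ∈ e, c.1 ∈ G.endoVars

/-- Instantiations of all exogenous variables. -/
abbrev ExoInst (G : SCM) : Type := (v : {v : Var // v ∈ G.exoVars}) → Fin (G.card v)

/-- `x` assigns to the variables of `G` the states that they have when the exogenous variables have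
states `ω` and the variables in `act` are set to their states in `act`, which overrides their
structural equations. -/
def IsSolution (G : SCM) (act : Inst) (ω : G.ExoInst) (x : Var → ℕ) : Prop :=
  ∀ v m, (v, m) ∈ G →
    match act.lookup v with
    | some s => x v = s
    | none =>
      match m with
      | Mech.exo _ => ∀ h : v ∈ G.exoVars, x v = ω ⟨v, h⟩
      | Mech.endo pa _ rows => rows.lookup (pa.map x) = some (x v)

open Classical in
/-- The counterfactual probability of a list of pairs `(act, out)`: the probability that, for each
of these pairs, the variables of `out` have their states in `out` after the variables of `act` have
been set to their states in `act`. -/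
noncomputable def prob (G : SCM) (worlds : List (Inst × Inst)) : ℚ≥0 :=
  ∑ ω : G.ExoInst, (∏ v : {v : Var // v ∈ G.exoVars}, G.prior v (ω v)) *
    if ∀ w ∈ worlds, ∃ x, G.IsSolution w.1 ω x ∧ ∀ c ∈ w.2, x c.1 = c.2 then 1 else 0

/-- The observational probability of an instantiation. -/
noncomputable def obs (G : SCM) (e : Inst) : ℚ≥0 := G.prob [([], e)]

end SCM

/-! ### The size of a model

A structural equation is stored by the rows of a table. In a row, a parent is described by one of
its states `s` or by "any state other than `s`". -/

/-- A cell of a table row. -/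
inductive Cell where
  | eq (s : ℕ) : Cell
  | ne (s : ℕ) : Cell

def Cell.Matches : Cell → ℕ → Prop
  | eq s, a => a = s
  | ne s, a => a ≠ s

/-- The table `T` with grouped rows stands for the fully expanded table `rows`: each row of the
latter is matched by some row of the former, and only by rows with the same value. -/
def Represents (T : List (List Cell × ℕ)) (rows : List (List ℕ × ℕ)) : Prop :=
  ∀ r ∈ rows,
    (∃ g ∈ T, List.Forall₂ Cell.Matches g.1 r.1) ∧
    ∀ g ∈ T, List.Forall₂ Cell.Matches g.1 r.1 → g.2 = r.2

/-- The number of rows that are needed to store a structural equation. -/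
noncomputable def rowCount (rows : List (List ℕ × ℕ)) : ℕ :=
  sInf {k | ∃ T : List (List Cell × ℕ), T.length = k ∧ Represents T rows}

/-- One unit for the variable, one for each incoming edge, and one for each entry of the conditional
probability table (a row has one entry for each state of the variable). -/
noncomputable def Mech.size : Mech → ℕ
  | exo θ => 1 + θ.length
  | endo pa k rows => 1 + pa.length + rowCount rows * k

/-- The space needed to store the structure and the parameters of `G`. -/
noncomputable def SCM.size (G : SCM) : ℕ := (G.map fun n => n.2.size).sum

/-! ### Reverse-MAP -/

structure RMAPInput where
  G : SCM
  U : List Var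
  e₁ : Inst
  e₂ : Inst

/-! ### Unit selection -/

/-- The summand `weight * Pr(y_x, w_v | e, u)` of an objective function. -/
structure Term where
  weight : ℚ≥0
  x : Inst
  y : Inst
  v : Inst
  w : Inst
  e : Inst

structure USInput where
  G : SCM
  U : List Var
  L : List Term

/-! ### Encodings of the inputs as trees -/

namespace Data

def ofVar (v : Var) : Data := ofList ofNat v

def ofInst (e : Inst) : Data := ofList (fun c : Var × ℕ => cons (ofVar c.1) (ofNat c.2)) e

def ofMech : Mech → Data
  | Mech.exo θ => cons nil (ofList ofRat θ)
  | Mech.endo pa k rows =>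
      cons (cons nil nil) (cons (ofList ofVar pa) (cons (ofNat k)
        (ofList (fun r : List ℕ × ℕ => cons (ofList ofNat r.1) (ofNat r.2)) rows)))

def ofSCM (G : SCM) : Data := ofList (fun n : Var × Mech => cons (ofVar n.1) (ofMech n.2)) G

def ofTerm (t : Term) : Data :=
  cons (ofRat t.weight) (cons (ofInst t.x) (cons (ofInst t.y) (cons (ofInst t.v)
    (cons (ofInst t.w) (ofInst t.e)))))

def ofRMAP (I : RMAPInput) : Data :=
  cons (ofSCM I.G) (cons (ofList ofVar I.U) (cons (ofInst I.e₁) (ofInst I.e₂)))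

def ofUS (I : USInput) : Data :=
  cons (ofSCM I.G) (cons (ofList ofVar I.U) (ofList ofTerm I.L))

end Data

/-- Reverse-MAP: given an SCM `G`, disjoint sets of variables `U`, `E₁`, `E₂` and instantiations
`e₁`, `e₂` of the last two, maximize `Pr(e₁ | u, e₂)` over the instantiations `u` of `U` for which
this conditional probability is defined. -/
noncomputable def RMAP : OptProblem where
  Input := RMAPInput
  encode := Data.ofRMAP
  Valid I := I.G.WF ∧ I.U.Nodup ∧ I.U ⊆ I.G.vars ∧ I.G.IsInst I.e₁ ∧ I.G.IsInst I.e₂ ∧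
    I.U.Disjoint I.e₁.vars ∧ I.U.Disjoint I.e₂.vars ∧ I.e₁.vars.Disjoint I.e₂.vars
  Feasible I u := I.G.IsStates u I.U ∧ I.G.obs (I.U.zip u ++ I.e₂) ≠ 0
  value I u := I.G.obs (I.e₁ ++ I.U.zip u ++ I.e₂) / I.G.obs (I.U.zip u ++ I.e₂)

/-- Unit selection: given an SCM `G`, a set `U` of exogenous variables, and an objective function
`L(u) = ∑ i, w i * Pr(y i _{x i}, w i _{v i} | e i, u)`, maximize `L(u)` over the instantiations `u`
of `U` for which all these conditional probabilities are defined. Treatment, outcome and evidence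
variables are endogenous, no treatment variable of a summand is an outcome variable of that
summand, and the weights sum to one. -/
noncomputable def UnitSelection : OptProblem where
  Input := USInput
  encode := Data.ofUS
  Valid I := I.G.WF ∧ I.U.Nodup ∧ (∀ v ∈ I.U, v ∈ I.G.exoVars) ∧
    (∀ t ∈ I.L,
      I.G.IsEndoInst t.x ∧ I.G.IsEndoInst t.y ∧ I.G.IsEndoInst t.v ∧ I.G.IsEndoInst t.w ∧
      I.G.IsEndoInst t.e ∧ (t.x.vars ++ t.v.vars).Disjoint (t.y.vars ++ t.w.vars)) ∧
    (I.L.map Term.weight).sum = 1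
  Feasible I u := I.G.IsStates u I.U ∧ ∀ t ∈ I.L, I.G.obs (t.e ++ I.U.zip u) ≠ 0
  value I u := (I.L.map fun t => t.weight *
    (I.G.prob [(t.x, t.y), (t.v, t.w), ([], t.e ++ I.U.zip u)] /
      I.G.obs (t.e ++ I.U.zip u))).sum

/-! ### The objective model -/

namespace Objective

/-- The mixture variable. -/
def mixVar : Var := [0]

/-- The shared copy of a unit variable. -/
def unitVar (v : Var) : Var := 1 :: v

/-- The copy of another exogenous variable in component `i`. -/
def exoVar (i : ℕ) (v : Var) : Var := 2 :: i :: v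

/-- The copy of an endogenous variable in world `j` of component `i`. World `0` carries the
evidence, worlds `1` and `2` carry the two interventions. -/
def endoVar (i j : ℕ) (v : Var) : Var := 3 :: i :: j :: v

/-- The copy of any variable of `G` in world `j` of component `i`. -/
def copyVar (G : SCM) (U : List Var) (i j : ℕ) (v : Var) : Var :=
  if v ∈ U then unitVar v else if v ∈ G.exoVars then exoVar i v else endoVar i j v

/-- The copies of the endogenous variables in world `j` of component `i` out of `n`. A variable that
is set by `act` becomes a root with that state. A variable with state `z` in `out` gets the mixture
variable as a further parent; it obeys its structural equation when the mixture variable has state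
`i` and has state `z` otherwise. -/
def world (G : SCM) (U : List Var) (n i j : ℕ) (act out : Inst) : SCM :=
  G.filterMap fun
    | (_, Mech.exo _) => none
    | (v, Mech.endo pa k rows) =>
      some (endoVar i j v,
        match act.lookup v with
        | some s => Mech.exo ((List.range k).map fun a => if a = s then 1 else 0)
        | none =>
          match out.lookup v with
          | none => Mech.endo (pa.map (copyVar G U i j)) k rows
          | some z => Mech.endo (mixVar :: pa.map (copyVar G U i j)) k
              (rows.flatMap fun r =>
                (List.range n).map fun h => (h :: r.1, if h = i then r.2 else z)))

/-- Component `i` out of `n`, for the summand `t`: a mutilated triplet model without its unit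
variables. -/
def component (G : SCM) (U : List Var) (n i : ℕ) (t : Term) : SCM :=
  (G.filterMap fun
    | (v, Mech.exo θ) => if v ∈ U then none else some (exoVar i v, Mech.exo θ)
    | (_, Mech.endo _ _ _) => none) ++
  world G U n i 0 [] [] ++ world G U n i 1 t.x t.y ++ world G U n i 2 t.v t.w

/-- The objective model. -/
def model (I : USInput) : SCM :=
  (mixVar, Mech.exo (I.L.map Term.weight)) ::
  (I.G.filterMap fun
    | (v, Mech.exo θ) => if v ∈ I.U then some (unitVar v, Mech.exo θ) else none
    | (_, Mech.endo _ _ _) => none) ++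
  I.L.zipIdx.flatMap fun c => component I.G I.U I.L.length c.2 c.1

/-- The copy of an instantiation of endogenous variables in world `j` of component `i`. -/
def copyInst (i j : ℕ) (e : Inst) : Inst := e.map fun c => (endoVar i j c.1, c.2)

/-- The Reverse-MAP problem `arg max_u Pr'(y, w | x, v, e, u)` on the objective model. -/
def toRMAP (I : USInput) : RMAPInput where
  G := model I
  U := I.U.map unitVar
  e₁ := I.L.zipIdx.flatMap fun c => copyInst c.2 1 c.1.y ++ copyInst c.2 2 c.1.w
  e₂ := I.L.zipIdx.flatMap fun c =>
    copyInst c.2 1 c.1.x ++ copyInst c.2 2 c.1.v ++ copyInst c.2 0 c.1.e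

end Objective

/-!
*From Reverse-MAP to unit selection.* Each target variable `v` is compared with a new exogenous
variable on the same states that is independent of everything else. Conditioning on their equality
turns the state of the new variable into an observation of `v`, so the new variables can serve as
unit variables. The probability of their states is a common factor of numerator and denominator and
cancels; it is nonzero because the new variables are given distributions without null states. All
outcomes and evidence refer to endogenous copies, since they may concern exogenous variables.

*From unit selection to Reverse-MAP.* Given the unit variables, the components of the objective
model are independent, so `Pr'(x, v, e | u)` is the product of the probabilities `Pr(eʲ | u)`. Given
`H = hᵢ`, the outcomes of all components other than `i` hold trivially, so `Pr'(y, w, x, v, e | u)`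
is obtained by replacing the factor of component `i` by `Pr(yⁱ_{xⁱ}, wⁱ_{vⁱ}, eⁱ | u)`. Summing over
`i` with weights `wᵢ` and dividing leaves the objective function.

*Size.* An outcome variable of component `i` gets one more parent, but all rows with `H ≠ hᵢ` have
the same value, so that a single row, for any state other than `hᵢ`, is added to its table.

*Polynomial time.* Functions that can be computed with a polynomial bound on the cost are closed
under composition, case distinction and iteration over a list, provided that the accumulator of the
iteration stays polynomially bounded.
-/

/-! ### Functions computed in polynomial time -/

theorem Data.size_pos (x : Data) : 1 ≤ x.size := by cases x <;> simp [Data.size]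

theorem Data.size_tail_le (x : Data) : x.tail.size ≤ x.size := by
  cases x <;> simp only [Data.tail, Data.size] <;> omega

theorem Runs.size_le {p : Prog} {x y : Data} {t : ℕ} (h : Runs p x y t) : y.size ≤ t := by
  induction h with
  | id x => exact le_rfl
  | nil x => exact x.size_pos
  | head x => cases x <;> simp only [Data.size, Data.head] <;> omega
  | tail x => exact x.size_tail_le
  | cons => simp only [Data.size]; omega
  | _ => omega

theorem eval_le_eval (b : Polynomial ℕ) {m n : ℕ} (h : m ≤ n) : b.eval m ≤ b.eval n := by
  simp only [Polynomial.eval_eq_sum_range]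
  exact Finset.sum_le_sum fun i _ => Nat.mul_le_mul_left _ (Nat.pow_le_pow_left h i)

/-- `p` transforms `x` into `y` at a cost that is at most the value of `b` at the size of `x`. -/
def RunsWithin (p : Prog) (b : Polynomial ℕ) (x y : Data) : Prop :=
  ∃ t ≤ b.eval x.size, Runs p x y t

namespace RunsWithin

variable {p q r : Prog} {b c d : Polynomial ℕ} {w x y z : Data}

theorem size_le (h : RunsWithin p b x y) : y.size ≤ b.eval x.size := by
  obtain ⟨t, ht, h⟩ := h
  exact h.size_le.trans ht

theorem id (x : Data) : RunsWithin Prog.id Polynomial.X x x := ⟨_, by simp, Runs.id x⟩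

theorem nil (x : Data) : RunsWithin Prog.nil Polynomial.X x Data.nil := ⟨_, by simp, Runs.nil x⟩

theorem head (x : Data) : RunsWithin Prog.head Polynomial.X x x.head := ⟨_, by simp, Runs.head x⟩

theorem tail (x : Data) : RunsWithin Prog.tail Polynomial.X x x.tail := ⟨_, by simp, Runs.tail x⟩

theorem cons (hp : RunsWithin p b x y) (hq : RunsWithin q c x z) :
    RunsWithin (Prog.cons p q) (Polynomial.X + b + c + 1) x (Data.cons y z) := by
  obtain ⟨s, hs, hp⟩ := hp
  obtain ⟨t, ht, hq⟩ := hq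
  exact ⟨_, by simp; omega, Runs.cons hp hq⟩

theorem seq (hp : RunsWithin p b x y) (hq : RunsWithin q c y z) :
    RunsWithin (Prog.seq p q) (b + c.comp b + 1) x z := by
  have hy := eval_le_eval c hp.size_le
  obtain ⟨s, hs, hp⟩ := hp
  obtain ⟨t, ht, hq⟩ := hq
  exact ⟨_, by simp; omega, Runs.seq hp hq⟩

theorem ite (hr : RunsWithin r d x w) (hp : w ≠ Data.nil → RunsWithin p b x y)
    (hq : w = Data.nil → RunsWithin q c x y) :
    RunsWithin (Prog.ite r p q) (Polynomial.X + d + b + c + 1) x y := by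
  obtain ⟨s, hs, hr⟩ := hr
  by_cases hw : w = Data.nil
  · obtain ⟨t, ht, hq⟩ := hq hw
    exact ⟨_, by simp; omega, Runs.iteFalse (hw ▸ hr) hq⟩
  · obtain ⟨t, ht, hp⟩ := hp hw
    exact ⟨_, by simp; omega, Runs.iteTrue hr hw hp⟩

theorem exists_const (y : Data) : ∃ p b, ∀ x, RunsWithin p b x y := by
  induction y with
  | nil => exact ⟨_, _, RunsWithin.nil⟩
  | cons y z hy hz =>
    obtain ⟨p, b, hp⟩ := hy
    obtain ⟨q, c, hq⟩ := hz
    exact ⟨_, _, fun x => (hp x).cons (hq x)⟩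

end RunsWithin

/-- Types whose elements are represented by trees. -/
class Enc (α : Type) where
  enc : α → Data

open Enc (enc)

namespace Enc

instance : Enc Data := ⟨id⟩
instance : Enc ℕ := ⟨Data.ofNat⟩
instance : Enc Bool := ⟨fun b => if b then Data.cons Data.nil Data.nil else Data.nil⟩
instance : Enc Unit := ⟨fun _ => Data.nil⟩
instance : Enc ℚ≥0 := ⟨Data.ofRat⟩
instance {α β : Type} [Enc α] [Enc β] : Enc (α × β) := ⟨fun p => Data.cons (enc p.1) (enc p.2)⟩
instance {α : Type} [Enc α] : Enc (List α) := ⟨Data.ofList enc⟩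
instance {α : Type} [Enc α] : Enc (Option α) := ⟨fun o => enc o.toList⟩
instance : Enc Mech := ⟨Data.ofMech⟩
instance : Enc Term := ⟨Data.ofTerm⟩
instance : Enc RMAPInput := ⟨Data.ofRMAP⟩
instance : Enc USInput := ⟨Data.ofUS⟩

theorem size_foldl_le {α β : Type} [Enc β] {g : β → α → β} {K : ℕ} {l : List α}
    (hg : ∀ s, ∀ a ∈ l, (enc (g s a)).size ≤ (enc s).size + K) (s : β) :
    (enc (l.foldl g s)).size ≤ (enc s).size + l.length * K := by
  induction l generalizing s with
  | nil => simp
  | cons a l ih =>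
    have hl := ih (fun s b hb => hg s b (List.mem_cons_of_mem _ hb)) (g s a)
    have ha := hg s a List.mem_cons_self
    simp only [List.foldl_cons, List.length_cons, Nat.succ_mul]
    omega

variable {α β : Type} [Enc α] [Enc β]

theorem size_pair (a : α) (b : β) : (enc (a, b)).size = (enc a).size + (enc b).size + 1 := rfl

theorem size_nil : (enc ([] : List α)).size = 1 := rfl

theorem size_cons (a : α) (l : List α) :
    (enc (a :: l)).size = (enc a).size + (enc l).size + 1 := rfl

theorem cons_ne_nil (a : α) (l : List α) : enc (a :: l) ≠ Data.nil := Data.noConfusion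

theorem size_append (l m : List α) :
    (enc (l ++ m)).size + 1 = (enc l).size + (enc m).size := by
  induction l with
  | nil => simp only [List.nil_append, size_nil]; omega
  | cons a l ih => simp only [List.cons_append, size_cons]; omega

theorem length_lt_size (l : List α) : l.length < (enc l).size := by
  induction l with
  | nil => simp [size_nil]
  | cons a l ih => simp only [List.length_cons, size_cons]; omega

theorem size_le_of_prefix {l m : List α} (h : l <+: m) : (enc l).size ≤ (enc m).size := by
  obtain ⟨r, rfl⟩ := h
  have := size_append l r
  have := Data.size_pos (enc r)
  omega

theorem size_le_of_mem {a : α} {l : List α} (h : a ∈ l) : (enc a).size ≤ (enc l).size := by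
  induction h with
  | head l => simp only [size_cons]; omega
  | tail b _ ih => simp only [size_cons]; omega

theorem size_nat (n : ℕ) : (enc n).size = 2 * n + 1 := by
  induction n with
  | zero => rfl
  | succ n ih =>
    change (Data.cons Data.nil (enc n)).size = _
    simp only [Data.size, ih]
    omega

theorem size_bool_le (b : Bool) : (enc b).size ≤ 3 := by cases b <;> decide

theorem nat_eq_replicate (n : ℕ) : enc n = enc (List.replicate n ()) := by
  induction n with
  | zero => rfl
  | succ n ih => exact congrArg (Data.cons Data.nil) ih

theorem size_zipIdx_le (l : List α) (i : ℕ) :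
    (enc (l.zipIdx i)).size ≤ (enc l).size + l.length * (2 * (i + l.length) + 2) := by
  induction l generalizing i with
  | nil => simp [size_nil]
  | cons a l ih =>
    have := ih (i + 1)
    simp only [List.zipIdx_cons, size_cons, size_pair, size_nat, List.length_cons]
    nlinarith

end Enc

theorem foldl_eq_zipIdx {α : Type} (l : List α) :
    l.foldl (fun (s : ℕ × List (α × ℕ)) a => (s.1 + 1, s.2 ++ [(a, s.1)])) (0, []) =
      (l.length, l.zipIdx) := by
  induction l using List.reverseRecOn with
  | nil => rfl
  | append_singleton l a ih => simp [ih, List.zipIdx_append]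

/-- `f` is computed in polynomial time. -/
@[fun_prop]
def IsPolyTime {α β : Type} [Enc α] [Enc β] (f : α → β) : Prop :=
  ∃ p b, ∀ a, RunsWithin p b (enc a) (enc (f a))

namespace IsPolyTime

section Basic

variable {α β γ δ ε ζ : Type} [Enc α] [Enc β] [Enc γ] [Enc δ] [Enc ε] [Enc ζ]

theorem exists_size_le {f : α → β} (h : IsPolyTime f) :
    ∃ b : Polynomial ℕ, ∀ a, (enc (f a)).size ≤ b.eval (enc a).size := by
  obtain ⟨p, b, h⟩ := h
  exact ⟨b, fun a => (h a).size_le⟩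

theorem of_enc_eq {f : α → β} (h : ∀ a, enc (f a) = enc a) : IsPolyTime f :=
  ⟨Prog.id, Polynomial.X, fun a => (h a).symm ▸ RunsWithin.id _⟩

theorem of_enc_eq_head {f : α → β} (h : ∀ a, enc (f a) = (enc a).head) : IsPolyTime f :=
  ⟨_, _, fun a => h a ▸ RunsWithin.head _⟩

theorem of_enc_eq_tail {f : α → β} (h : ∀ a, enc (f a) = (enc a).tail) : IsPolyTime f :=
  ⟨_, _, fun a => h a ▸ RunsWithin.tail _⟩

theorem of_enc_eq_cons {f : α → β} {g : α → γ} {h : α → δ} (hf : IsPolyTime f)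
    (hg : IsPolyTime g) (hh : ∀ a, enc (h a) = Data.cons (enc (f a)) (enc (g a))) :
    IsPolyTime h := by
  obtain ⟨p, b, hp⟩ := hf
  obtain ⟨q, c, hq⟩ := hg
  exact ⟨_, _, fun a => hh a ▸ (hp a).cons (hq a)⟩

@[fun_prop]
theorem id : IsPolyTime fun a : α => a := of_enc_eq fun _ => rfl

@[fun_prop]
theorem const (b : β) : IsPolyTime fun _ : α => b := by
  obtain ⟨p, c, h⟩ := RunsWithin.exists_const (enc b)
  exact ⟨p, c, fun a => h _⟩

@[fun_prop]
theorem comp {f : β → γ} {g : α → β} (hf : IsPolyTime f) (hg : IsPolyTime g) :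
    IsPolyTime fun a => f (g a) := by
  obtain ⟨p, b, hp⟩ := hf
  obtain ⟨q, c, hq⟩ := hg
  exact ⟨_, _, fun a => (hq a).seq (hp _)⟩

@[fun_prop]
theorem prodMk {f : α → β} {g : α → γ} (hf : IsPolyTime f) (hg : IsPolyTime g) :
    IsPolyTime fun a => (f a, g a) := of_enc_eq_cons hf hg fun _ => rfl

@[fun_prop]
theorem fst {f : α → β × γ} (hf : IsPolyTime f) : IsPolyTime fun a => (f a).1 :=
  comp (of_enc_eq_head (f := Prod.fst) fun _ => rfl) hf

@[fun_prop]
theorem snd {f : α → β × γ} (hf : IsPolyTime f) : IsPolyTime fun a => (f a).2 :=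
  comp (of_enc_eq_tail (f := Prod.snd) fun _ => rfl) hf

@[fun_prop]
theorem list_cons {f : α → β} {g : α → List β} (hf : IsPolyTime f) (hg : IsPolyTime g) :
    IsPolyTime fun a => f a :: g a := of_enc_eq_cons hf hg fun _ => rfl

@[fun_prop]
theorem nat_pred {f : α → ℕ} (hf : IsPolyTime f) : IsPolyTime fun a => (f a).pred :=
  comp (of_enc_eq_tail (f := Nat.pred) fun n => by cases n <;> rfl) hf

@[fun_prop]
theorem nat_succ {f : α → ℕ} (hf : IsPolyTime f) : IsPolyTime fun a => f a + 1 :=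
  of_enc_eq_cons (const ()) hf fun _ => rfl

@[fun_prop]
theorem option_some {f : α → β} (hf : IsPolyTime f) : IsPolyTime fun a => some (f a) :=
  of_enc_eq_cons hf (const ()) fun _ => rfl

@[fun_prop]
theorem option_toList {f : α → Option β} (hf : IsPolyTime f) : IsPolyTime fun a => (f a).toList :=
  comp (of_enc_eq fun _ => rfl) hf

/-- Case distinction on the shape of a tree: each branch may reread the tree `d a` as an element
of a type of its own. -/
theorem of_cases {c : α → γ} {d : α → Data} {f : α × ε → δ} {g : α × ζ → δ} {h : α → δ}
    (hc : IsPolyTime c) (hd : IsPolyTime d) (hf : IsPolyTime f) (hg : IsPolyTime g)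
    (hnil : ∀ a, enc (c a) = Data.nil → ∃ x, enc x = d a ∧ h a = f (a, x))
    (hcons : ∀ a, enc (c a) ≠ Data.nil → ∃ x, enc x = d a ∧ h a = g (a, x)) : IsPolyTime h := by
  obtain ⟨pc, bc, hc⟩ := hc
  obtain ⟨pd, bd, hd⟩ := hd
  obtain ⟨pf, bf, hf⟩ := hf
  obtain ⟨pg, bg, hg⟩ := hg
  have hread : ∀ {η : Type} [Enc η] {k : α × η → δ} {q : Prog} {b : Polynomial ℕ},
      (∀ y, RunsWithin q b (enc y) (enc (k y))) → ∃ q' b', ∀ a x, enc x = d a →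
        RunsWithin q' b' (enc a) (enc (k (a, x))) :=
    fun hk => ⟨_, _, fun a x hx => ((RunsWithin.id _).cons (hd a)).seq
      (hx ▸ (show RunsWithin _ _ (Data.cons (enc a) (enc x)) _ from hk (a, x)))⟩
  obtain ⟨pf, bf, hf⟩ := hread hf
  obtain ⟨pg, bg, hg⟩ := hread hg
  refine ⟨pc.ite pg pf, _, fun a =>
    (hc a).ite (b := bg) (c := bf) (fun hne => ?_) fun heq => ?_⟩
  · obtain ⟨x, hx, ha⟩ := hcons a hne
    exact ha ▸ hg a x hx
  · obtain ⟨x, hx, ha⟩ := hnil a heq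
    exact ha ▸ hf a x hx

theorem of_branch {c : α → γ} {f g h : α → δ} (hc : IsPolyTime c) (hf : IsPolyTime f)
    (hg : IsPolyTime g) (hnil : ∀ a, enc (c a) = Data.nil → h a = f a)
    (hcons : ∀ a, enc (c a) ≠ Data.nil → h a = g a) : IsPolyTime h :=
  of_cases (f := fun p : α × Unit => f p.1) (g := fun p : α × Unit => g p.1) hc (const Data.nil)
    (comp hf (fst id)) (comp hg (fst id)) (fun a ha => ⟨(), rfl, hnil a ha⟩)
    fun a ha => ⟨(), rfl, hcons a ha⟩

@[fun_prop]
theorem ite {c : α → Prop} [∀ a, Decidable (c a)] {f g : α → β}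
    (hc : IsPolyTime fun a => decide (c a)) (hf : IsPolyTime f) (hg : IsPolyTime g) :
    IsPolyTime fun a => if c a then f a else g a := by
  refine of_branch hc hg hf (fun a h => ?_) (fun a h => ?_) <;>
    by_cases hca : c a <;> simp [hca, enc] at h ⊢

theorem list_casesOn {l : α → List β} {f : α → δ} {g : α → β → List β → δ} (hl : IsPolyTime l)
    (hf : IsPolyTime f) (hg : IsPolyTime fun p : α × β × List β => g p.1 p.2.1 p.2.2) :
    IsPolyTime fun a => List.casesOn (motive := fun _ => δ) (l a) (f a) (g a) := by
  refine of_cases (d := fun a => enc (l a)) (f := fun p : α × List β => f p.1) hl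
    (comp (of_enc_eq fun _ => rfl) hl) (comp hf (fst id)) hg (fun a ha => ?_) fun a ha => ?_
  all_goals dsimp only at ha ⊢; cases hla : l a
  · exact ⟨[], rfl, rfl⟩
  · exact absurd (hla ▸ ha) (Enc.cons_ne_nil _ _)
  · exact absurd (hla ▸ rfl) ha
  case cons x m => exact ⟨(x, m), rfl, rfl⟩

theorem option_casesOn {o : α → Option β} {f : α → δ} {g : α × β → δ} (ho : IsPolyTime o)
    (hf : IsPolyTime f) (hg : IsPolyTime g) :
    IsPolyTime fun a => Option.casesOn (motive := fun _ => δ) (o a) (f a) fun x => g (a, x) := by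
  have hg' : IsPolyTime fun p : α × β × List β => g (p.1, p.2.1) := by fun_prop
  convert list_casesOn (g := fun a x _ => g (a, x)) (option_toList ho) hf hg' using 2 with a
  cases o a <;> rfl

theorem mech_casesOn {m : α → Mech} {f : α × List ℚ≥0 → δ}
    {g : α × List Var × ℕ × List (List ℕ × ℕ) → δ} (hm : IsPolyTime m) (hf : IsPolyTime f)
    (hg : IsPolyTime g) :
    IsPolyTime fun a => Mech.casesOn (motive := fun _ => δ) (m a) (fun θ => f (a, θ))
      fun pa k rows => g (a, pa, k, rows) := by
  refine of_cases (c := fun a => (enc (m a)).head) (d := fun a => (enc (m a)).tail)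
    (comp (of_enc_eq_head fun _ => rfl) hm) (comp (of_enc_eq_tail fun _ => rfl) hm) hf hg
    (fun a ha => ?_) fun a ha => ?_
  all_goals dsimp only at ha ⊢; cases hma : m a
  case refine_1.exo θ => exact ⟨θ, rfl, rfl⟩
  case refine_1.endo => exact absurd (hma ▸ ha) Data.noConfusion
  case refine_2.exo => exact absurd (hma ▸ rfl) ha
  case refine_2.endo pa k rows => exact ⟨(pa, k, rows), rfl, rfl⟩

@[fun_prop]
theorem bool_not {f : α → Bool} (hf : IsPolyTime f) : IsPolyTime fun a => !(f a) := by
  refine of_branch hf (const true) (const false) (fun a h => ?_) (fun a h => ?_) <;>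
    cases hfa : f a <;> simp [hfa, enc] at h ⊢

@[fun_prop]
theorem bool_and {f g : α → Bool} (hf : IsPolyTime f) (hg : IsPolyTime g) :
    IsPolyTime fun a => f a && g a := by
  refine of_branch hf (const false) hg (fun a h => ?_) (fun a h => ?_) <;>
    cases hfa : f a <;> simp [hfa, enc] at h ⊢

@[fun_prop]
theorem bool_or {f g : α → Bool} (hf : IsPolyTime f) (hg : IsPolyTime g) :
    IsPolyTime fun a => f a || g a := by
  refine of_branch hf hg (const true) (fun a h => ?_) (fun a h => ?_) <;>
    cases hfa : f a <;> simp [hfa, enc] at h ⊢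

theorem nat_eq_zero {f : α → ℕ} (hf : IsPolyTime f) : IsPolyTime fun a => decide (f a = 0) := by
  refine of_branch hf (const true) (const false) (fun a h => ?_) (fun a h => ?_) <;>
    cases hfa : f a <;> simp [hfa, enc, Data.ofNat] at h ⊢

end Basic

section Lists

variable {α β γ σ : Type} [Enc α] [Enc β] [Enc γ] [Enc σ]

theorem exists_runs_loop {g : γ → σ → α → σ} {pc pb : Prog} {bc bb : Polynomial ℕ}
    (hc : ∀ q : γ × σ × List α, RunsWithin pc bc (enc q) (enc q.2.2))
    (hb : ∀ q : γ × σ × α × List α,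
      RunsWithin pb bb (enc q) (enc (q.1, g q.1 q.2.1 q.2.2.1, q.2.2.2)))
    (c : γ) (K M : ℕ) (l : List α) (s : σ)
    (hK : ∀ l', l' <+: l → (enc (l'.foldl (g c) s)).size ≤ K)
    (hM : (enc c).size + K + (enc l).size + 2 ≤ M) :
    ∃ t ≤ (l.length + 1) * (M + bc.eval M + bb.eval M + 1),
      Runs (Prog.loop pc pb) (enc (c, s, l)) (enc (c, l.foldl (g c) s, ([] : List α))) t := by
  have hs : (enc (c, s, l)).size ≤ M := by
    have := hK [] List.nil_prefix
    simp only [Enc.size_pair, List.foldl_nil] at this ⊢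
    omega
  obtain ⟨t, ht, hct⟩ := hc (c, s, l)
  have hcM := eval_le_eval bc hs
  induction l generalizing s t with
  | nil => exact ⟨_, by simp only [List.length_nil]; omega, Runs.loopStop hct⟩
  | cons a l ih =>
    obtain ⟨u, hu, hbu⟩ := hb (c, s, a, l)
    have hK' : ∀ l', l' <+: l → (enc (l'.foldl (g c) (g c s a))).size ≤ K :=
      fun l' hl' => hK (a :: l') (by simpa using hl')
    have hM' : (enc c).size + K + (enc l).size + 2 ≤ M := by
      simp only [Enc.size_cons] at hM; omega
    have hs' : (enc (c, g c s a, l)).size ≤ M := by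
      have := hK' [] List.nil_prefix
      simp only [Enc.size_pair, List.foldl_nil] at this ⊢
      omega
    obtain ⟨t', ht', hct'⟩ := hc (c, g c s a, l)
    obtain ⟨v, hv, hloop⟩ := ih _ hK' hM' hs' t' ht' hct' (eval_le_eval bc hs')
    refine ⟨_, ?_, Runs.loopStep hct (Enc.cons_ne_nil a l) hbu hloop⟩
    have hbM : u ≤ bb.eval M := hu.trans (eval_le_eval bb hs)
    rw [List.length_cons, Nat.succ_mul]
    omega

theorem foldl {g : γ → σ → α → σ} {l : γ → List α} {s : γ → σ}
    (hg : IsPolyTime fun p : γ × σ × α => g p.1 p.2.1 p.2.2) (hl : IsPolyTime l)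
    (hs : IsPolyTime s)
    (hB : ∃ B : Polynomial ℕ, ∀ c l', l' <+: l c →
      (enc (l'.foldl (g c) (s c))).size ≤ B.eval (enc c).size) :
    IsPolyTime fun c => (l c).foldl (g c) (s c) := by
  obtain ⟨B, hB⟩ := hB
  obtain ⟨d, hd⟩ := hl.exists_size_le
  obtain ⟨pi, bi, hi⟩ := prodMk id (prodMk hs hl)
  obtain ⟨pc, bc, hc⟩ : IsPolyTime fun q : γ × σ × List α => q.2.2 := by fun_prop
  obtain ⟨pb, bb, hb⟩ :
      IsPolyTime fun q : γ × σ × α × List α => (q.1, g q.1 q.2.1 q.2.2.1, q.2.2.2) :=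
    prodMk (by fun_prop) (prodMk (comp hg (g := fun q : γ × σ × α × List α =>
      (q.1, q.2.1, q.2.2.1)) (by fun_prop)) (by fun_prop))
  obtain ⟨po, bo, ho⟩ : IsPolyTime fun q : γ × σ × List α => q.2.1 := by fun_prop
  let N : Polynomial ℕ := Polynomial.X + B + d + 2
  refine ⟨Prog.seq pi (Prog.seq (Prog.loop pc pb) po),
    bi + (d * (N + bc.comp N + bb.comp N + 1) + bo.comp N + 1) + 1, fun c => ?_⟩
  have hN : N.eval (enc c).size = (enc c).size + B.eval (enc c).size + d.eval (enc c).size + 2 := by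
    simp [N]
  have hlc := hd c
  have hres := hB c _ (List.prefix_refl _)
  obtain ⟨t, ht, hrun⟩ := hi c
  obtain ⟨u, hu, hloop⟩ := exists_runs_loop hc hb c (B.eval (enc c).size) (N.eval (enc c).size)
    (l c) (s c) (hB c) (by omega)
  obtain ⟨v, hv, hout⟩ := ho (c, (l c).foldl (g c) (s c), [])
  have hvN : v ≤ bo.eval (N.eval (enc c).size) := hv.trans <| eval_le_eval bo <| by
    have := Data.size_pos (enc (l c))
    simp only [Enc.size_pair, Enc.size_nil]
    omega
  have hsteps := hu.trans <| Nat.mul_le_mul_right _ <| (Enc.length_lt_size (l c)).trans_le hlc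
  refine ⟨_, ?_, Runs.seq hrun (Runs.seq hloop hout)⟩
  simp only [Polynomial.eval_add, Polynomial.eval_comp, Polynomial.eval_one, Polynomial.eval_mul]
  omega

theorem foldl_of_growth {g : γ → σ → α → σ} {l : γ → List α} {s : γ → σ}
    (hg : IsPolyTime fun p : γ × σ × α => g p.1 p.2.1 p.2.2) (hl : IsPolyTime l)
    (hs : IsPolyTime s)
    (hB : ∃ B : Polynomial ℕ, ∀ c s a,
      (enc (g c s a)).size ≤ (enc s).size + B.eval (enc (c, a)).size) :
    IsPolyTime fun c => (l c).foldl (g c) (s c) := by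
  obtain ⟨B, hB⟩ := hB
  obtain ⟨d, hd⟩ := hl.exists_size_le
  obtain ⟨e, he⟩ := hs.exists_size_le
  refine foldl hg hl hs ⟨e + d * B.comp (Polynomial.X + d + 1), fun c l' hl' => ?_⟩
  have hlc := hd c
  have hgrowth : ∀ s, ∀ a ∈ l', (enc (g c s a)).size ≤
      (enc s).size + B.eval ((enc c).size + d.eval (enc c).size + 1) := fun s a ha => by
    have hal := Enc.size_le_of_mem (hl'.subset ha)
    refine (hB c s a).trans (Nat.add_le_add_left (eval_le_eval B ?_) _)
    rw [Enc.size_pair]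
    omega
  have hlength : l'.length ≤ d.eval (enc c).size :=
    hl'.length_le.trans ((Enc.length_lt_size (l c)).le.trans hlc)
  simpa using (Enc.size_foldl_le hgrowth (s c)).trans
    (Nat.add_le_add (he c) (Nat.mul_le_mul_right _ hlength))

theorem list_foldl_cons {l m : γ → List α} (hl : IsPolyTime l) (hm : IsPolyTime m) :
    IsPolyTime fun c => (l c).foldl (fun s a => a :: s) (m c) :=
  foldl_of_growth (g := fun _ s a => a :: s) (by fun_prop) hl hm ⟨Polynomial.X + 1, fun c s a => by
    simp only [Enc.size_cons, Enc.size_pair, Polynomial.eval_add, Polynomial.eval_X,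
      Polynomial.eval_one]
    omega⟩

@[fun_prop]
theorem list_append {l m : γ → List α} (hl : IsPolyTime l) (hm : IsPolyTime m) :
    IsPolyTime fun c => l c ++ m c := by
  simpa using list_foldl_cons (list_foldl_cons hl (const [])) hm

@[fun_prop]
theorem list_flatMap {l : γ → List α} {f : γ → α → List β} (hl : IsPolyTime l)
    (hf : IsPolyTime fun p : γ × α => f p.1 p.2) : IsPolyTime fun c => (l c).flatMap (f c) := by
  obtain ⟨b, hb⟩ := hf.exists_size_le
  have happend : IsPolyTime fun p : γ × List β × α => p.2.1 ++ f p.1 p.2.2 :=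
    list_append (by fun_prop) (comp hf (g := fun p : γ × List β × α => (p.1, p.2.2)) (by fun_prop))
  have hfold := foldl_of_growth (g := fun c s a => s ++ f c a) happend hl (const []) ⟨b, by
    intro c s a
    have hsize := Enc.size_append s (f c a)
    have hfca : (enc (f c a)).size ≤ _ := hb (c, a)
    omega⟩
  simpa only [List.foldl_append_eq_append, List.nil_append, List.flatMap_def] using hfold

@[fun_prop]
theorem list_map {l : γ → List α} {f : γ → α → β} (hl : IsPolyTime l)
    (hf : IsPolyTime fun p : γ × α => f p.1 p.2) : IsPolyTime fun c => (l c).map (f c) := by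
  simpa only [List.map_eq_flatMap] using
    list_flatMap (f := fun c a => [f c a]) hl (list_cons hf (const []))

@[fun_prop]
theorem list_filterMap {l : γ → List α} {f : γ → α → Option β} (hl : IsPolyTime l)
    (hf : IsPolyTime fun p : γ × α => f p.1 p.2) : IsPolyTime fun c => (l c).filterMap (f c) := by
  simpa only [List.filterMap_eq_flatMap_toList] using
    list_flatMap (f := fun c a => (f c a).toList) hl (option_toList hf)

@[fun_prop]
theorem list_head? {l : γ → List α} (hl : IsPolyTime l) : IsPolyTime fun c => (l c).head? := by
  convert list_casesOn (f := fun _ => none) (g := fun _ a _ => some a) hl (const none)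
    (by fun_prop) using 2 with c
  cases l c <;> rfl

@[fun_prop]
theorem list_any {l : γ → List α} {f : γ → α → Bool} (hl : IsPolyTime l)
    (hf : IsPolyTime fun p : γ × α => f p.1 p.2) : IsPolyTime fun c => (l c).any (f c) := by
  have hor : IsPolyTime fun p : γ × Bool × α => p.2.1 || f p.1 p.2.2 :=
    bool_or (by fun_prop) (comp hf (g := fun p : γ × Bool × α => (p.1, p.2.2)) (by fun_prop))
  have hfold := foldl_of_growth (g := fun c s a => s || f c a) hor hl (const false)
    ⟨3, fun c s a => (Enc.size_bool_le _).trans (by simp)⟩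
  have hfoldl : ∀ c (m : List α) (s : Bool),
      m.foldl (fun s a => s || f c a) s = (s || m.any (f c)) :=
    fun c m => by
      induction m with
      | nil => simp
      | cons a m ih => intro s; simp [ih, Bool.or_assoc]
  simpa [hfoldl] using hfold

@[fun_prop]
theorem list_all {l : γ → List α} {f : γ → α → Bool} (hl : IsPolyTime l)
    (hf : IsPolyTime fun p : γ × α => f p.1 p.2) : IsPolyTime fun c => (l c).all (f c) := by
  simpa [List.any_eq_not_all_not] using
    bool_not (list_any (f := fun c a => !f c a) hl (bool_not hf))

@[fun_prop]
theorem list_replicate_unit {f : γ → ℕ} (hf : IsPolyTime f) :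
    IsPolyTime fun c => List.replicate (f c) () :=
  comp (f := fun n => List.replicate n ()) (of_enc_eq fun n => (Enc.nat_eq_replicate n).symm) hf

@[fun_prop]
theorem list_length {l : γ → List α} (hl : IsPolyTime l) : IsPolyTime fun c => (l c).length := by
  have hunits : IsPolyTime fun m : List Unit => m.length := of_enc_eq fun m => by
    rw [Enc.nat_eq_replicate]
    exact congrArg enc (List.eq_replicate_of_mem fun _ _ => rfl).symm
  simpa using comp hunits (list_map (f := fun _ _ => ()) hl (const ()))

@[fun_prop]
theorem nat_sub {f g : γ → ℕ} (hf : IsPolyTime f) (hg : IsPolyTime g) :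
    IsPolyTime fun c => f c - g c := by
  have hfold := foldl_of_growth (g := fun _ (s : ℕ) (_ : Unit) => s.pred) (by fun_prop)
    (list_replicate_unit hg) hf ⟨0, fun c s a => by
      simp only [Enc.size_nat, Nat.pred_eq_sub_one, Polynomial.eval_zero]; omega⟩
  have hfoldl : ∀ n s : ℕ, (List.replicate n ()).foldl (fun s _ => s.pred) s = s - n := by
    intro n
    induction n with
    | zero => simp
    | succ n ih =>
      intro s
      rw [List.replicate_succ, List.foldl_cons, ih, Nat.pred_eq_sub_one]
      omega
  simpa only [hfoldl] using hfold

@[fun_prop]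
theorem nat_eq {f g : γ → ℕ} (hf : IsPolyTime f) (hg : IsPolyTime g) :
    IsPolyTime fun c => decide (f c = g c) := by
  convert bool_and (nat_eq_zero (nat_sub hf hg)) (nat_eq_zero (nat_sub hg hf)) using 2 with c
  rw [← Bool.decide_and]
  congr 1
  simp only [eq_iff_iff]
  omega

@[fun_prop]
theorem list_zipIdx {l : γ → List α} (hl : IsPolyTime l) : IsPolyTime fun c => (l c).zipIdx := by
  obtain ⟨d, hd⟩ := hl.exists_size_le
  have hfold := foldl (g := fun _ (s : ℕ × List (α × ℕ)) a => (s.1 + 1, s.2 ++ [(a, s.1)]))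
    (s := fun _ => (0, [])) (by fun_prop) hl (by fun_prop)
    ⟨2 * d + 2 + d + d * (2 * d + 2), fun c l' hl' => by
      have hl'd := (Enc.size_le_of_prefix hl').trans (hd c)
      have hlength := Enc.length_lt_size l'
      have hzip := Enc.size_zipIdx_le l' 0
      have hmul : l'.length * (2 * (0 + l'.length) + 2) ≤
          d.eval (enc c).size * (2 * d.eval (enc c).size + 2) :=
        Nat.mul_le_mul (by omega) (by omega)
      simp only [foldl_eq_zipIdx, Enc.size_pair, Enc.size_nat, Polynomial.eval_add,
        Polynomial.eval_mul, Polynomial.eval_ofNat]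
      omega⟩
  simpa only [foldl_eq_zipIdx] using snd hfold

@[fun_prop]
theorem list_range {f : γ → ℕ} (hf : IsPolyTime f) : IsPolyTime fun c => List.range (f c) := by
  have hsnd : IsPolyTime fun c => (List.replicate (f c) ()).zipIdx.map Prod.snd := by fun_prop
  simpa [List.zipIdx_map_snd, List.range_eq_range'] using hsnd

/-- Two lists are equal as soon as they have the same entries at the same positions. -/
theorem list_eq [DecidableEq α] {l m : γ → List α} (hl : IsPolyTime l) (hm : IsPolyTime m)
    (hα : IsPolyTime fun p : α × α => decide (p.1 = p.2)) :
    IsPolyTime fun c => decide (l c = m c) := by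
  have hsubset : ∀ {l m : γ → List α}, IsPolyTime l → IsPolyTime m → IsPolyTime fun c =>
      (l c).zipIdx.all fun p => (m c).zipIdx.any fun q =>
        decide (p.1 = q.1) && decide (p.2 = q.2) := fun {l m} hl hm => by
    refine list_all (by fun_prop) (list_any (by fun_prop) (bool_and ?_ (by fun_prop)))
    exact comp hα (g := fun p : (γ × α × ℕ) × α × ℕ => (p.1.2.1, p.2.1)) (by fun_prop)
  convert bool_and (hsubset hl hm) (hsubset hm hl) using 2 with c
  have hmem : ∀ l m : List α, (l.zipIdx.all fun p => m.zipIdx.any fun q =>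
      decide (p.1 = q.1) && decide (p.2 = q.2)) = true ↔ ∀ p ∈ l.zipIdx, p ∈ m.zipIdx := by
    intro l m
    simp only [← Bool.decide_and, ← Prod.ext_iff, List.all_eq_true, List.any_eq_true,
      decide_eq_true_eq, exists_eq_right']
  rw [Bool.eq_iff_iff, Bool.and_eq_true, hmem, hmem, decide_eq_true_eq]
  refine ⟨fun h => by simp [h], fun ⟨hlm, hml⟩ => List.ext_getElem? fun i => Option.ext fun a => ?_⟩
  rw [← List.mk_mem_zipIdx_iff_getElem?, ← List.mk_mem_zipIdx_iff_getElem?]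
  exact ⟨hlm _, hml _⟩

@[fun_prop]
theorem var_eq {f g : γ → Var} (hf : IsPolyTime f) (hg : IsPolyTime g) :
    IsPolyTime fun c => decide (f c = g c) := list_eq hf hg (by fun_prop)

@[fun_prop]
theorem var_mem {f : γ → Var} {l : γ → List Var} (hf : IsPolyTime f) (hl : IsPolyTime l) :
    IsPolyTime fun c => decide (f c ∈ l c) := by
  convert list_any (f := fun c v => decide (v = f c)) hl (by fun_prop) using 2 with c
  rw [Bool.eq_iff_iff]
  simp

@[fun_prop]
theorem lookup {f : γ → Var} {l : γ → List (Var × β)} (hf : IsPolyTime f) (hl : IsPolyTime l) :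
    IsPolyTime fun c => (l c).lookup (f c) := by
  have hhead : IsPolyTime fun c =>
      ((l c).filterMap fun p => if f c = p.1 then some p.2 else none).head? := by fun_prop
  convert hhead using 2 with c
  rw [List.lookup_eq_findSome?, List.head?_filterMap]
  simp only [beq_iff_eq]

end Lists

end IsPolyTime

/-! ### The objective model in pieces -/

namespace SCM

/-- The root variables of `G` that satisfy `p`, renamed by `f`, with their priors. -/
def renamedRoots (G : SCM) (p : Var → Prop) [DecidablePred p] (f : Var → Var) : SCM :=
  G.filterMap fun
    | (v, Mech.exo θ) => if p v then some (f v, Mech.exo θ) else none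
    | (_, Mech.endo _ _ _) => none

end SCM

/-- The distribution on `k` states that is concentrated in the state `s`. -/
def pointMass (k s : ℕ) : List ℚ≥0 := (List.range k).map fun a => if a = s then 1 else 0

/-- The table `rows` after a mixture variable with `n` states has been added in front of the
parents: the table applies when that variable has state `i`, otherwise the value is `z`. -/
def mixRows (n i z : ℕ) (rows : List (List ℕ × ℕ)) : List (List ℕ × ℕ) :=
  rows.flatMap fun r => (List.range n).map fun h => (h :: r.1, if h = i then r.2 else z)

namespace Objective

/-- The mechanism that `world` gives to the copy of an endogenous variable `v` with parents `pa`,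
`k` states and table `rows`. -/
def worldMech (G : SCM) (U : List Var) (n i j : ℕ) (act out : Inst) (v : Var) (pa : List Var)
    (k : ℕ) (rows : List (List ℕ × ℕ)) : Mech :=
  match act.lookup v with
  | some s => Mech.exo (pointMass k s)
  | none =>
    match out.lookup v with
    | none => Mech.endo (pa.map (copyVar G U i j)) k rows
    | some z => Mech.endo (mixVar :: pa.map (copyVar G U i j)) k (mixRows n i z rows)

theorem world_eq (G : SCM) (U : List Var) (n i j : ℕ) (act out : Inst) :
    world G U n i j act out = G.filterMap fun nd =>
      Mech.casesOn (motive := fun _ => Option (Var × Mech)) nd.2 (fun _ => none) fun pa k rows =>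
        some (endoVar i j nd.1, worldMech G U n i j act out nd.1 pa k rows) := by
  refine List.filterMap_congr fun nd _ => ?_
  obtain ⟨v, θ | ⟨pa, k, rows⟩⟩ := nd <;> rfl

theorem component_eq (G : SCM) (U : List Var) (n i : ℕ) (t : Term) :
    component G U n i t = G.renamedRoots (· ∉ U) (exoVar i) ++ world G U n i 0 [] [] ++
      world G U n i 1 t.x t.y ++ world G U n i 2 t.v t.w := by
  simp only [component, SCM.renamedRoots, ite_not]

theorem model_eq (I : USInput) :
    model I = (mixVar, Mech.exo (I.L.map Term.weight)) :: I.G.renamedRoots (· ∈ I.U) unitVar ++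
      I.L.zipIdx.flatMap fun c => component I.G I.U I.L.length c.2 c.1 := rfl

end Objective

/-! ### From Reverse-MAP to unit selection -/

/-- A distribution on `k` states (`k ≠ 0`) without null states. -/
def dyadicPrior (k : ℕ) : List ℚ≥0 :=
  (1 / 2) ^ (k - 1) :: (List.range (k - 1)).map fun i => (1 / 2) ^ (i + 1)

/-- The table of the identity function on `k` states. -/
def idTable (k : ℕ) : List (List ℕ × ℕ) := (List.range k).map fun a => ([a], a)

/-- The table that compares two variables with `k` states: `1` stands for equal states, `0` for
different ones. -/
def eqTable (k : ℕ) : List (List ℕ × ℕ) :=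
  (List.range k).flatMap fun a => (List.range k).map fun b => ([a, b], if a = b then 1 else 0)

namespace Targets

/-- The original of a variable. -/
def origVar (v : Var) : Var := 0 :: v

/-- An endogenous copy of a variable. -/
def copyVar (v : Var) : Var := 1 :: v

/-- An independent exogenous variable with the states of the variable `v`. -/
def targetVar (v : Var) : Var := 2 :: v

/-- Tells whether the independent variable has the same state as the original. -/
def matchVar (v : Var) : Var := 3 :: v

/-- The mechanism of the original of a variable. -/
def origMech : Mech → Mech
  | Mech.exo θ => Mech.exo θ
  | Mech.endo pa k rows => Mech.endo (pa.map origVar) k rows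

/-- The structural equation of the copy of a variable with `k` states. -/
def copyMech (v : Var) (k : ℕ) : Mech := Mech.endo [origVar v] k (idTable k)

/-- The structural equation of the comparison of a variable with `k` states. -/
def matchMech (v : Var) (k : ℕ) : Mech := Mech.endo [origVar v, targetVar v] 2 (eqTable k)

/-- The causal model of the unit selection problem to which a Reverse-MAP problem on `G` is
reduced. -/
def model (G : SCM) : SCM :=
  (G.map fun n => (origVar n.1, origMech n.2)) ++
  (G.map fun n => (copyVar n.1, copyMech n.1 n.2.card)) ++
  (G.map fun n => (targetVar n.1, Mech.exo (dyadicPrior n.2.card))) ++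
  G.map fun n => (matchVar n.1, matchMech n.1 n.2.card)

/-- The instantiation of the endogenous copies with the states given by `e`. -/
def copyInst (e : Inst) : Inst := e.map fun c => (copyVar c.1, c.2)

/-- The instantiation saying that each variable of `U` has the state of its independent variable. -/
def matchInst (U : List Var) : Inst := U.map fun v => (matchVar v, 1)

/-- The unit selection problem with one summand, whose unit variables are independent variables
that are compared with the target variables. -/
def toUS (I : RMAPInput) : USInput where
  G := model I.G
  U := I.U.map targetVar
  L := [⟨1, [], copyInst I.e₁, [], [], copyInst I.e₂ ++ matchInst I.U⟩]

end Targets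

/-! ### Both reductions run in polynomial time -/

namespace IsPolyTime

variable {γ : Type} [Enc γ]

@[fun_prop]
theorem mech_exo {θ : γ → List ℚ≥0} (h : IsPolyTime θ) : IsPolyTime fun c => Mech.exo (θ c) :=
  of_enc_eq_cons (const ()) h fun _ => rfl

@[fun_prop]
theorem mech_endo {pa : γ → List Var} {k : γ → ℕ} {rows : γ → List (List ℕ × ℕ)}
    (hpa : IsPolyTime pa) (hk : IsPolyTime k) (hrows : IsPolyTime rows) :
    IsPolyTime fun c => Mech.endo (pa c) (k c) (rows c) :=
  of_enc_eq_cons (const [()]) (prodMk hpa (prodMk hk hrows)) fun _ => rfl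

@[fun_prop]
theorem mech_isExo {m : γ → Mech} (hm : IsPolyTime m) : IsPolyTime fun c => (m c).IsExo := by
  convert mech_casesOn (f := fun _ => true) (g := fun _ => false) hm (const _) (const _)
    using 2 with c
  cases m c <;> rfl

@[fun_prop]
theorem mech_card {m : γ → Mech} (hm : IsPolyTime m) : IsPolyTime fun c => (m c).card := by
  convert mech_casesOn (f := fun p => p.2.length) (g := fun p => p.2.2.1) hm (by fun_prop)
    (by fun_prop) using 2 with c
  cases m c <;> rfl

@[fun_prop]
theorem usInput_G {I : γ → USInput} (h : IsPolyTime I) : IsPolyTime fun c => (I c).G :=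
  comp (f := fun I : USInput => I.G) (of_enc_eq_head fun _ => rfl) h

theorem usInput_tail : IsPolyTime fun I : USInput => (I.U, I.L) :=
  of_enc_eq_tail fun _ => rfl

@[fun_prop]
theorem usInput_U {I : γ → USInput} (h : IsPolyTime I) : IsPolyTime fun c => (I c).U :=
  comp (fst usInput_tail) h

@[fun_prop]
theorem usInput_L {I : γ → USInput} (h : IsPolyTime I) : IsPolyTime fun c => (I c).L :=
  comp (snd usInput_tail) h

theorem usInput_mk {G : γ → SCM} {U : γ → List Var} {L : γ → List Term} (hG : IsPolyTime G)
    (hU : IsPolyTime U) (hL : IsPolyTime L) :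
    IsPolyTime fun c => USInput.mk (G c) (U c) (L c) :=
  of_enc_eq_cons hG (prodMk hU hL) fun _ => rfl

@[fun_prop]
theorem rmapInput_G {I : γ → RMAPInput} (h : IsPolyTime I) : IsPolyTime fun c => (I c).G :=
  comp (f := fun I : RMAPInput => I.G) (of_enc_eq_head fun _ => rfl) h

theorem rmapInput_tail : IsPolyTime fun I : RMAPInput => (I.U, I.e₁, I.e₂) :=
  of_enc_eq_tail fun _ => rfl

@[fun_prop]
theorem rmapInput_U {I : γ → RMAPInput} (h : IsPolyTime I) : IsPolyTime fun c => (I c).U :=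
  comp (fst rmapInput_tail) h

@[fun_prop]
theorem rmapInput_e₁ {I : γ → RMAPInput} (h : IsPolyTime I) : IsPolyTime fun c => (I c).e₁ :=
  comp (fst (snd rmapInput_tail)) h

@[fun_prop]
theorem rmapInput_e₂ {I : γ → RMAPInput} (h : IsPolyTime I) : IsPolyTime fun c => (I c).e₂ :=
  comp (snd (snd rmapInput_tail)) h

theorem rmapInput_mk {G : γ → SCM} {U : γ → List Var} {e₁ e₂ : γ → Inst} (hG : IsPolyTime G)
    (hU : IsPolyTime U) (he₁ : IsPolyTime e₁) (he₂ : IsPolyTime e₂) :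
    IsPolyTime fun c => RMAPInput.mk (G c) (U c) (e₁ c) (e₂ c) :=
  of_enc_eq_cons hG (prodMk hU (prodMk he₁ he₂)) fun _ => rfl

@[fun_prop]
theorem term_weight {t : γ → Term} (h : IsPolyTime t) : IsPolyTime fun c => (t c).weight :=
  comp (f := fun t : Term => t.weight) (of_enc_eq_head fun _ => rfl) h

theorem term_tail : IsPolyTime fun t : Term => (t.x, t.y, t.v, t.w, t.e) :=
  of_enc_eq_tail fun _ => rfl

@[fun_prop]
theorem term_x {t : γ → Term} (h : IsPolyTime t) : IsPolyTime fun c => (t c).x :=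
  comp (fst term_tail) h

@[fun_prop]
theorem term_y {t : γ → Term} (h : IsPolyTime t) : IsPolyTime fun c => (t c).y :=
  comp (fst (snd term_tail)) h

@[fun_prop]
theorem term_v {t : γ → Term} (h : IsPolyTime t) : IsPolyTime fun c => (t c).v :=
  comp (fst (snd (snd term_tail))) h

@[fun_prop]
theorem term_w {t : γ → Term} (h : IsPolyTime t) : IsPolyTime fun c => (t c).w :=
  comp (fst (snd (snd (snd term_tail)))) h

@[fun_prop]
theorem term_e {t : γ → Term} (h : IsPolyTime t) : IsPolyTime fun c => (t c).e :=
  comp (snd (snd (snd (snd term_tail)))) h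

theorem term_mk {weight : γ → ℚ≥0} {x y v w e : γ → Inst} (hweight : IsPolyTime weight)
    (hx : IsPolyTime x) (hy : IsPolyTime y) (hv : IsPolyTime v) (hw : IsPolyTime w)
    (he : IsPolyTime e) :
    IsPolyTime fun c => Term.mk (weight c) (x c) (y c) (v c) (w c) (e c) :=
  of_enc_eq_cons hweight (prodMk hx (prodMk hy (prodMk hv (prodMk hw he)))) fun _ => rfl

@[fun_prop]
theorem mem_exoVars {G : γ → SCM} {v : γ → Var} (hG : IsPolyTime G) (hv : IsPolyTime v) :
    IsPolyTime fun c => decide (v c ∈ (G c).exoVars) := by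
  convert list_any (f := fun c n => n.2.IsExo && decide (n.1 = v c)) hG (by fun_prop)
    using 2 with c
  rw [Bool.eq_iff_iff, decide_eq_true_iff]
  simp [SCM.exoVars, and_comm]

theorem renamedRoots {G : γ → SCM} {p : γ → Var → Prop} [∀ c, DecidablePred (p c)]
    {f : γ → Var → Var} (hG : IsPolyTime G)
    (hp : IsPolyTime fun q : γ × Var => decide (p q.1 q.2))
    (hf : IsPolyTime fun q : γ × Var => f q.1 q.2) :
    IsPolyTime fun c => (G c).renamedRoots (p c) (f c) := by
  have hpq : IsPolyTime fun q : (γ × Var × Mech) × List ℚ≥0 => decide (p q.1.1 q.1.2.1) :=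
    comp hp (g := fun q : (γ × Var × Mech) × List ℚ≥0 => (q.1.1, q.1.2.1)) (by fun_prop)
  have hfq : IsPolyTime fun q : (γ × Var × Mech) × List ℚ≥0 => f q.1.1 q.1.2.1 :=
    comp hf (g := fun q : (γ × Var × Mech) × List ℚ≥0 => (q.1.1, q.1.2.1)) (by fun_prop)
  refine list_filterMap hG ?_
  convert mech_casesOn (m := fun q : γ × Var × Mech => q.2.2) (δ := Option (Var × Mech))
    (f := fun q => if p q.1.1 q.1.2.1 then some (f q.1.1 q.1.2.1, Mech.exo q.2) else none)
    (g := fun _ => none) (by fun_prop)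
    (ite hpq (option_some (prodMk hfq (by fun_prop))) (by fun_prop)) (by fun_prop) using 2 with q
  obtain ⟨c, v, θ | ⟨pa, k, rows⟩⟩ := q <;> rfl

section Objective

@[fun_prop]
theorem unitVar {v : γ → Var} (h : IsPolyTime v) : IsPolyTime fun c => Objective.unitVar (v c) := by
  unfold Objective.unitVar
  fun_prop

@[fun_prop]
theorem exoVar {i : γ → ℕ} {v : γ → Var} (hi : IsPolyTime i) (hv : IsPolyTime v) :
    IsPolyTime fun c => Objective.exoVar (i c) (v c) := by
  unfold Objective.exoVar
  fun_prop

@[fun_prop]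
theorem endoVar {i j : γ → ℕ} {v : γ → Var} (hi : IsPolyTime i) (hj : IsPolyTime j)
    (hv : IsPolyTime v) : IsPolyTime fun c => Objective.endoVar (i c) (j c) (v c) := by
  unfold Objective.endoVar
  fun_prop

@[fun_prop]
theorem copyVar {G : γ → SCM} {U : γ → List Var} {i j : γ → ℕ} {v : γ → Var} (hG : IsPolyTime G)
    (hU : IsPolyTime U) (hi : IsPolyTime i) (hj : IsPolyTime j) (hv : IsPolyTime v) :
    IsPolyTime fun c => Objective.copyVar (G c) (U c) (i c) (j c) (v c) := by
  unfold Objective.copyVar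
  fun_prop

@[fun_prop]
theorem pointMass {k s : γ → ℕ} (hk : IsPolyTime k) (hs : IsPolyTime s) :
    IsPolyTime fun c => pointMass (k c) (s c) := by
  unfold _root_.pointMass
  fun_prop

@[fun_prop]
theorem mixRows {n i z : γ → ℕ} {rows : γ → List (List ℕ × ℕ)} (hn : IsPolyTime n)
    (hi : IsPolyTime i) (hz : IsPolyTime z) (hrows : IsPolyTime rows) :
    IsPolyTime fun c => mixRows (n c) (i c) (z c) (rows c) := by
  unfold _root_.mixRows
  fun_prop

variable {G : γ → SCM} {U : γ → List Var} {n i j : γ → ℕ} {act out : γ → Inst}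

theorem worldMech {v : γ → Var} {pa : γ → List Var} {k : γ → ℕ} {rows : γ → List (List ℕ × ℕ)}
    (hG : IsPolyTime G) (hU : IsPolyTime U) (hn : IsPolyTime n) (hi : IsPolyTime i)
    (hj : IsPolyTime j) (hact : IsPolyTime act) (hout : IsPolyTime out) (hv : IsPolyTime v)
    (hpa : IsPolyTime pa) (hk : IsPolyTime k) (hrows : IsPolyTime rows) :
    IsPolyTime fun c => Objective.worldMech (G c) (U c) (n c) (i c) (j c) (act c) (out c) (v c)
      (pa c) (k c) (rows c) := by
  have hforced : IsPolyTime fun p : γ × ℕ => Mech.exo (_root_.pointMass (k p.1) p.2) := by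
    fun_prop
  have hplain : IsPolyTime fun c => Mech.endo
      ((pa c).map (Objective.copyVar (G c) (U c) (i c) (j c))) (k c) (rows c) := by fun_prop
  have hmixed : IsPolyTime fun p : γ × ℕ => Mech.endo
      (Objective.mixVar :: (pa p.1).map (Objective.copyVar (G p.1) (U p.1) (i p.1) (j p.1)))
      (k p.1) (_root_.mixRows (n p.1) (i p.1) p.2 (rows p.1)) := by fun_prop
  convert option_casesOn (lookup hv hact) (option_casesOn (lookup hv hout) hplain hmixed) hforced
    using 2 with c
  unfold Objective.worldMech
  cases (act c).lookup (v c) <;> cases (out c).lookup (v c) <;> rfl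

@[fun_prop]
theorem world (hG : IsPolyTime G) (hU : IsPolyTime U) (hn : IsPolyTime n) (hi : IsPolyTime i)
    (hj : IsPolyTime j) (hact : IsPolyTime act) (hout : IsPolyTime out) :
    IsPolyTime fun c =>
      Objective.world (G c) (U c) (n c) (i c) (j c) (act c) (out c) := by
  have hmech : IsPolyTime fun p : (γ × Var × Mech) × List Var × ℕ × List (List ℕ × ℕ) =>
      Objective.worldMech (G p.1.1) (U p.1.1) (n p.1.1) (i p.1.1) (j p.1.1) (act p.1.1)
        (out p.1.1) p.1.2.1 p.2.1 p.2.2.1 p.2.2.2 := by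
    apply worldMech <;> fun_prop
  simp only [Objective.world_eq]
  exact list_filterMap hG (mech_casesOn (m := fun q : γ × Var × Mech => q.2.2)
    (f := fun _ => (none : Option (Var × Mech))) (by fun_prop) (by fun_prop)
    (option_some (prodMk (f := fun p => Objective.endoVar (i p.1.1) (j p.1.1) p.1.2.1)
      (by fun_prop) hmech)))

@[fun_prop]
theorem component {t : γ → Term} (hG : IsPolyTime G) (hU : IsPolyTime U) (hn : IsPolyTime n)
    (hi : IsPolyTime i) (ht : IsPolyTime t) :
    IsPolyTime fun c => Objective.component (G c) (U c) (n c) (i c) (t c) := by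
  simp only [Objective.component_eq]
  refine list_append (list_append (list_append (renamedRoots hG ?_ (by fun_prop)) (by fun_prop))
    (by fun_prop)) (by fun_prop)
  simpa only [decide_not] using bool_not (f := fun q : γ × Var => decide (q.2 ∈ U q.1))
    (by fun_prop)

theorem model : IsPolyTime Objective.model :=
  list_append (list_cons (f := fun I : USInput =>
      (Objective.mixVar, Mech.exo (I.L.map Term.weight)))
    (by fun_prop) (renamedRoots (p := fun (I : USInput) v => v ∈ I.U)
      (f := fun _ => Objective.unitVar) (by fun_prop) (by fun_prop) (by fun_prop))) (by fun_prop)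

@[fun_prop]
theorem copyInst {i j : γ → ℕ} {e : γ → Inst} (hi : IsPolyTime i) (hj : IsPolyTime j)
    (he : IsPolyTime e) : IsPolyTime fun c => Objective.copyInst (i c) (j c) (e c) := by
  unfold Objective.copyInst
  fun_prop

theorem toRMAP : IsPolyTime Objective.toRMAP :=
  rmapInput_mk model (by fun_prop) (by fun_prop) (by fun_prop)

end Objective

end IsPolyTime

theorem polyTime_toRMAP : OptProblem.PolyTime UnitSelection RMAP Objective.toRMAP := by
  obtain ⟨p, b, h⟩ := IsPolyTime.toRMAP
  exact ⟨p, b, fun I _ => h I⟩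

theorem bits_two_pow (n : ℕ) : Nat.bits (2 ^ n) = List.replicate n false ++ [true] := by
  induction n with
  | zero => simp
  | succ n ih =>
    rw [pow_succ', Nat.bit0_bits _ (by positivity), ih, List.replicate_succ, List.cons_append]

namespace IsPolyTime

variable {γ : Type} [Enc γ]

@[fun_prop]
theorem half_pow {n : γ → ℕ} (h : IsPolyTime n) : IsPolyTime fun c => (1 / 2 : ℚ≥0) ^ n c := by
  have hzeros : IsPolyTime fun c => (List.range (n c)).map fun _ => false := by fun_prop
  refine of_enc_eq_cons (const [true]) (list_append hzeros (const [true])) fun c => ?_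
  have hden : ((1 / 2 : ℚ≥0) ^ n c).den = 2 ^ n c := by
    rw [NNRat.den_pow, ← NNRat.den_coe]
    norm_num
  have hnum : ((1 / 2 : ℚ≥0) ^ n c).num = 1 := by
    rw [NNRat.num_pow, NNRat.num]
    norm_num
  change Data.cons (Data.ofNatBinary _) (Data.ofNatBinary _) = _
  rw [hden, hnum]
  unfold Data.ofNatBinary
  rw [bits_two_pow, List.map_const', List.length_range]
  rfl

@[fun_prop]
theorem dyadicPrior {k : γ → ℕ} (h : IsPolyTime k) : IsPolyTime fun c => dyadicPrior (k c) := by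
  unfold _root_.dyadicPrior
  fun_prop

section Targets

@[fun_prop]
theorem targets_origVar {v : γ → Var} (h : IsPolyTime v) :
    IsPolyTime fun c => Targets.origVar (v c) := by
  unfold Targets.origVar
  fun_prop

@[fun_prop]
theorem targets_copyVar {v : γ → Var} (h : IsPolyTime v) :
    IsPolyTime fun c => Targets.copyVar (v c) := by
  unfold Targets.copyVar
  fun_prop

@[fun_prop]
theorem targets_targetVar {v : γ → Var} (h : IsPolyTime v) :
    IsPolyTime fun c => Targets.targetVar (v c) := by
  unfold Targets.targetVar
  fun_prop

@[fun_prop]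
theorem targets_matchVar {v : γ → Var} (h : IsPolyTime v) :
    IsPolyTime fun c => Targets.matchVar (v c) := by
  unfold Targets.matchVar
  fun_prop

@[fun_prop]
theorem targets_copyInst {e : γ → Inst} (he : IsPolyTime e) :
    IsPolyTime fun c => Targets.copyInst (e c) := by
  unfold Targets.copyInst
  fun_prop

@[fun_prop]
theorem targets_matchInst {U : γ → List Var} (hU : IsPolyTime U) :
    IsPolyTime fun c => Targets.matchInst (U c) := by
  unfold Targets.matchInst
  fun_prop

@[fun_prop]
theorem targets_origMech {m : γ → Mech} (hm : IsPolyTime m) :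
    IsPolyTime fun c => Targets.origMech (m c) := by
  convert mech_casesOn (f := fun p => Mech.exo p.2)
    (g := fun p => Mech.endo (p.2.1.map Targets.origVar) p.2.2.1 p.2.2.2) hm (by fun_prop)
    (by fun_prop) using 2 with c
  cases m c <;> rfl

@[fun_prop]
theorem targets_model {G : γ → SCM} (hG : IsPolyTime G) :
    IsPolyTime fun c => Targets.model (G c) := by
  unfold Targets.model Targets.matchMech Targets.copyMech eqTable idTable
  fun_prop

theorem toUS : IsPolyTime Targets.toUS :=
  usInput_mk (by fun_prop) (by fun_prop) (list_cons (term_mk (by fun_prop) (by fun_prop)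
    (by fun_prop) (by fun_prop) (by fun_prop) (by fun_prop)) (by fun_prop))

end Targets

end IsPolyTime

theorem polyTime_toUS : OptProblem.PolyTime RMAP UnitSelection Targets.toUS := by
  obtain ⟨p, b, h⟩ := IsPolyTime.toUS
  exact ⟨p, b, fun I _ => h I⟩

/-! ### Product distributions -/

theorem lt_length_of_getD_ne_zero {R : Type*} [Zero R] {θ : List R} {s : ℕ}
    (h : θ.getD s 0 ≠ 0) : s < θ.length :=
  not_le.1 fun hs => h (List.getD_eq_default _ _ hs)

theorem sum_range_getD {R : Type*} [AddCommMonoid R] (θ : List R) :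
    ∑ s ∈ Finset.range θ.length, θ.getD s 0 = θ.sum := by
  rw [Finset.sum_range, ← Fin.sum_univ_getElem]
  simp

section ProductDistribution

variable {ι R : Type*} [DecidableEq ι]

/-- `b` has positive probability when the variables of `l` are drawn from their distributions and
the others are given by `a`. -/
def InSupport [Zero R] (l : List (ι × List R)) (a b : ι → ℕ) : Prop :=
  (∀ v, v ∉ l.map Prod.fst → b v = a v) ∧ ∀ p ∈ l, p.2.getD (b p.1) 0 ≠ 0

/-- `F` does not depend on the variable `v`. -/
def IndepOf {β : Type*} (F : (ι → ℕ) → β) (v : ι) : Prop :=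
  ∀ a s, F (Function.update a v s) = F a

variable [CommSemiring R]

/-- The expectation of `F` when the variables of `l` are drawn independently from their
distributions and the others are given by `a`. A distribution is the list of the probabilities of
the states `0, 1, …`. -/
def expect : List (ι × List R) → ((ι → ℕ) → R) → (ι → ℕ) → R
  | [], F, a => F a
  | (v, θ) :: l, F, a =>
      ∑ s ∈ Finset.range θ.length, θ.getD s 0 * expect l F (Function.update a v s)

variable {l m : List (ι × List R)} {F F' g : (ι → ℕ) → R} {a b : ι → ℕ}

theorem expect_append (l m : List (ι × List R)) (F : (ι → ℕ) → R) (a : ι → ℕ) :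
    expect (l ++ m) F a = expect l (expect m F) a := by
  induction l generalizing a with
  | nil => rfl
  | cons p l ih => simp only [List.cons_append, expect, ih]

theorem expect_congr (hl : (l.map Prod.fst).Nodup) (h : ∀ b, InSupport l a b → F b = F' b) :
    expect l F a = expect l F' a := by
  induction l generalizing a with
  | nil => exact h a ⟨fun _ _ => rfl, by simp⟩
  | cons p l ih =>
    obtain ⟨v, θ⟩ := p
    simp only [List.map_cons, List.nodup_cons] at hl
    refine Finset.sum_congr rfl fun s _ => ?_
    by_cases hs : θ.getD s 0 = 0
    · rw [hs, zero_mul, zero_mul]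
    congr 1
    refine ih hl.2 fun b hb => h b ⟨fun w hw => ?_, List.forall_mem_cons.2 ⟨?_, hb.2⟩⟩
    · simp only [List.map_cons, List.mem_cons, not_or] at hw
      rw [hb.1 w hw.2, Function.update_of_ne hw.1]
    · rwa [hb.1 v hl.1, Function.update_self]

theorem expect_mul_left (hg : ∀ v ∈ l.map Prod.fst, IndepOf g v) :
    expect l (fun b => g b * F b) a = g a * expect l F a := by
  induction l generalizing a with
  | nil => rfl
  | cons p l ih =>
    simp only [List.map_cons, List.forall_mem_cons] at hg
    simp only [expect, Finset.mul_sum]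
    refine Finset.sum_congr rfl fun s _ => ?_
    rw [ih hg.2, hg.1, mul_left_comm]

theorem expect_one (hl : ∀ p ∈ l, p.2.sum = 1) : expect l (fun _ => 1) a = 1 := by
  induction l generalizing a with
  | nil => rfl
  | cons p l ih =>
    rw [List.forall_mem_cons] at hl
    simp only [expect, ih hl.2, mul_one]
    rw [sum_range_getD, hl.1]

theorem expect_of_indep (hl : ∀ p ∈ l, p.2.sum = 1) (hg : ∀ v ∈ l.map Prod.fst, IndepOf g v) :
    expect l g a = g a := by
  simpa only [mul_one, expect_one hl] using expect_mul_left (F := fun _ => 1) (a := a) hg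

theorem IndepOf.expect {v : ι} (hF : IndepOf F v) (hv : v ∉ l.map Prod.fst) :
    IndepOf (expect l F) v := by
  intro a s
  induction l generalizing a with
  | nil => exact hF a s
  | cons p l ih =>
    simp only [List.map_cons, List.mem_cons, not_or] at hv
    simp only [_root_.expect]
    refine Finset.sum_congr rfl fun t _ => ?_
    rw [Function.update_comm hv.1, ih hv.2]

theorem expect_map {κ : Type*} [DecidableEq κ] {f : ι → κ} (hf : Function.Injective f)
    {a : κ → ℕ} :
    expect (l.map fun p => (f p.1, p.2)) (fun b => F (b ∘ f)) a = expect l F (a ∘ f) := by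
  induction l generalizing a with
  | nil => rfl
  | cons p l ih =>
    simp only [List.map_cons, expect, ih, Function.update_comp_eq_of_injective _ hf]

theorem expect_perm (h : l.Perm m) (hl : (l.map Prod.fst).Nodup) : expect l F a = expect m F a := by
  induction h generalizing a with
  | nil => rfl
  | cons p _ ih =>
    simp only [List.map_cons, List.nodup_cons] at hl
    simp only [expect, ih hl.2]
  | swap p q l =>
    simp only [List.map_cons, List.nodup_cons, List.mem_cons, not_or] at hl
    simp only [expect, Finset.mul_sum]
    rw [Finset.sum_comm]
    refine Finset.sum_congr rfl fun s _ => Finset.sum_congr rfl fun t _ => ?_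
    rw [Function.update_comm hl.1.1, mul_left_comm]
  | trans hlm _ ih₁ ih₂ => rw [ih₁ hl, ih₂ ((hlm.map Prod.fst).nodup_iff.1 hl)]

theorem expect_ne_zero [NoZeroDivisors R] [PartialOrder R] [CanonicallyOrderedAdd R]
    (hb : InSupport l a b) (hF : F b ≠ 0) : expect l F a ≠ 0 := by
  induction l generalizing a with
  | nil => rwa [expect, ← show b = a from funext fun v => hb.1 v List.not_mem_nil]
  | cons p l ih =>
    obtain ⟨v, θ⟩ := p
    obtain ⟨hout, hpos⟩ := hb
    rw [List.forall_mem_cons] at hpos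
    have hb' : InSupport l (Function.update a v (b v)) b := by
      refine ⟨fun w hw => ?_, hpos.2⟩
      by_cases h : w = v
      · rw [h, Function.update_self]
      · rw [Function.update_of_ne h]
        exact hout w (List.not_mem_cons_of_ne_of_not_mem h hw)
    intro hzero
    simp only [expect, Finset.sum_eq_zero_iff, Finset.mem_range] at hzero
    exact mul_ne_zero hpos.1 (ih hb') (hzero (b v) (lt_length_of_getD_ne_zero hpos.1))

theorem expect_append_mul (hF : ∀ v ∈ m.map Prod.fst, IndepOf F v)
    (hg : ∀ v ∈ l.map Prod.fst, IndepOf g v ∧ v ∉ m.map Prod.fst) :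
    expect (l ++ m) (fun b => F b * g b) a = expect l F a * expect m g a := by
  have hinner : expect m (fun b => F b * g b) = fun b => expect m g b * F b := by
    funext b
    rw [expect_mul_left hF, mul_comm]
  rw [expect_append, hinner, expect_mul_left fun v hv => (hg v hv).1.expect (hg v hv).2, mul_comm]

theorem expect_flatMap {κ : Type*} {c : κ → List (ι × List R)} {F : κ → (ι → ℕ) → R}
    {is : List κ}
    (h : is.Pairwise fun i j =>
      (∀ v ∈ (c i).map Prod.fst, IndepOf (F j) v ∧ v ∉ (c j).map Prod.fst) ∧
        ∀ v ∈ (c j).map Prod.fst, IndepOf (F i) v) :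
    expect (is.flatMap c) (fun b => (is.map fun i => F i b).prod) a =
      (is.map fun i => expect (c i) (F i) a).prod := by
  induction is with
  | nil => rfl
  | cons i is ih =>
    rw [List.pairwise_cons] at h
    simp only [List.flatMap_cons, List.map_cons, List.prod_cons]
    rw [expect_append_mul, ih h.2]
    · simp only [List.map_flatMap, List.mem_flatMap]
      rintro v ⟨j, hj, hv⟩
      exact (h.1 j hj).2 v hv
    · refine fun v hv => ⟨fun a s => ?_, ?_⟩
      · exact congrArg List.prod (List.map_congr_left fun j hj => ((h.1 j hj).1 v hv).1 a s)
      · simp only [List.map_flatMap, List.mem_flatMap]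
        rintro ⟨j, hj, hvj⟩
        exact ((h.1 j hj).1 v hv).2 hvj

end ProductDistribution

section Extend

variable {ι R : Type*} [DecidableEq ι] [CommSemiring R] {k : ι → ℕ}

/-- The function that is `ω` on the finite set `S` and `a` elsewhere. -/
def extend (S : Finset ι) (a : ι → ℕ) (ω : (v : {v // v ∈ S}) → Fin (k v)) : ι → ℕ :=
  fun v => if h : v ∈ S then ω ⟨v, h⟩ else a v

theorem extend_empty (a : ι → ℕ) (ω : (v : {v // v ∈ (∅ : Finset ι)}) → Fin (k v)) :
    extend ∅ a ω = a :=
  funext fun v => dif_neg (Finset.notMem_empty v)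

theorem prod_extend (pr : ι → ℕ → R) (S : Finset ι) (a : ι → ℕ)
    (ω : (v : {v // v ∈ S}) → Fin (k v)) :
    ∏ v : {v // v ∈ S}, pr v (ω v) = ∏ v ∈ S, pr v (extend S a ω v) := by
  rw [← Finset.prod_coe_sort S fun v => pr v (extend S a ω v)]
  exact Finset.prod_congr rfl fun v _ => by simp [extend]

theorem sum_extend_insert {S : Finset ι} {v : ι} (hv : v ∉ S) (a : ι → ℕ) (H : (ι → ℕ) → R) :
    ∑ ω : (w : {w // w ∈ insert v S}) → Fin (k w), H (extend _ a ω) =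
      ∑ s ∈ Finset.range (k v), ∑ ω : (w : {w // w ∈ S}) → Fin (k w),
        H (extend S (Function.update a v s) ω) := by
  rw [Finset.sum_range, ← Fintype.sum_prod_type']
  let e : ((w : {w // w ∈ insert v S}) → Fin (k w)) ≃
      Fin (k v) × ((w : {w // w ∈ S}) → Fin (k w)) :=
    { toFun := fun ω => (ω ⟨v, Finset.mem_insert_self _ _⟩,
        fun w => ω ⟨w, Finset.mem_insert_of_mem w.2⟩)
      invFun := fun q w => if h : w.1 = v then ⟨q.1, by rw [h]; exact q.1.2⟩ else
        q.2 ⟨w, Finset.mem_of_mem_insert_of_ne w.2 h⟩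
      left_inv := by
        intro ω
        funext ⟨w, hw⟩
        by_cases h : w = v
        · subst h; simp
        · simp [h]
      right_inv := by
        rintro ⟨s, ω⟩
        refine Prod.ext (by simp) (funext fun w => ?_)
        simp [show w.1 ≠ v from fun h => hv (h ▸ w.2)] }
  refine Fintype.sum_equiv e _ _ fun ω => congrArg H (funext fun w => ?_)
  by_cases h : w = v
  · subst h; simp [extend, hv, e]
  · by_cases hw : w ∈ S <;> simp [extend, h, hw, e]

theorem sum_extend_eq_expect {pr : ι → ℕ → R} {l : List (ι × List R)}
    (hl : (l.map Prod.fst).Nodup) (hk : ∀ p ∈ l, k p.1 = p.2.length)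
    (hpr : ∀ p ∈ l, ∀ s, pr p.1 s = p.2.getD s 0) {S : Finset ι}
    (hS : S = (l.map Prod.fst).toFinset) (F : (ι → ℕ) → R) (a : ι → ℕ) :
    ∑ ω : (v : {v // v ∈ S}) → Fin (k v), (∏ v : {v // v ∈ S}, pr v (ω v)) * F (extend S a ω) =
      expect l F a := by
  induction l generalizing a S with
  | nil =>
    obtain rfl : S = ∅ := hS
    simp [extend_empty, expect]
  | cons p l ih =>
    obtain ⟨v, θ⟩ := p
    obtain rfl : S = insert v (l.map Prod.fst).toFinset := by simpa using hS
    simp only [List.map_cons, List.nodup_cons] at hl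
    rw [List.forall_mem_cons] at hk hpr
    have hv : v ∉ (l.map Prod.fst).toFinset := by simpa using hl.1
    simp only [prod_extend pr _ a]
    rw [sum_extend_insert hv a fun b =>
      (∏ w ∈ insert v (l.map Prod.fst).toFinset, pr w (b w)) * F b]
    simp only [expect, hk.1]
    refine Finset.sum_congr rfl fun s _ => ?_
    rw [← ih hl.2 hk.2 hpr.2 rfl, Finset.mul_sum]
    refine Finset.sum_congr rfl fun ω _ => ?_
    have hω : extend _ (Function.update a v s) ω v = s := by
      rw [extend, dif_neg hv, Function.update_self]
    rw [Finset.prod_insert hv, hω, ← hpr.1, prod_extend pr _ (Function.update a v s), mul_assoc]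

end Extend

/-! ### Probabilities in causal models as expectations -/

theorem mem_of_lookup_eq_some {α β : Type*} [BEq α] [LawfulBEq α] {l : List (α × β)} {a : α} {b : β}
    (h : l.lookup a = some b) : (a, b) ∈ l := by
  obtain ⟨l₁, l₂, rfl, -⟩ := List.lookup_eq_some_iff.1 h
  exact List.mem_append_right _ List.mem_cons_self

theorem lookup_eq_none_iff_notMem {α β : Type*} [BEq α] [LawfulBEq α] {l : List (α × β)} {a : α} :
    l.lookup a = none ↔ a ∉ l.map Prod.fst := by
  rw [List.lookup_eq_none_iff, List.mem_map]
  grind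

theorem lookup_eq_some_iff_mem {α β : Type*} [BEq α] [LawfulBEq α] {l : List (α × β)}
    (hl : (l.map Prod.fst).Nodup) {a : α} {b : β} : l.lookup a = some b ↔ (a, b) ∈ l := by
  refine ⟨mem_of_lookup_eq_some, fun hab => ?_⟩
  cases hc : l.lookup a with
  | none => exact absurd (List.mem_map_of_mem hab) (lookup_eq_none_iff_notMem.1 hc)
  | some c =>
    have hpair := List.inj_on_of_nodup_map hl (mem_of_lookup_eq_some hc) hab rfl
    exact congrArg some (Prod.mk.inj hpair).2

open Classical in
/-- The indicator of a proposition. -/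
noncomputable def ind (p : Prop) : ℚ≥0 := if p then 1 else 0

/-- The variables of `e` have their states in `e`. -/
def Agrees (e : Inst) (x : Var → ℕ) : Prop := ∀ p ∈ e, x p.1 = p.2

namespace SCM

/-- The exogenous variables with their distributions. -/
def priors (G : SCM) : List (Var × List ℚ≥0) :=
  G.filterMap fun
    | (v, Mech.exo θ) => some (v, θ)
    | (_, Mech.endo _ _ _) => none

/-- `IsSolution` for states of the exogenous variables that are given by a function on all
names. -/
def Sol (G : SCM) (act : Inst) (ω x : Var → ℕ) : Prop :=
  ∀ v m, (v, m) ∈ G →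
    match act.lookup v with
    | some s => x v = s
    | none =>
      match m with
      | Mech.exo _ => x v = ω v
      | Mech.endo pa _ rows => rows.lookup (pa.map x) = some (x v)

/-- The event whose probability is `G.prob worlds`, for states of the exogenous variables that are
given by a function on all names. -/
def Holds (G : SCM) (worlds : List (Inst × Inst)) (ω : Var → ℕ) : Prop :=
  ∀ w ∈ worlds, ∃ x, G.Sol w.1 ω x ∧ Agrees w.2 x

/-- `pa`, `k` and `rows` are the parents, the number of states and the table of an endogenous
variable of a well-formed model. -/
def IsTable (G : SCM) (pa : List Var) (k : ℕ) (rows : List (List ℕ × ℕ)) : Prop :=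
  pa ≠ [] ∧ pa.Nodup ∧ pa ⊆ G.vars ∧
    (rows.map Prod.fst).Nodup ∧ (∀ p, p ∈ rows.map Prod.fst ↔ G.IsStates p pa) ∧
    ∀ r ∈ rows, r.2 < k

variable {G G' : SCM} {v : Var} {m m' : Mech} {θ : List ℚ≥0} {pa : List Var} {k : ℕ}
  {rows : List (List ℕ × ℕ)} {act : Inst} {ω x : Var → ℕ}

theorem mem_priors : (v, θ) ∈ G.priors ↔ (v, Mech.exo θ) ∈ G := by
  simp only [priors, List.mem_filterMap]
  constructor
  · rintro ⟨⟨w, m⟩, hw, h⟩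
    cases m with
    | exo θ' =>
      obtain ⟨rfl, rfl⟩ : w = v ∧ θ' = θ := by simpa using h
      exact hw
    | endo => cases h
  · exact fun h => ⟨_, h, rfl⟩

theorem exoVars_eq (G : SCM) : G.exoVars = (G.priors.map Prod.fst).toFinset := by
  unfold exoVars priors
  congr 1
  induction G with
  | nil => rfl
  | cons n G ih =>
    obtain ⟨v, m⟩ := n
    cases m with
    | exo θ => exact congrArg (List.cons v) ih
    | endo => exact ih

theorem mem_exoVars : v ∈ G.exoVars ↔ ∃ θ, (v, Mech.exo θ) ∈ G := by
  simp [exoVars_eq, mem_priors]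

theorem mem_endoVars : v ∈ G.endoVars ↔ ∃ pa k rows, (v, Mech.endo pa k rows) ∈ G := by
  simp only [endoVars, List.mem_toFinset, List.mem_map, List.mem_filter]
  constructor
  · rintro ⟨⟨w, m⟩, ⟨hw, hm⟩, rfl⟩
    cases m with
    | exo => simp [Mech.IsExo] at hm
    | endo pa k rows => exact ⟨pa, k, rows, hw⟩
  · rintro ⟨pa, k, rows, h⟩
    exact ⟨_, ⟨h, rfl⟩, rfl⟩

theorem mem_vars : v ∈ G.vars ↔ ∃ m, (v, m) ∈ G := by
  simp [vars]

theorem priors_vars_sublist (G : SCM) : (G.priors.map Prod.fst).Sublist G.vars := by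
  unfold priors vars
  induction G with
  | nil => exact List.Sublist.refl _
  | cons n G ih =>
    obtain ⟨v, m⟩ := n
    cases m with
    | exo θ => simpa using ih
    | endo => exact (by simpa using ih : List.Sublist _ (List.map Prod.fst G)).cons v

theorem lookup_eq_some_iff (hG : G.vars.Nodup) : G.lookup v = some m ↔ (v, m) ∈ G :=
  lookup_eq_some_iff_mem hG

theorem card_eq (hG : G.vars.Nodup) (hm : (v, m) ∈ G) : G.card v = m.card := by
  rw [SCM.card, (lookup_eq_some_iff hG).2 hm]

theorem mech_unique (hG : G.vars.Nodup) (hm : (v, m) ∈ G) (hm' : (v, m') ∈ G) : m = m' :=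
  Option.some.inj (((lookup_eq_some_iff hG).2 hm).symm.trans ((lookup_eq_some_iff hG).2 hm'))

theorem isStates_map {f : Var → Var} {V : List Var} (hf : ∀ v ∈ V, G'.card (f v) = G.card v)
    (s : List ℕ) : G'.IsStates s (V.map f) ↔ G.IsStates s V := by
  unfold IsStates
  induction V generalizing s with
  | nil => simp
  | cons v V ih =>
    rw [List.forall_mem_cons] at hf
    cases s with
    | nil => simp
    | cons a s => simp [ih hf.2, hf.1]

theorem isStates_map_apply (hx : ∀ p ∈ pa, x p < G.card p) :
    G.IsStates (pa.map x) pa :=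
  List.forall₂_map_left_iff.2 (List.forall₂_same.2 hx)

theorem IsTable.exists_lookup {s : List ℕ} (h : G.IsTable pa k rows) (hs : G.IsStates s pa) :
    ∃ a < k, rows.lookup s = some a := by
  obtain ⟨-, -, -, hnodup, hkeys, hlt⟩ := h
  obtain ⟨⟨p, a⟩, hr, rfl⟩ := List.mem_map.1 ((hkeys s).2 hs)
  exact ⟨a, hlt _ hr, (lookup_eq_some_iff_mem hnodup).2 hr⟩

theorem WF.nodup (h : G.WF) : G.vars.Nodup := h.2.1

theorem WF.priors_nodup (h : G.WF) : (G.priors.map Prod.fst).Nodup :=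
  h.nodup.sublist G.priors_vars_sublist

theorem WF.sum_eq_one (h : G.WF) (hm : (v, Mech.exo θ) ∈ G) : θ.sum = 1 := h.2.2.1 v θ hm

theorem WF.isTable (h : G.WF) (hm : (v, Mech.endo pa k rows) ∈ G) : G.IsTable pa k rows :=
  h.2.2.2.1 v pa k rows hm

theorem WF.parents_subset (h : G.WF) (hm : (v, Mech.endo pa k rows) ∈ G) : pa ⊆ G.vars :=
  (h.isTable hm).2.2.1

theorem WF.parents_induction {P : Var → Prop} (h : G.WF)
    (exo : ∀ v θ, (v, Mech.exo θ) ∈ G → P v)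
    (endo : ∀ v pa k rows, (v, Mech.endo pa k rows) ∈ G → (∀ p ∈ pa, P p) → P v) :
    ∀ v ∈ G.vars, P v := by
  obtain ⟨rank, hrank⟩ := h.2.2.2.2
  intro v
  induction hr : rank v using Nat.strong_induction_on generalizing v with
  | _ r ih =>
    intro hv
    obtain ⟨m, hm⟩ := mem_vars.1 hv
    cases m with
    | exo θ => exact exo v θ hm
    | endo pa k rows =>
      exact endo v pa k rows hm fun p hp =>
        ih _ (hr ▸ hrank _ _ _ _ hm p hp) p rfl (h.parents_subset hm hp)

theorem WF.prob_eq (h : G.WF) (worlds : List (Inst × Inst)) :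
    G.prob worlds = expect G.priors (fun ω => ind (G.Holds worlds ω)) 0 := by
  classical
  unfold ind
  rw [← sum_extend_eq_expect (k := G.card) (pr := G.prior) h.priors_nodup ?_ ?_ G.exoVars_eq]
  · refine Finset.sum_congr (by congr) fun ω _ => congrArg _ (if_congr ?_ rfl rfl)
    refine forall₂_congr fun w _ => exists_congr fun x => and_congr_left fun _ => ?_
    refine forall₃_congr fun v m hm => ?_
    cases w.1.lookup v with
    | some s => rfl
    | none =>
      cases m with
      | exo θ => simp [extend, mem_exoVars.2 ⟨θ, hm⟩]
      | endo => rfl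
  · rintro ⟨v, θ⟩ hp
    exact card_eq h.nodup (mem_priors.1 hp)
  · rintro ⟨v, θ⟩ hp s
    rw [prior, (lookup_eq_some_iff h.nodup).2 (mem_priors.1 hp)]

theorem Sol.eq_of_act {s : ℕ} (h : G.Sol act ω x) (hm : (v, m) ∈ G)
    (hact : act.lookup v = some s) : x v = s := by
  simpa only [hact] using h v m hm

theorem Sol.eq_of_exo (h : G.Sol act ω x) (hm : (v, Mech.exo θ) ∈ G)
    (hact : act.lookup v = none) : x v = ω v := by
  simpa only [hact] using h v _ hm

theorem Sol.lookup_eq (h : G.Sol act ω x) (hm : (v, Mech.endo pa k rows) ∈ G)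
    (hact : act.lookup v = none) : rows.lookup (pa.map x) = some (x v) := by
  simpa only [hact] using h v _ hm

theorem WF.sol_unique {y : Var → ℕ} (h : G.WF) (hx : G.Sol act ω x)
    (hy : G.Sol act ω y) : ∀ v ∈ G.vars, x v = y v := by
  refine h.parents_induction (fun v θ hm => ?_) fun v pa k rows hm ih => ?_
  · cases hact : act.lookup v with
    | some s => rw [hx.eq_of_act hm hact, hy.eq_of_act hm hact]
    | none => rw [hx.eq_of_exo hm hact, hy.eq_of_exo hm hact]
  · cases hact : act.lookup v with
    | some s => rw [hx.eq_of_act hm hact, hy.eq_of_act hm hact]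
    | none =>
      have hlookup := hx.lookup_eq hm hact
      rw [List.map_congr_left ih, hy.lookup_eq hm hact] at hlookup
      exact (Option.some.inj hlookup).symm

/-- One simultaneous evaluation of all structural equations, at the states `x`. -/
def eval (G : SCM) (ω x : Var → ℕ) (v : Var) : ℕ :=
  match G.lookup v with
  | some (Mech.endo pa _ rows) => (rows.lookup (pa.map x)).getD 0
  | _ => ω v

theorem eval_exo (hG : G.vars.Nodup) (hm : (v, Mech.exo θ) ∈ G) :
    G.eval ω x v = ω v := by
  rw [eval, (lookup_eq_some_iff hG).2 hm]

theorem eval_endo (hG : G.vars.Nodup) (hm : (v, Mech.endo pa k rows) ∈ G) :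
    G.eval ω x v = (rows.lookup (pa.map x)).getD 0 := by
  rw [eval, (lookup_eq_some_iff hG).2 hm]

theorem WF.exists_eval_eq (h : G.WF) (ω : Var → ℕ) : ∃ x, ∀ v ∈ G.vars, G.eval ω x v = x v := by
  let x : ℕ → Var → ℕ := fun N => (G.eval ω)^[N] ω
  have hsucc (N : ℕ) : x (N + 1) = G.eval ω (x N) := Function.iterate_succ_apply' ..
  have hstable : ∀ v ∈ G.vars, ∀ᶠ N in Filter.atTop, G.eval ω (x N) v = x N v := by
    refine h.parents_induction (fun v θ hm => ?_) fun v pa k rows hm ih => ?_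
    · refine Filter.Eventually.of_forall fun N => ?_
      cases N with
      | zero => exact eval_exo h.nodup hm
      | succ N => rw [hsucc, eval_exo h.nodup hm, eval_exo h.nodup hm]
    · have hpa : ∀ᶠ N in Filter.atTop, ∀ p ∈ pa.toFinset, G.eval ω (x N) p = x N p :=
        (Filter.eventually_all_finset _).2 fun p hp => ih p (List.mem_toFinset.1 hp)
      rw [← Filter.map_add_atTop_eq_nat 1, Filter.eventually_map]
      filter_upwards [hpa] with N hN
      rw [hsucc, eval_endo h.nodup hm, eval_endo h.nodup hm,
        List.map_congr_left fun p hp => hN p (List.mem_toFinset.2 hp)]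
  have hall : ∀ᶠ N in Filter.atTop, ∀ v ∈ G.vars.toFinset, G.eval ω (x N) v = x N v :=
    (Filter.eventually_all_finset _).2 fun v hv => hstable v (List.mem_toFinset.1 hv)
  obtain ⟨N, hN⟩ := hall.exists
  exact ⟨x N, fun v hv => hN v (List.mem_toFinset.2 hv)⟩

theorem WF.exists_sol (h : G.WF) (hω : ∀ v ∈ G.exoVars, ω v < G.card v) :
    ∃ x, G.Sol [] ω x ∧ ∀ v ∈ G.vars, x v < G.card v := by
  obtain ⟨x, hx⟩ := h.exists_eval_eq ω
  have hlookup {v pa k rows} (hm : (v, Mech.endo pa k rows) ∈ G)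
      (hpa : ∀ p ∈ pa, x p < G.card p) : rows.lookup (pa.map x) = some (x v) ∧ x v < k := by
    obtain ⟨a, hak, ha⟩ := (h.isTable hm).exists_lookup (isStates_map_apply hpa)
    have hxa : x v = a := by
      rw [← hx v (mem_vars.2 ⟨_, hm⟩), eval_endo h.nodup hm, ha, Option.getD_some]
    exact ⟨hxa ▸ ha, hxa ▸ hak⟩
  have hlt : ∀ v ∈ G.vars, x v < G.card v := by
    refine h.parents_induction (fun v θ hm => ?_) fun v pa k rows hm ih => ?_
    · rw [← hx v (mem_vars.2 ⟨_, hm⟩), eval_exo h.nodup hm]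
      exact hω v (mem_exoVars.2 ⟨θ, hm⟩)
    · rw [card_eq h.nodup hm]
      exact (hlookup hm ih).2
  refine ⟨x, fun v m hm => ?_, hlt⟩
  simp only [List.lookup_nil]
  cases m with
  | exo θ => rw [← hx v (mem_vars.2 ⟨_, hm⟩), eval_exo h.nodup hm]
  | endo pa k rows => exact (hlookup hm fun p hp => hlt p (h.parents_subset hm hp)).1

theorem WF.card_pos (h : G.WF) (hv : v ∈ G.vars) : 0 < G.card v := by
  obtain ⟨x, -, hx⟩ := h.exists_sol (ω := fun _ => 0) fun v hv => by
    obtain ⟨θ, hθ⟩ := mem_exoVars.1 hv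
    rw [card_eq h.nodup hθ]
    refine List.length_pos_iff.2 fun hnil => ?_
    simpa [hnil] using h.sum_eq_one hθ
  exact (Nat.zero_le _).trans_lt (hx v hv)

end SCM

/-! ### The size of the objective model -/

theorem forall₂_matches_eq {p q : List ℕ} :
    List.Forall₂ Cell.Matches (p.map Cell.eq) q ↔ q = p := by
  rw [List.forall₂_map_left_iff]
  constructor
  · intro h
    induction h with
    | nil => rfl
    | cons hmatch _ ih => rw [ih, show _ = _ from hmatch]
  · rintro rfl
    exact List.forall₂_same.2 fun _ _ => rfl

theorem exists_forall₂_matches {l : List (List ℕ)} {m : ℕ} (hm : ∀ p ∈ l, p.length = m) :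
    ∃ c, ∀ p ∈ l, List.Forall₂ Cell.Matches c p := by
  refine ⟨List.replicate m (Cell.ne (l.flatten.sum + 1)), fun p hp => ?_⟩
  rw [← hm p hp, ← List.map_const', List.forall₂_map_left_iff]
  refine List.forall₂_same.2 fun a ha => ?_
  have hle : a ≤ l.flatten.sum := List.le_sum_of_mem (List.mem_flatten.2 ⟨p, hp, ha⟩)
  exact (Nat.lt_succ_of_le hle).ne

theorem exists_represents {rows : List (List ℕ × ℕ)} (h : (rows.map Prod.fst).Nodup) :
    ∃ T : List (List Cell × ℕ), T.length = rowCount rows ∧ Represents T rows := by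
  refine Nat.sInf_mem (s := {k | ∃ T : List (List Cell × ℕ), T.length = k ∧ Represents T rows})
    ⟨_, rows.map fun r => (r.1.map Cell.eq, r.2), rfl, fun r hr => ⟨?_, ?_⟩⟩
  · exact ⟨_, List.mem_map_of_mem hr, forall₂_matches_eq.2 rfl⟩
  · intro g hg hmatch
    obtain ⟨r', hr', rfl⟩ := List.mem_map.1 hg
    rw [List.inj_on_of_nodup_map h hr hr' (forall₂_matches_eq.1 hmatch)]

theorem rowCount_pos {rows : List (List ℕ × ℕ)} (h : (rows.map Prod.fst).Nodup)
    (hne : rows ≠ []) : 0 < rowCount rows := by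
  obtain ⟨T, hT, hrep⟩ := exists_represents h
  obtain ⟨r, hr⟩ := List.exists_mem_of_ne_nil _ hne
  obtain ⟨⟨g, hg, -⟩, -⟩ := hrep r hr
  rw [← hT]
  exact List.length_pos_of_mem hg

theorem Represents.mixRows {T : List (List Cell × ℕ)} {rows : List (List ℕ × ℕ)} {c : List Cell}
    (hT : Represents T rows) (hc : ∀ r ∈ rows, List.Forall₂ Cell.Matches c r.1) (n i z : ℕ) :
    Represents (T.map (fun g => (Cell.eq i :: g.1, g.2)) ++ [(Cell.ne i :: c, z)])
      (mixRows n i z rows) := by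
  intro r' hr'
  simp only [_root_.mixRows, List.mem_flatMap, List.mem_map, List.mem_range] at hr'
  obtain ⟨r, hr, h, -, rfl⟩ := hr'
  obtain ⟨⟨g, hg, hmatch⟩, hvalue⟩ := hT r hr
  simp only [List.mem_append, List.mem_map, List.mem_singleton]
  by_cases hi : h = i
  · refine ⟨⟨_, Or.inl ⟨g, hg, rfl⟩, List.Forall₂.cons hi hmatch⟩, ?_⟩
    rintro _ (⟨g', hg', rfl⟩ | rfl) hmatch' <;> rw [List.forall₂_cons] at hmatch'
    · rw [if_pos hi]
      exact hvalue g' hg' hmatch'.2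
    · exact absurd hi hmatch'.1
  · refine ⟨⟨_, Or.inr rfl, List.Forall₂.cons hi (hc r hr)⟩, ?_⟩
    rintro _ (⟨g', -, rfl⟩ | rfl) hmatch'
    · rw [List.forall₂_cons] at hmatch'
      exact absurd hmatch'.1 hi
    · rw [if_neg hi]

theorem rowCount_mixRows_le {rows : List (List ℕ × ℕ)} {m : ℕ} (h : (rows.map Prod.fst).Nodup)
    (hm : ∀ r ∈ rows, r.1.length = m) (n i z : ℕ) :
    rowCount (mixRows n i z rows) ≤ rowCount rows + 1 := by
  obtain ⟨T, hT, hrep⟩ := exists_represents h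
  obtain ⟨c, hc⟩ := exists_forall₂_matches (l := rows.map Prod.fst) (m := m) (by simpa using hm)
  refine Nat.sInf_le ⟨_, ?_, hrep.mixRows (fun r hr => hc _ (List.mem_map_of_mem hr)) n i z⟩
  simp [hT]

namespace SCM

variable {G : SCM}

theorem size_append (G G' : SCM) : SCM.size (G ++ G') = G.size + SCM.size G' := by
  simp [SCM.size]

theorem size_flatMap_le {α : Type*} {f : α → SCM} {c : ℕ} {l : List α}
    (h : ∀ a ∈ l, (f a).size ≤ c) : SCM.size (l.flatMap f) ≤ l.length * c := by
  induction l with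
  | nil => simp [SCM.size]
  | cons a l ih =>
    rw [List.forall_mem_cons] at h
    rw [List.flatMap_cons, size_append, List.length_cons, Nat.succ_mul, add_comm]
    exact Nat.add_le_add (ih h.2) h.1

theorem size_filterMap_le {f : Var × Mech → Option (Var × Mech)} {c : ℕ}
    (h : ∀ n ∈ G, ∀ n', f n = some n' → n'.2.size ≤ c * n.2.size) :
    SCM.size (G.filterMap f) ≤ c * G.size := by
  unfold SCM.size
  induction G with
  | nil => simp
  | cons n G ih =>
    rw [List.forall_mem_cons] at h
    rw [List.map_cons, List.sum_cons, Nat.mul_add]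
    cases hf : f n with
    | none =>
      rw [List.filterMap_cons_none hf]
      exact (ih h.2).trans (Nat.le_add_left _ _)
    | some n' =>
      rw [List.filterMap_cons_some hf, List.map_cons, List.sum_cons]
      exact Nat.add_le_add (h.1 n' hf) (ih h.2)

theorem size_renamedRoots_le (G : SCM) (p : Var → Prop) [DecidablePred p] (f : Var → Var) :
    (G.renamedRoots p f).size ≤ G.size := by
  rw [← one_mul G.size]
  refine size_filterMap_le fun nd _ nd' h => ?_
  obtain ⟨v, θ | ⟨pa, k, rows⟩⟩ := nd
  · obtain ⟨-, rfl⟩ : p v ∧ (f v, Mech.exo θ) = nd' := by simpa using h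
    exact (one_mul _).ge
  · cases h

theorem size_pos (hG : G ≠ []) : 0 < G.size := by
  obtain ⟨n, hn⟩ := List.exists_mem_of_ne_nil _ hG
  have hle : n.2.size ≤ G.size := List.le_sum_of_mem (List.mem_map.2 ⟨n, hn, rfl⟩)
  refine lt_of_lt_of_le ?_ hle
  cases n.2 <;> simp only [Mech.size] <;> omega

theorem WF.rows_ne_nil (h : G.WF) {v : Var} {pa : List Var} {k : ℕ}
    {rows : List (List ℕ × ℕ)} (hm : (v, Mech.endo pa k rows) ∈ G) : rows ≠ [] := by
  have hstates : G.IsStates (pa.map fun _ => 0) pa :=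
    isStates_map_apply fun p hp => h.card_pos (h.parents_subset hm hp)
  obtain ⟨a, -, ha⟩ := (h.isTable hm).exists_lookup hstates
  rintro rfl
  cases ha

end SCM

namespace Objective

theorem size_world_le {G : SCM} (hG : G.WF) (U : List Var) (n i j : ℕ) (act out : Inst) :
    (world G U n i j act out).size ≤ 2 * G.size := by
  refine SCM.size_filterMap_le fun nd hnd nd' h => ?_
  obtain ⟨v, θ | ⟨pa, k, rows⟩⟩ := nd
  · cases h
  obtain ⟨-, -, -, hnodup, hkeys, -⟩ := hG.isTable hnd
  have hk : k ≤ rowCount rows * k :=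
    Nat.le_mul_of_pos_left k (rowCount_pos hnodup (hG.rows_ne_nil hnd))
  obtain rfl := Option.some.inj h
  change (worldMech G U n i j act out v pa k rows).size ≤ _
  unfold worldMech
  cases act.lookup v with
  | some s =>
    simp only [Mech.size, pointMass, List.length_map, List.length_range]
    omega
  | none =>
    cases out.lookup v with
    | none =>
      simp only [Mech.size, List.length_map]
      omega
    | some z =>
      have hlength : ∀ r ∈ rows, r.1.length = pa.length := fun r hr =>
        ((hkeys r.1).1 (List.mem_map_of_mem hr)).length_eq
      have hrows := Nat.mul_le_mul_right k (rowCount_mixRows_le hnodup hlength n i z)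
      simp only [Mech.size, List.length_cons, List.length_map]
      rw [Nat.succ_mul] at hrows
      omega

theorem size_component_le {G : SCM} (hG : G.WF) (U : List Var) (n i : ℕ) (t : Term) :
    (component G U n i t).size ≤ 7 * G.size := by
  simp only [component_eq, SCM.size_append]
  have hroots := G.size_renamedRoots_le (· ∉ U) (exoVar i)
  have hworld₀ := size_world_le hG U n i 0 [] []
  have hworld₁ := size_world_le hG U n i 1 t.x t.y
  have hworld₂ := size_world_le hG U n i 2 t.v t.w
  omega

theorem size_model_le {I : USInput} (hG : I.G.WF) (hL : I.L ≠ []) :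
    (model I).size ≤ 10 * (I.L.length * I.G.size) := by
  have hcomponents := SCM.size_flatMap_le (l := I.L.zipIdx)
    fun c _ => size_component_le hG I.U I.L.length c.2 c.1
  have hroots := I.G.size_renamedRoots_le (· ∈ I.U) unitVar
  have hmix : SCM.size ((mixVar, Mech.exo (I.L.map Term.weight)) ::
      I.G.renamedRoots (· ∈ I.U) unitVar) =
        1 + I.L.length + (I.G.renamedRoots (· ∈ I.U) unitVar).size := by
    simp [SCM.size, Mech.size]
  have hsize : 1 ≤ I.G.size := SCM.size_pos hG.1
  have hlength : 1 ≤ I.L.length := List.length_pos_of_ne_nil hL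
  rw [List.length_zipIdx] at hcomponents
  rw [model_eq, SCM.size_append, hmix]
  nlinarith

end Objective

/-! ### The objective model is a causal model -/

theorem nodup_keys_filterMap {α β γ : Type*} {l : List (α × β)} (hl : (l.map Prod.fst).Nodup)
    {f : α × β → Option (γ × β)} {g : α → γ} (hg : Function.Injective g)
    (hf : ∀ p q, f p = some q → q.1 = g p.1) : ((l.filterMap f).map Prod.fst).Nodup := by
  have hsub : ((l.filterMap f).map Prod.fst).Sublist ((l.map Prod.fst).map g) := by
    clear hl
    induction l with
    | nil => exact List.Sublist.refl _
    | cons p l ih =>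
      cases hp : f p with
      | none => rw [List.filterMap_cons_none hp]; exact ih.cons _
      | some q =>
        rw [List.filterMap_cons_some hp, List.map_cons, hf p q hp]
        exact ih.cons_cons _
  exact (hl.map hg).sublist hsub

theorem pairwise_zipIdx_snd_ne {α : Type*} (l : List α) :
    l.zipIdx.Pairwise fun c d => c.2 ≠ d.2 := by
  refine List.pairwise_map.1 (?_ : (l.zipIdx.map Prod.snd).Nodup)
  rw [List.zipIdx_map_snd]
  exact List.nodup_range'

theorem eq_of_mem_zipIdx {α : Type*} {l : List α} {c d : α × ℕ} (hc : c ∈ l.zipIdx)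
    (hd : d ∈ l.zipIdx) (h : c.2 = d.2) : c = d :=
  List.inj_on_of_nodup_map (by rw [List.zipIdx_map_snd]; exact List.nodup_range') hc hd h

theorem sum_pointMass {k s : ℕ} (hs : s < k) : (pointMass k s).sum = 1 := by
  rw [pointMass, ← List.sum_toFinset _ List.nodup_range]
  simp [hs]

theorem map_fst_mixRows (n i z : ℕ) (rows : List (List ℕ × ℕ)) :
    (mixRows n i z rows).map Prod.fst =
      (rows.map Prod.fst).flatMap fun p => (List.range n).map fun h => h :: p := by
  simp [mixRows, List.map_flatMap, List.flatMap_map, Function.comp_def]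

theorem nodup_map_fst_mixRows {rows : List (List ℕ × ℕ)} (hrows : (rows.map Prod.fst).Nodup)
    (n i z : ℕ) : ((mixRows n i z rows).map Prod.fst).Nodup := by
  rw [map_fst_mixRows, List.nodup_flatMap]
  refine ⟨fun p _ => List.nodup_range.map fun a b hab => (List.cons.inj hab).1,
    hrows.imp fun hpq w hp hq => ?_⟩
  obtain ⟨a, -, rfl⟩ := List.mem_map.1 hp
  obtain ⟨b, -, hb⟩ := List.mem_map.1 hq
  exact hpq (List.cons.inj hb).2.symm

namespace SCM

variable {G G' : SCM} {v w : Var} {m : Mech} {p : Var → Prop} [DecidablePred p] {f : Var → Var}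
  {pa : List Var} {k : ℕ} {rows : List (List ℕ × ℕ)} {e e' : Inst}

theorem vars_append (G G' : SCM) : SCM.vars (G ++ G') = G.vars ++ SCM.vars G' := List.map_append

theorem notMem_exoVars_of_mem_endoVars (hG : G.vars.Nodup) (hv : v ∈ G.endoVars) :
    v ∉ G.exoVars := by
  intro hexo
  obtain ⟨θ, hθ⟩ := mem_exoVars.1 hexo
  obtain ⟨pa, k, rows, hm⟩ := mem_endoVars.1 hv
  cases mech_unique hG hθ hm

theorem mem_renamedRoots : (w, m) ∈ G.renamedRoots p f ↔
    ∃ v θ, (v, Mech.exo θ) ∈ G ∧ p v ∧ w = f v ∧ m = Mech.exo θ := by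
  rw [renamedRoots, List.mem_filterMap]
  constructor
  · rintro ⟨⟨v, θ | ⟨pa, k, rows⟩⟩, hv, h⟩
    · obtain ⟨hp, hw, hm⟩ : p v ∧ f v = w ∧ Mech.exo θ = m := by simpa using h
      exact ⟨v, θ, hv, hp, hw.symm, hm.symm⟩
    · cases h
  · rintro ⟨v, θ, hv, hp, rfl, rfl⟩
    exact ⟨_, hv, by simp [hp]⟩

theorem exists_of_mem_vars_renamedRoots (hw : w ∈ (G.renamedRoots p f).vars) :
    ∃ v, p v ∧ w = f v := by
  obtain ⟨m, hm⟩ := mem_vars.1 hw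
  obtain ⟨v, -, -, hv, rfl, -⟩ := mem_renamedRoots.1 hm
  exact ⟨v, hv, rfl⟩

theorem nodup_renamedRoots (hG : G.vars.Nodup) (hf : Function.Injective f) :
    (G.renamedRoots p f).vars.Nodup := by
  refine nodup_keys_filterMap hG hf ?_
  rintro ⟨v, θ | ⟨pa, k, rows⟩⟩ q hq
  · dsimp only at hq
    split_ifs at hq
    rw [← Option.some.inj hq]
  · cases hq

theorem IsTable.map (h : G.IsTable pa k rows) (hf : Function.Injective f)
    (hmem : ∀ v ∈ pa, f v ∈ G'.vars) (hcard : ∀ v ∈ pa, G'.card (f v) = G.card v) :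
    G'.IsTable (pa.map f) k rows := by
  obtain ⟨hne, hnodup, -, hrows, hkeys, hlt⟩ := h
  refine ⟨by simpa using hne, hnodup.map hf, ?_, hrows,
    fun s => (hkeys s).trans (isStates_map hcard s).symm, hlt⟩
  rintro _ hw
  obtain ⟨v, hv, rfl⟩ := List.mem_map.1 hw
  exact hmem v hv

theorem IsTable.mixRows (h : G.IsTable pa k rows) (hv : v ∈ G.vars) (hpa : v ∉ pa) {z : ℕ}
    (hz : z < k) (i : ℕ) : G.IsTable (v :: pa) k (mixRows (G.card v) i z rows) := by
  obtain ⟨-, hnodup, hsub, hrows, hkeys, hlt⟩ := h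
  refine ⟨List.cons_ne_nil _ _, List.nodup_cons.2 ⟨hpa, hnodup⟩, List.cons_subset.2 ⟨hv, hsub⟩,
    nodup_map_fst_mixRows hrows _ _ _, fun s => ?_, fun r hr => ?_⟩
  · rw [map_fst_mixRows]
    simp only [List.mem_flatMap, hkeys, IsStates]
    cases s <;> simp [and_comm]
  · simp only [_root_.mixRows, List.mem_flatMap, List.mem_map, List.mem_range] at hr
    obtain ⟨r, hr, h, -, rfl⟩ := hr
    dsimp only
    split_ifs
    exacts [hlt r hr, hz]

theorem isInst_nil (G : SCM) : G.IsInst [] := by simp [IsInst]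

theorem IsInst.append (he : G.IsInst e) (he' : G.IsInst e') (h : e.vars.Disjoint e'.vars) :
    G.IsInst (e ++ e') := by
  refine ⟨?_, fun c hc => (List.mem_append.1 hc).elim (he.2 c) (he'.2 c)⟩
  rw [Inst.vars, List.map_append]
  exact he.1.append he'.1 h

theorem IsInst.lt_card_of_lookup {s : ℕ} (he : G.IsInst e) (h : e.lookup v = some s) :
    s < G.card v :=
  (he.2 _ (mem_of_lookup_eq_some h)).2

end SCM

namespace Term

/-- The intervention in world `j`; there is none in world `0`. -/
def act (t : Term) : ℕ → Inst
  | 0 => []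
  | 1 => t.x
  | _ => t.v

/-- The outcome in the interventional world `j`. World `0` carries the evidence, and its outcome is
empty because the mixture variable does not act on it. -/
def out (t : Term) : ℕ → Inst
  | 0 => []
  | 1 => t.y
  | _ => t.w

end Term

namespace Objective

theorem unitVar_injective : Function.Injective unitVar := List.cons_injective

theorem exoVar_injective (i : ℕ) : Function.Injective (exoVar i) :=
  fun _ _ h => by simpa [exoVar] using h

theorem endoVar_eq_iff {i j i' j' : ℕ} {v v' : Var} :
    endoVar i j v = endoVar i' j' v' ↔ i = i' ∧ j = j' ∧ v = v' := by simp [endoVar]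

theorem endoVar_injective (i j : ℕ) : Function.Injective (endoVar i j) :=
  fun _ _ h => (endoVar_eq_iff.1 h).2.2

theorem copyVar_injective (G : SCM) (U : List Var) (i j : ℕ) :
    Function.Injective (copyVar G U i j) := by
  intro v w h
  unfold copyVar unitVar exoVar endoVar at h
  grind

theorem copyVar_ne_mixVar (G : SCM) (U : List Var) (i j : ℕ) (v : Var) :
    copyVar G U i j v ≠ mixVar := by
  unfold copyVar unitVar exoVar endoVar mixVar
  grind

variable {G : SCM} {U : List Var} {n i j k : ℕ} {act out : Inst} {t : Term} {I : USInput}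
  {c : Term × ℕ} {v w : Var} {m : Mech} {θ : List ℚ≥0} {pa pa' : List Var}
  {rows rows' : List (List ℕ × ℕ)} {e : Inst}

theorem copyVar_unit (hv : v ∈ U) : copyVar G U i j v = unitVar v := if_pos hv

theorem copyVar_exo (hv : v ∉ U) (h : v ∈ G.exoVars) : copyVar G U i j v = exoVar i v := by
  rw [copyVar, if_neg hv, if_pos h]

theorem copyVar_endo (hU : ∀ v ∈ U, v ∈ G.exoVars) (h : v ∉ G.exoVars) :
    copyVar G U i j v = endoVar i j v := by
  rw [copyVar, if_neg (fun hv => h (hU v hv)), if_neg h]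

theorem component_eq_flatMap (G : SCM) (U : List Var) (n i : ℕ) (t : Term) :
    component G U n i t = G.renamedRoots (· ∉ U) (exoVar i) ++
      (List.range 3).flatMap fun j => world G U n i j (t.act j) (t.out j) := by
  simp [component_eq, List.range_succ, Term.act, Term.out]

theorem card_worldMech (G : SCM) (U : List Var) (n i j : ℕ) (act out : Inst) (v : Var)
    (pa : List Var) (k : ℕ) (rows : List (List ℕ × ℕ)) :
    (worldMech G U n i j act out v pa k rows).card = k := by
  unfold worldMech
  cases act.lookup v with
  | some s => simp [Mech.card, pointMass]
  | none => cases out.lookup v <;> rfl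

theorem exists_of_worldMech_eq_exo
    (h : worldMech G U n i j act out v pa k rows = Mech.exo θ) :
    ∃ s, act.lookup v = some s ∧ θ = pointMass k s := by
  unfold worldMech at h
  cases hact : act.lookup v with
  | some s => exact ⟨s, rfl, by simpa [hact] using h.symm⟩
  | none => cases hout : out.lookup v <;> simp [hact, hout] at h

theorem eq_of_worldMech_eq_endo {k' : ℕ}
    (h : worldMech G U n i j act out v pa k rows = Mech.endo pa' k' rows') :
    k' = k ∧ ((pa' = pa.map (copyVar G U i j) ∧ rows' = rows) ∨
      ∃ z, out.lookup v = some z ∧ pa' = mixVar :: pa.map (copyVar G U i j) ∧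
        rows' = mixRows n i z rows) := by
  unfold worldMech at h
  cases hact : act.lookup v with
  | some s => simp [hact] at h
  | none => cases hout : out.lookup v <;> simp_all

theorem mem_world : (w, m) ∈ world G U n i j act out ↔ ∃ v pa k rows,
    (v, Mech.endo pa k rows) ∈ G ∧ w = endoVar i j v ∧
      m = worldMech G U n i j act out v pa k rows := by
  rw [world_eq, List.mem_filterMap]
  constructor
  · rintro ⟨⟨v, θ | ⟨pa, k, rows⟩⟩, hv, h⟩
    · cases h
    · obtain ⟨hw, hm⟩ := Prod.mk.inj (Option.some.inj h)
      exact ⟨v, pa, k, rows, hv, hw.symm, hm.symm⟩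
  · rintro ⟨v, pa, k, rows, hv, rfl, rfl⟩
    exact ⟨_, hv, rfl⟩

theorem mem_component : (w, m) ∈ component G U n i t ↔
    (w, m) ∈ G.renamedRoots (· ∉ U) (exoVar i) ∨
      ∃ j < 3, (w, m) ∈ world G U n i j (t.act j) (t.out j) := by
  simp only [component_eq_flatMap, List.mem_append, List.mem_flatMap, List.mem_range]

theorem mem_model : (w, m) ∈ model I ↔
    (w = mixVar ∧ m = Mech.exo (I.L.map Term.weight)) ∨
      (w, m) ∈ I.G.renamedRoots (· ∈ I.U) unitVar ∨
      ∃ c ∈ I.L.zipIdx, (w, m) ∈ component I.G I.U I.L.length c.2 c.1 := by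
  simp only [model_eq, List.mem_append, List.mem_cons, List.mem_flatMap, Prod.mk.injEq, or_assoc]

theorem exists_of_mem_vars_world (hw : w ∈ (world G U n i j act out).vars) :
    ∃ v, w = endoVar i j v := by
  obtain ⟨m, hm⟩ := SCM.mem_vars.1 hw
  obtain ⟨v, -, -, -, -, rfl, -⟩ := mem_world.1 hm
  exact ⟨v, rfl⟩

theorem exists_of_mem_vars_component (hw : w ∈ (component G U n i t).vars) :
    (∃ v, w = exoVar i v) ∨ ∃ j v, w = endoVar i j v := by
  obtain ⟨m, hm⟩ := SCM.mem_vars.1 hw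
  rcases mem_component.1 hm with hm | ⟨j, -, hm⟩
  · obtain ⟨v, -, rfl⟩ := SCM.exists_of_mem_vars_renamedRoots (SCM.mem_vars.2 ⟨m, hm⟩)
    exact .inl ⟨v, rfl⟩
  · obtain ⟨v, rfl⟩ := exists_of_mem_vars_world (SCM.mem_vars.2 ⟨m, hm⟩)
    exact .inr ⟨j, v, rfl⟩

theorem nodup_world (hG : G.vars.Nodup) (U : List Var) (n i j : ℕ) (act out : Inst) :
    (world G U n i j act out).vars.Nodup := by
  rw [world_eq]
  refine nodup_keys_filterMap hG (endoVar_injective i j) ?_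
  rintro ⟨v, θ | ⟨pa, k, rows⟩⟩ q hq
  · cases hq
  · rw [← Option.some.inj hq]

theorem nodup_component (hG : G.vars.Nodup) (U : List Var) (n i : ℕ) (t : Term) :
    (component G U n i t).vars.Nodup := by
  rw [component_eq_flatMap, SCM.vars_append]
  refine (SCM.nodup_renamedRoots hG (exoVar_injective i)).append ?_ ?_
  · rw [SCM.vars, List.map_flatMap, List.nodup_flatMap]
    refine ⟨fun j _ => nodup_world hG _ _ _ _ _ _, List.nodup_range.imp fun hne w hw hw' => ?_⟩
    obtain ⟨v, rfl⟩ := exists_of_mem_vars_world hw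
    obtain ⟨v', h⟩ := exists_of_mem_vars_world hw'
    exact hne (endoVar_eq_iff.1 h).2.1
  · intro w hw hw'
    obtain ⟨v, -, rfl⟩ := SCM.exists_of_mem_vars_renamedRoots hw
    rw [SCM.vars, List.map_flatMap, List.mem_flatMap] at hw'
    obtain ⟨j, -, hj⟩ := hw'
    obtain ⟨v', h⟩ := exists_of_mem_vars_world hj
    simp [exoVar, endoVar] at h

theorem nodup_model (hG : I.G.vars.Nodup) : (model I).vars.Nodup := by
  have hcomponents {w : Var}
      (hw : w ∈ SCM.vars (I.L.zipIdx.flatMap fun c => component I.G I.U I.L.length c.2 c.1)) :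
      ∃ i, (∃ v, w = exoVar i v) ∨ ∃ j v, w = endoVar i j v := by
    rw [SCM.vars, List.map_flatMap, List.mem_flatMap] at hw
    obtain ⟨c, -, hc⟩ := hw
    exact ⟨c.2, exists_of_mem_vars_component hc⟩
  rw [model_eq, SCM.vars_append]
  refine List.Nodup.append (List.nodup_cons.2
    ⟨fun hmix => ?_, SCM.nodup_renamedRoots hG unitVar_injective⟩) ?_ fun w hw hw' => ?_
  · obtain ⟨v, -, hv⟩ := SCM.exists_of_mem_vars_renamedRoots hmix
    simp [mixVar, unitVar] at hv
  · rw [SCM.vars, List.map_flatMap, List.nodup_flatMap]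
    refine ⟨fun c _ => nodup_component hG _ _ _ _,
      (pairwise_zipIdx_snd_ne I.L).imp fun hne w hw hw' => ?_⟩
    rcases exists_of_mem_vars_component hw with ⟨v, rfl⟩ | ⟨j, v, rfl⟩ <;>
      rcases exists_of_mem_vars_component hw' with ⟨v', h⟩ | ⟨j', v', h⟩ <;>
      simp only [exoVar, endoVar, List.cons.injEq] at h <;>
      exact hne (by tauto)
  · obtain ⟨i, hi⟩ := hcomponents hw'
    rcases List.mem_cons.1 hw with rfl | hw
    · rcases hi with ⟨v, h⟩ | ⟨j, v, h⟩ <;> simp [mixVar, exoVar, endoVar] at h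
    · obtain ⟨v', -, rfl⟩ := SCM.exists_of_mem_vars_renamedRoots hw
      rcases hi with ⟨v, h⟩ | ⟨j, v, h⟩ <;> simp [unitVar, exoVar, endoVar] at h

section Valid

theorem valid_iff : UnitSelection.Valid I ↔ I.G.WF ∧ I.U.Nodup ∧ (∀ v ∈ I.U, v ∈ I.G.exoVars) ∧
    (∀ t ∈ I.L,
      I.G.IsEndoInst t.x ∧ I.G.IsEndoInst t.y ∧ I.G.IsEndoInst t.v ∧ I.G.IsEndoInst t.w ∧
      I.G.IsEndoInst t.e ∧ (t.x.vars ++ t.v.vars).Disjoint (t.y.vars ++ t.w.vars)) ∧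
    (I.L.map Term.weight).sum = 1 := Iff.rfl

variable (hI : UnitSelection.Valid I)
include hI

theorem wf_of_valid : I.G.WF := hI.1

theorem mem_exoVars_of_valid : ∀ v ∈ I.U, v ∈ I.G.exoVars := hI.2.2.1

theorem isEndoInst_act (ht : t ∈ I.L) (j : ℕ) : I.G.IsEndoInst (t.act j) := by
  obtain ⟨hx, -, hv, -⟩ := (valid_iff.1 hI).2.2.2.1 t ht
  rcases j with _ | _ | _
  exacts [⟨SCM.isInst_nil _, fun _ h => absurd h List.not_mem_nil⟩, hx, hv]

theorem isEndoInst_out (ht : t ∈ I.L) (j : ℕ) : I.G.IsEndoInst (t.out j) := by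
  obtain ⟨-, hy, -, hw, -⟩ := (valid_iff.1 hI).2.2.2.1 t ht
  rcases j with _ | _ | _
  exacts [⟨SCM.isInst_nil _, fun _ h => absurd h List.not_mem_nil⟩, hy, hw]

theorem isEndoInst_e (ht : t ∈ I.L) : I.G.IsEndoInst t.e :=
  ((valid_iff.1 hI).2.2.2.1 t ht).2.2.2.2.1

theorem disjoint_act_out (ht : t ∈ I.L) (j : ℕ) : (t.act j).vars.Disjoint (t.out j).vars := by
  obtain ⟨-, -, -, -, -, hdisj⟩ := (valid_iff.1 hI).2.2.2.1 t ht
  rcases j with _ | _ | _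
  · exact List.disjoint_nil_left _
  · exact (List.disjoint_append_right.1 (List.disjoint_append_left.1 hdisj).1).1
  · exact (List.disjoint_append_right.1 (List.disjoint_append_left.1 hdisj).2).2

omit hI in
theorem unitVar_mem_model (hm : (v, Mech.exo θ) ∈ I.G) (hv : v ∈ I.U) :
    (unitVar v, Mech.exo θ) ∈ model I :=
  mem_model.2 (.inr (.inl (SCM.mem_renamedRoots.2 ⟨v, θ, hm, hv, rfl, rfl⟩)))

omit hI in
theorem copyVar_mem_model_of_exo (hc : c ∈ I.L.zipIdx) (hm : (v, Mech.exo θ) ∈ I.G) (j : ℕ) :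
    (copyVar I.G I.U c.2 j v, Mech.exo θ) ∈ model I := by
  by_cases hv : v ∈ I.U
  · rw [copyVar_unit hv]
    exact unitVar_mem_model hm hv
  · rw [copyVar_exo hv (SCM.mem_exoVars.2 ⟨θ, hm⟩)]
    exact mem_model.2 (.inr (.inr ⟨c, hc, mem_component.2
      (.inl (SCM.mem_renamedRoots.2 ⟨v, θ, hm, hv, rfl, rfl⟩))⟩))

theorem copyVar_mem_model_of_endo (hc : c ∈ I.L.zipIdx) (hj : j < 3)
    (hm : (v, Mech.endo pa k rows) ∈ I.G) :
    (copyVar I.G I.U c.2 j v, worldMech I.G I.U I.L.length c.2 j (c.1.act j) (c.1.out j) v pa k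
      rows) ∈ model I := by
  rw [copyVar_endo (mem_exoVars_of_valid hI) (SCM.notMem_exoVars_of_mem_endoVars
    (wf_of_valid hI).nodup (SCM.mem_endoVars.2 ⟨pa, k, rows, hm⟩))]
  exact mem_model.2 (.inr (.inr ⟨c, hc, mem_component.2 (.inr ⟨j, hj,
    mem_world.2 ⟨v, pa, k, rows, hm, rfl, rfl⟩⟩)⟩))

theorem exists_mem_model (hc : c ∈ I.L.zipIdx) (hj : j < 3) (hv : v ∈ I.G.vars) :
    ∃ m, (copyVar I.G I.U c.2 j v, m) ∈ model I ∧ m.card = I.G.card v := by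
  have hG := (wf_of_valid hI).nodup
  obtain ⟨θ | ⟨pa, k, rows⟩, hm⟩ := SCM.mem_vars.1 hv
  · exact ⟨_, copyVar_mem_model_of_exo hc hm j, (SCM.card_eq hG hm).symm⟩
  · exact ⟨_, copyVar_mem_model_of_endo hI hc hj hm,
      (card_worldMech ..).trans (SCM.card_eq hG hm).symm⟩

theorem copyVar_mem_vars (hc : c ∈ I.L.zipIdx) (hj : j < 3) (hv : v ∈ I.G.vars) :
    copyVar I.G I.U c.2 j v ∈ (model I).vars := by
  obtain ⟨m, hm, -⟩ := exists_mem_model hI hc hj hv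
  exact SCM.mem_vars.2 ⟨m, hm⟩

theorem card_model_copyVar (hc : c ∈ I.L.zipIdx) (hj : j < 3) (hv : v ∈ I.G.vars) :
    (model I).card (copyVar I.G I.U c.2 j v) = I.G.card v := by
  obtain ⟨m, hm, hcard⟩ := exists_mem_model hI hc hj hv
  rw [SCM.card_eq (nodup_model (wf_of_valid hI).nodup) hm, hcard]

omit hI in
theorem mixVar_mem_model (I : USInput) : (mixVar, Mech.exo (I.L.map Term.weight)) ∈ model I :=
  mem_model.2 (.inl ⟨rfl, rfl⟩)

theorem card_model_mixVar : (model I).card mixVar = I.L.length := by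
  rw [SCM.card_eq (nodup_model (wf_of_valid hI).nodup) (mixVar_mem_model I), Mech.card,
    List.length_map]

theorem isTable_worldMech (hc : c ∈ I.L.zipIdx) (hj : j < 3)
    (hv : (v, Mech.endo pa k rows) ∈ I.G) {k' : ℕ}
    (h : worldMech I.G I.U I.L.length c.2 j (c.1.act j) (c.1.out j) v pa k rows =
      Mech.endo pa' k' rows') : (model I).IsTable pa' k' rows' := by
  have hG := wf_of_valid hI
  have hcopy : (model I).IsTable (pa.map (copyVar I.G I.U c.2 j)) k rows :=
    (hG.isTable hv).map (copyVar_injective ..)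
      (fun p hp => copyVar_mem_vars hI hc hj (hG.parents_subset hv hp))
      fun p hp => card_model_copyVar hI hc hj (hG.parents_subset hv hp)
  obtain ⟨rfl, ⟨rfl, rfl⟩ | ⟨z, hz, rfl, rfl⟩⟩ := eq_of_worldMech_eq_endo h
  · exact hcopy
  · have hlt := (isEndoInst_out hI (List.fst_mem_of_mem_zipIdx hc) j).1.lt_card_of_lookup hz
    rw [SCM.card_eq hG.nodup hv] at hlt
    rw [← card_model_mixVar hI]
    refine hcopy.mixRows (SCM.mem_vars.2 ⟨_, mixVar_mem_model I⟩) ?_ hlt c.2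
    simp [copyVar_ne_mixVar]

theorem sum_eq_one_of_mem_model (hw : (w, Mech.exo θ) ∈ model I) : θ.sum = 1 := by
  have hG := wf_of_valid hI
  rcases mem_model.1 hw with ⟨-, h⟩ | h | ⟨c, hc, h⟩
  · cases h
    exact (valid_iff.1 hI).2.2.2.2
  · obtain ⟨v, _, hv, -, -, ⟨⟩⟩ := SCM.mem_renamedRoots.1 h
    exact hG.sum_eq_one hv
  · rcases mem_component.1 h with h | ⟨j, -, h⟩
    · obtain ⟨v, _, hv, -, -, ⟨⟩⟩ := SCM.mem_renamedRoots.1 h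
      exact hG.sum_eq_one hv
    · obtain ⟨v, pa, k, rows, hv, -, hm⟩ := mem_world.1 h
      obtain ⟨s, hs, rfl⟩ := exists_of_worldMech_eq_exo hm.symm
      have hlt := (isEndoInst_act hI (List.fst_mem_of_mem_zipIdx hc) j).1.lt_card_of_lookup hs
      rw [SCM.card_eq hG.nodup hv] at hlt
      exact sum_pointMass hlt

omit hI in
theorem exists_of_endo_mem_model (hw : (w, Mech.endo pa k rows) ∈ model I) :
    ∃ c ∈ I.L.zipIdx, ∃ j < 3, ∃ v pa' k' rows', (v, Mech.endo pa' k' rows') ∈ I.G ∧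
      w = endoVar c.2 j v ∧ worldMech I.G I.U I.L.length c.2 j (c.1.act j) (c.1.out j) v pa' k'
        rows' = Mech.endo pa k rows := by
  rcases mem_model.1 hw with ⟨-, ⟨⟩⟩ | h | ⟨c, hc, h⟩
  · obtain ⟨-, -, -, -, -, ⟨⟩⟩ := SCM.mem_renamedRoots.1 h
  · rcases mem_component.1 h with h | ⟨j, hj, h⟩
    · obtain ⟨-, -, -, -, -, ⟨⟩⟩ := SCM.mem_renamedRoots.1 h
    · obtain ⟨v, pa', k', rows', hv, hw, hm⟩ := mem_world.1 h
      exact ⟨c, hc, j, hj, v, pa', k', rows', hv, hw, hm.symm⟩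

theorem wf_model : (model I).WF := by
  have hG := wf_of_valid hI
  refine ⟨by simp [model_eq], nodup_model hG.nodup, fun v θ => sum_eq_one_of_mem_model hI,
    fun v pa k rows hv => ?_, ?_⟩
  · obtain ⟨c, hc, j, hj, v', _, _, _, hv', -, hm⟩ := exists_of_endo_mem_model hv
    exact isTable_worldMech hI hc hj hv' hm
  · obtain ⟨rank, hrank⟩ := hG.2.2.2.2
    refine ⟨fun w => match w with
      | 3 :: _ :: _ :: v => rank v + 1
      | _ => 0, fun w pa k rows hw p hp => ?_⟩
    obtain ⟨c, -, j, -, v, pa', k', rows', hv, rfl, hm⟩ := exists_of_endo_mem_model hw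
    have hp' : p = mixVar ∨ ∃ q ∈ pa', copyVar I.G I.U c.2 j q = p := by
      obtain ⟨-, ⟨rfl, -⟩ | ⟨z, -, rfl, -⟩⟩ := eq_of_worldMech_eq_endo hm
      · exact .inr (List.mem_map.1 hp)
      · simpa using hp
    obtain rfl | ⟨q, hq, rfl⟩ := hp'
    · simp [mixVar, endoVar]
    · have := hrank _ _ _ _ hv q hq
      unfold copyVar unitVar exoVar endoVar
      split_ifs <;> simp [this]

omit hI in
theorem vars_copyInst (i j : ℕ) (e : Inst) :
    (copyInst i j e).map Prod.fst = e.vars.map (endoVar i j) := by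
  simp [copyInst, Function.comp_def]

theorem isInst_copyInst (hc : c ∈ I.L.zipIdx) (hj : j < 3) (he : I.G.IsEndoInst e) :
    (model I).IsInst (copyInst c.2 j e) := by
  refine ⟨?_, fun p hp => ?_⟩
  · rw [Inst.vars, vars_copyInst]
    exact he.1.1.map (endoVar_injective _ _)
  · obtain ⟨q, hq, rfl⟩ := List.mem_map.1 hp
    obtain ⟨hmem, hlt⟩ := he.1.2 q hq
    have hexo := SCM.notMem_exoVars_of_mem_endoVars (wf_of_valid hI).nodup (he.2 q hq)
    dsimp only
    rw [← copyVar_endo (mem_exoVars_of_valid hI) hexo]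
    exact ⟨copyVar_mem_vars hI hc hj hmem, by rwa [card_model_copyVar hI hc hj hmem]⟩

omit hI in
theorem disjoint_copyInst {j' : ℕ} (hj : j ≠ j') (e e' : Inst) :
    (copyInst i j e).vars.Disjoint (copyInst i j' e').vars := by
  intro w hw hw'
  rw [Inst.vars, vars_copyInst] at hw hw'
  obtain ⟨v, -, rfl⟩ := List.mem_map.1 hw
  obtain ⟨v', -, h⟩ := List.mem_map.1 hw'
  exact hj (endoVar_eq_iff.1 h).2.1.symm

omit hI in
theorem isInst_flatMap_zipIdx {l : List Term} {f : Term × ℕ → Inst}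
    (hf : ∀ c ∈ l.zipIdx, G.IsInst (f c))
    (hvars : ∀ c, ∀ w ∈ (f c).vars, ∃ j v, w = endoVar c.2 j v) :
    G.IsInst (l.zipIdx.flatMap f) := by
  refine ⟨?_, fun p hp => ?_⟩
  · rw [Inst.vars, List.map_flatMap, List.nodup_flatMap]
    refine ⟨fun c hc => (hf c hc).1, (pairwise_zipIdx_snd_ne l).imp fun hne w hw hw' => ?_⟩
    obtain ⟨j, v, rfl⟩ := hvars _ w hw
    obtain ⟨j', v', h⟩ := hvars _ _ hw'
    exact hne (endoVar_eq_iff.1 h).1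
  · obtain ⟨c, hc, hp⟩ := List.mem_flatMap.1 hp
    exact (hf c hc).2 p hp

theorem isInst_e₁ : (model I).IsInst (toRMAP I).e₁ := by
  refine isInst_flatMap_zipIdx (fun c hc => ?_) fun c w hw => ?_
  · have hout := isEndoInst_out hI (List.fst_mem_of_mem_zipIdx hc)
    exact (isInst_copyInst hI hc (by norm_num) (hout 1)).append
      (isInst_copyInst hI hc (by norm_num) (hout 2)) (disjoint_copyInst (by norm_num) _ _)
  · simp only [Inst.vars, List.map_append, vars_copyInst, List.mem_append,
      List.mem_map (f := endoVar _ _)] at hw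
    obtain ⟨v, -, rfl⟩ | ⟨v, -, rfl⟩ := hw <;> exact ⟨_, _, rfl⟩

theorem isInst_e₂ : (model I).IsInst (toRMAP I).e₂ := by
  refine isInst_flatMap_zipIdx (fun c hc => ?_) fun c w hw => ?_
  · have ht := List.fst_mem_of_mem_zipIdx hc
    have hact := isEndoInst_act hI ht
    refine ((isInst_copyInst hI hc (by norm_num) (hact 1)).append
      (isInst_copyInst hI hc (by norm_num) (hact 2)) (disjoint_copyInst (by norm_num) _ _)).append
      (isInst_copyInst hI hc (by norm_num) (isEndoInst_e hI ht)) ?_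
    rw [Inst.vars, List.map_append, List.disjoint_append_left]
    exact ⟨disjoint_copyInst (by norm_num) _ _, disjoint_copyInst (by norm_num) _ _⟩
  · simp only [Inst.vars, List.map_append, vars_copyInst, List.mem_append,
      List.mem_map (f := endoVar _ _)] at hw
    obtain (⟨v, -, rfl⟩ | ⟨v, -, rfl⟩) | ⟨v, -, rfl⟩ := hw <;> exact ⟨_, _, rfl⟩

omit hI in
theorem exists_of_mem_vars_e₁ (hw : w ∈ (toRMAP I).e₁.vars) :
    ∃ c ∈ I.L.zipIdx, ∃ j v, w = endoVar c.2 j v ∧ v ∈ (c.1.out j).vars := by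
  simp only [toRMAP, Inst.vars, List.map_flatMap, List.map_append, vars_copyInst, List.mem_flatMap,
    List.mem_append, List.mem_map (f := endoVar _ _)] at hw
  obtain ⟨c, hc, ⟨v, hv, rfl⟩ | ⟨v, hv, rfl⟩⟩ := hw
  exacts [⟨c, hc, 1, v, rfl, hv⟩, ⟨c, hc, 2, v, rfl, hv⟩]

omit hI in
theorem exists_of_mem_vars_e₂ (hw : w ∈ (toRMAP I).e₂.vars) :
    ∃ c ∈ I.L.zipIdx, ∃ j v, w = endoVar c.2 j v ∧ (j = 0 ∨ v ∈ (c.1.act j).vars) := by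
  simp only [toRMAP, Inst.vars, List.map_flatMap, List.map_append, vars_copyInst, List.mem_flatMap,
    List.mem_append, List.mem_map (f := endoVar _ _)] at hw
  obtain ⟨c, hc, (⟨v, hv, rfl⟩ | ⟨v, hv, rfl⟩) | ⟨v, -, rfl⟩⟩ := hw
  exacts [⟨c, hc, 1, v, rfl, .inr hv⟩, ⟨c, hc, 2, v, rfl, .inr hv⟩, ⟨c, hc, 0, v, rfl, .inl rfl⟩]

theorem disjoint_e₁_e₂ : (toRMAP I).e₁.vars.Disjoint (toRMAP I).e₂.vars := by
  intro w hw hw'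
  obtain ⟨c, hc, j, v, rfl, hout⟩ := exists_of_mem_vars_e₁ hw
  obtain ⟨d, hd, j', v', h, hact⟩ := exists_of_mem_vars_e₂ hw'
  obtain ⟨hi, rfl, rfl⟩ := endoVar_eq_iff.1 h
  obtain rfl := eq_of_mem_zipIdx hc hd hi
  rcases hact with rfl | hact
  · simp [Term.out] at hout
  · exact disjoint_act_out hI (List.fst_mem_of_mem_zipIdx hc) j hact hout

theorem ne_nil_of_valid : I.L ≠ [] := by
  intro hnil
  simpa [hnil] using hI.2.2.2.2

theorem unitVar_mem_vars (hv : v ∈ I.U) : unitVar v ∈ (model I).vars := by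
  obtain ⟨θ, hθ⟩ := SCM.mem_exoVars.1 (mem_exoVars_of_valid hI v hv)
  exact SCM.mem_vars.2 ⟨_, unitVar_mem_model hθ hv⟩

theorem valid_toRMAP : RMAP.Valid (toRMAP I) := by
  refine ⟨wf_model hI, hI.2.1.map unitVar_injective, fun w hw => ?_, isInst_e₁ hI,
    isInst_e₂ hI, fun w hw hw' => ?_, fun w hw hw' => ?_, disjoint_e₁_e₂ hI⟩
  · obtain ⟨v, hv, rfl⟩ := List.mem_map.1 hw
    exact unitVar_mem_vars hI hv
  · obtain ⟨v, -, rfl⟩ := List.mem_map.1 hw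
    obtain ⟨c, -, j, v', h, -⟩ := exists_of_mem_vars_e₁ hw'
    simp [unitVar, endoVar] at h
  · obtain ⟨v, -, rfl⟩ := List.mem_map.1 hw
    obtain ⟨c, -, j, v', h, -⟩ := exists_of_mem_vars_e₂ hw'
    simp [unitVar, endoVar] at h

end Valid

end Objective

/-! ### Conditioning on the unit variables -/

section Indicator

variable {U : List Var} {u : List ℕ} {e e' : Inst} {x : Var → ℕ}

theorem ind_true {p : Prop} (h : p) : ind p = 1 := if_pos h

theorem ind_false {p : Prop} (h : ¬p) : ind p = 0 := if_neg h

theorem ind_and (p q : Prop) : ind (p ∧ q) = ind p * ind q := by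
  by_cases hp : p <;> by_cases hq : q <;> simp [ind, hp, hq]

theorem ind_forall_mem {ι : Type*} (l : List ι) (p : ι → Prop) :
    ind (∀ c ∈ l, p c) = (l.map fun c => ind (p c)).prod := by
  induction l with
  | nil => exact ind_true (by simp)
  | cons c l ih => rw [List.map_cons, List.prod_cons, ← ih, ← ind_and, List.forall_mem_cons]

theorem agrees_append : Agrees (e ++ e') x ↔ Agrees e x ∧ Agrees e' x := List.forall_mem_append

theorem indepOf_ind_agrees {v : Var} (hv : v ∉ e.vars) : IndepOf (fun x => ind (Agrees e x)) v := by
  refine fun x s => congrArg ind (propext (forall₂_congr fun p hp => ?_))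
  rw [Function.update_of_ne]
  rintro rfl
  exact hv (List.mem_map_of_mem hp)

/-- The function that is `u` on the variables `U` and `0` elsewhere. -/
def assign (U : List Var) (u : List ℕ) (v : Var) : ℕ := ((U.zip u).lookup v).getD 0

theorem eq_assign (hu : U.length = u.length) (hx : ∀ v, v ∉ U → x v = 0)
    (h : Agrees (U.zip u) x) : x = assign U u := by
  have hfst : (U.zip u).map Prod.fst = U := List.map_fst_zip hu.le
  funext v
  unfold assign
  cases hv : (U.zip u).lookup v with
  | none => exact hx v (hfst ▸ lookup_eq_none_iff_notMem.1 hv)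
  | some s =>
    exact h (v, s) (mem_of_lookup_eq_some hv)

theorem vars_zip_subset (U : List Var) (u : List ℕ) : Inst.vars (U.zip u) ⊆ U := by
  intro v hv
  obtain ⟨p, hp, rfl⟩ := List.mem_map.1 hv
  exact (List.of_mem_zip (a := p.1) (b := p.2) hp).1

end Indicator

namespace SCM

variable {G : SCM} {U : List Var} {u : List ℕ} {v : Var} {p : Var × List ℚ≥0}

/-- The variables of `U` with their distributions. -/
def unitPriors (G : SCM) (U : List Var) : List (Var × List ℚ≥0) :=
  G.priors.filter (·.1 ∈ U)

/-- The exogenous variables outside `U` with their distributions. -/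
def restPriors (G : SCM) (U : List Var) : List (Var × List ℚ≥0) :=
  G.priors.filter (·.1 ∉ U)

/-- The probability that the variables `U` have states `u`. -/
noncomputable def unitProb (G : SCM) (U : List Var) (u : List ℕ) : ℚ≥0 :=
  expect (G.unitPriors U) (fun ω => ind (Agrees (U.zip u) ω)) 0

/-- The conditional probability of an event given that the variables `U` have states `u`. It is
defined even if that condition has probability zero. -/
noncomputable def probGiven (G : SCM) (U : List Var) (u : List ℕ) (A : (Var → ℕ) → Prop) : ℚ≥0 :=
  expect (G.restPriors U) (fun ω => ind (A ω)) (assign U u)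

theorem mem_of_mem_unitPriors (hp : p ∈ G.unitPriors U) : p.1 ∈ U := by
  simpa using (List.mem_filter.1 hp).2

theorem notMem_of_mem_restPriors (hp : p ∈ G.restPriors U) : p.1 ∉ U := by
  simpa using (List.mem_filter.1 hp).2

theorem WF.nodup_unitPriors (h : G.WF) (U : List Var) : ((G.unitPriors U).map Prod.fst).Nodup :=
  h.priors_nodup.sublist (List.filter_sublist.map _)

theorem WF.nodup_restPriors (h : G.WF) (U : List Var) : ((G.restPriors U).map Prod.fst).Nodup :=
  h.priors_nodup.sublist (List.filter_sublist.map _)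

theorem perm_unitPriors_append_restPriors (G : SCM) (U : List Var) :
    (G.unitPriors U ++ G.restPriors U).Perm G.priors := by
  simpa only [unitPriors, restPriors, decide_not] using
    List.filter_append_perm (fun p : Var × List ℚ≥0 => decide (p.1 ∈ U)) G.priors

theorem WF.expect_and (h : G.WF) (hu : U.length = u.length) (A : (Var → ℕ) → Prop) :
    expect G.priors (fun ω => ind (Agrees (U.zip u) ω ∧ A ω)) 0 =
      G.unitProb U u * G.probGiven U u A := by
  have hperm := G.perm_unitPriors_append_restPriors U
  have hrest : expect (G.restPriors U) (fun ω => ind (Agrees (U.zip u) ω ∧ A ω)) =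
      fun b => ind (Agrees (U.zip u) b) * expect (G.restPriors U) (fun ω => ind (A ω)) b := by
    funext b
    simp only [ind_and]
    refine expect_mul_left fun v hv => indepOf_ind_agrees fun hvU => ?_
    obtain ⟨p, hp, rfl⟩ := List.mem_map.1 hv
    exact notMem_of_mem_restPriors hp (vars_zip_subset _ _ hvU)
  rw [← expect_perm hperm ((hperm.map Prod.fst).nodup_iff.2 h.priors_nodup), expect_append, hrest,
    mul_comm, unitProb,
    ← expect_mul_left (g := fun _ => G.probGiven U u A) fun _ _ _ _ => rfl]
  refine expect_congr (h.nodup_unitPriors U) fun b hb => ?_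
  by_cases hA : Agrees (U.zip u) b
  · rw [probGiven, ← eq_assign hu (fun v hv => hb.1 v fun hmem => ?_) hA, mul_comm]
    obtain ⟨p, hp, rfl⟩ := List.mem_map.1 hmem
    exact hv (mem_of_mem_unitPriors hp)
  · rw [ind_false hA, zero_mul, mul_zero]

theorem Sol.eq_of_mem_exoVars {ω x : Var → ℕ} (hx : G.Sol [] ω x) (hv : v ∈ G.exoVars) :
    x v = ω v := by
  obtain ⟨θ, hθ⟩ := mem_exoVars.1 hv
  exact hx.eq_of_exo hθ rfl

theorem Sol.agrees_zip_iff {ω x : Var → ℕ} (hx : G.Sol [] ω x) (hU : ∀ v ∈ U, v ∈ G.exoVars) :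
    Agrees (U.zip u) x ↔ Agrees (U.zip u) ω :=
  forall₂_congr fun _ hp => Eq.congr_left
    (hx.eq_of_mem_exoVars (hU _ (vars_zip_subset _ _ (List.mem_map_of_mem hp))))

theorem holds_append_units (hU : ∀ v ∈ U, v ∈ G.exoVars) (ws : List (Inst × Inst))
    (e : Inst) (ω : Var → ℕ) :
    G.Holds (ws ++ [([], e ++ U.zip u)]) ω ↔
      Agrees (U.zip u) ω ∧ G.Holds (ws ++ [([], e)]) ω := by
  unfold Holds
  simp only [List.forall_mem_append, List.forall_mem_singleton, agrees_append]
  constructor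
  · rintro ⟨hws, x, hx, he, hxU⟩
    exact ⟨(hx.agrees_zip_iff hU).1 hxU, hws, x, hx, he⟩
  · rintro ⟨hA, hws, x, hx, he⟩
    exact ⟨hws, x, hx, he, (hx.agrees_zip_iff hU).2 hA⟩

theorem priors_append (G G' : SCM) : SCM.priors (G ++ G') = G.priors ++ SCM.priors G' :=
  List.filterMap_append

theorem priors_flatMap {ι : Type*} (l : List ι) (f : ι → SCM) :
    SCM.priors (l.flatMap f) = l.flatMap fun c => (f c).priors := List.filterMap_flatMap

theorem priors_renamedRoots (G : SCM) (q : Var → Prop) [DecidablePred q] (f : Var → Var) :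
    (G.renamedRoots q f).priors = (G.priors.filter (q ·.1)).map fun p => (f p.1, p.2) := by
  unfold renamedRoots priors
  induction G with
  | nil => rfl
  | cons nd G ih =>
    obtain ⟨v, θ | ⟨_, _, _⟩⟩ := nd
    · by_cases hv : q v <;> simp [hv, ih]
    · exact ih

end SCM

namespace Objective

open SCM

variable {G : SCM} {U : List Var} {u : List ℕ} {n i j : ℕ} {t : Term} {I : USInput}
  {A : ℕ → (Var → ℕ) → Prop} {v : Var} {b : Var → ℕ}

theorem priors_component (G : SCM) (U : List Var) (n i j : ℕ) (t : Term) :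
    (component G U n i t).priors = ((G.restPriors U).map fun p => (copyVar G U i j p.1, p.2)) ++
      (List.range 3).flatMap fun j => (world G U n i j (t.act j) (t.out j)).priors := by
  rw [component_eq_flatMap, priors_append, priors_flatMap, priors_renamedRoots]
  refine congrArg (· ++ _) (List.map_congr_left fun p hp => ?_)
  rw [copyVar_exo (notMem_of_mem_restPriors hp)]
  exact mem_exoVars.2 ⟨p.2, mem_priors.1 (List.mem_of_mem_filter hp)⟩

theorem priors_model (I : USInput) : (model I).priors =
    (mixVar, I.L.map Term.weight) :: (((I.G.unitPriors I.U).map fun p => (unitVar p.1, p.2)) ++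
      I.L.zipIdx.flatMap fun c => (component I.G I.U I.L.length c.2 c.1).priors) := by
  rw [unitPriors, ← priors_renamedRoots, ← priors_flatMap, ← priors_append]
  rfl

theorem exists_of_mem_priors_component (hv : v ∈ (component G U n i t).priors.map Prod.fst) :
    (∃ w, v = exoVar i w) ∨ ∃ j w, v = endoVar i j w :=
  exists_of_mem_vars_component ((priors_vars_sublist _).subset hv)

/-- The indicator of an event about the exogenous variables of component `i` that may depend on the
state of the mixture variable. The index `3` belongs to no world of the objective model, so that
the endogenous copies that are read here are not among its variables. -/
noncomputable def componentInd (G : SCM) (U : List Var) (A : ℕ → (Var → ℕ) → Prop) (i : ℕ)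
    (b : Var → ℕ) : ℚ≥0 :=
  ind (A (b mixVar) (b ∘ copyVar G U i 3))

theorem indepOf_componentInd (hmix : v ≠ mixVar) (hv : ∀ w, copyVar G U i 3 w ≠ v) :
    IndepOf (componentInd G U A i) v := by
  intro b s
  rw [componentInd, Function.update_comp_eq_of_forall_ne _ _ hv, Function.update_of_ne hmix.symm,
    componentInd]

theorem indepOf_componentInd_endoVar (hj : j ≠ 3) :
    IndepOf (componentInd G U A i) (endoVar i j v) := by
  refine indepOf_componentInd (by simp [mixVar, endoVar]) fun w => ?_
  unfold copyVar unitVar exoVar endoVar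
  split_ifs <;> simp [hj.symm]

theorem indepOf_componentInd_of_ne {i' : ℕ} (hi : i ≠ i')
    (hv : v ∈ (component G U n i' t).priors.map Prod.fst) :
    IndepOf (componentInd G U A i) v := by
  rcases exists_of_mem_priors_component hv with ⟨w, rfl⟩ | ⟨j, w, rfl⟩
  all_goals
    refine indepOf_componentInd (by simp [mixVar, exoVar, endoVar]) fun w' => ?_
    unfold copyVar unitVar exoVar endoVar
    split_ifs <;> simp [hi]

theorem expect_worlds (hsum : ∀ p ∈ (component G U n i t).priors, p.2.sum = 1) :
    expect ((List.range 3).flatMap fun j => (world G U n i j (t.act j) (t.out j)).priors)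
      (componentInd G U A i) = componentInd G U A i := by
  funext a
  refine expect_of_indep (fun p hp => hsum p ?_) fun v hv => ?_
  · rw [priors_component G U n i 3 t]
    exact List.mem_append_right _ hp
  · rw [List.map_flatMap, List.mem_flatMap] at hv
    obtain ⟨j, hj, hv⟩ := hv
    obtain ⟨w, rfl⟩ := exists_of_mem_vars_world ((priors_vars_sublist _).subset hv)
    exact indepOf_componentInd_endoVar (List.mem_range.1 hj).ne

theorem expect_component (hG : G.WF) (hsum : ∀ p ∈ (component G U n i t).priors, p.2.sum = 1)
    (A : ℕ → (Var → ℕ) → Prop) (b : Var → ℕ) :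
    expect (component G U n i t).priors (componentInd G U A i) b =
      expect (G.restPriors U) (fun ω => ind (A (b mixVar) ω)) (b ∘ copyVar G U i 3) := by
  rw [priors_component G U n i 3 t, expect_append, expect_worlds hsum,
    ← expect_map (copyVar_injective G U i 3)]
  refine expect_congr ?_ fun a ha => ?_
  · have hnodup := (hG.nodup_restPriors U).map (copyVar_injective G U i 3)
    rwa [List.map_map] at hnodup ⊢
  · rw [componentInd, ha.1]
    rw [List.map_map]
    intro hmix
    obtain ⟨p, -, hp⟩ := List.mem_map.1 hmix
    exact copyVar_ne_mixVar _ _ _ _ _ hp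

theorem expect_components (hI : UnitSelection.Valid I) (A : Term × ℕ → ℕ → (Var → ℕ) → Prop)
    (b : Var → ℕ) :
    expect (I.L.zipIdx.flatMap fun c => (component I.G I.U I.L.length c.2 c.1).priors)
        (fun α => (I.L.zipIdx.map fun c => componentInd I.G I.U (A c) c.2 α).prod) b =
      (I.L.zipIdx.map fun c => expect (I.G.restPriors I.U) (fun ω => ind (A c (b mixVar) ω))
        (b ∘ copyVar I.G I.U c.2 3)).prod := by
  rw [expect_flatMap]
  · refine congrArg List.prod (List.map_congr_left fun c hc => ?_)
    refine expect_component (wf_of_valid hI) (fun p hp => ?_) _ _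
    exact sum_eq_one_of_mem_model hI (w := p.1) (mem_model.2 (.inr (.inr ⟨c, hc, mem_priors.1 hp⟩)))
  · refine (pairwise_zipIdx_snd_ne I.L).imp fun {c d} hcd => ⟨fun v hv => ⟨?_, fun hv' => ?_⟩,
      fun v hv => indepOf_componentInd_of_ne hcd hv⟩
    · exact indepOf_componentInd_of_ne hcd.symm hv
    · rcases exists_of_mem_priors_component hv with ⟨w, rfl⟩ | ⟨j, w, rfl⟩ <;>
        rcases exists_of_mem_priors_component hv' with ⟨w', h⟩ | ⟨j', w', h⟩ <;>
        simp only [exoVar, endoVar, List.cons.injEq] at h <;>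
        exact hcd (by tauto)

theorem agrees_zip_unitVar :
    Agrees ((U.map unitVar).zip u) b ↔ Agrees (U.zip u) (b ∘ unitVar) := by
  unfold Agrees
  rw [List.zip_map_left, List.forall_mem_map]
  rfl

theorem expect_unitPriors (hb : b ∘ unitVar = 0) :
    expect ((G.unitPriors U).map fun p => (unitVar p.1, p.2))
      (fun b => ind (Agrees ((U.map unitVar).zip u) b)) b = G.unitProb U u := by
  simp only [agrees_zip_unitVar]
  rw [expect_map (F := fun ω => ind (Agrees (U.zip u) ω)) unitVar_injective, hb, unitProb]

theorem comp_copyVar_eq_assign (hu : U.length = u.length) {s : ℕ}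
    (hb : InSupport ((G.unitPriors U).map fun p => (unitVar p.1, p.2))
      (Function.update 0 mixVar s) b)
    (hA : Agrees ((U.map unitVar).zip u) b) (i j : ℕ) :
    b ∘ copyVar G U i j = assign U u := by
  refine eq_assign hu (fun v hv => ?_) fun p hp => ?_
  · rw [Function.comp_apply, hb.1, Function.update_of_ne (copyVar_ne_mixVar _ _ _ _ _),
      Pi.zero_apply]
    rw [List.map_map]
    intro hunit
    obtain ⟨p, hp, hcopy⟩ := List.mem_map.1 hunit
    have hpU := mem_of_mem_unitPriors hp
    rw [Function.comp_apply, ← copyVar_unit (G := G) (i := i) (j := j) hpU] at hcopy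
    exact hv (copyVar_injective _ _ _ _ hcopy ▸ hpU)
  · rw [Function.comp_apply, copyVar_unit (vars_zip_subset _ _ (List.mem_map_of_mem hp))]
    exact agrees_zip_unitVar.1 hA p hp

theorem unitVar_notMem_component {c : Term × ℕ} {w : Var} :
    unitVar w ∉ (component G U n c.2 c.1).priors.map Prod.fst := by
  intro hw
  rcases exists_of_mem_priors_component hw with ⟨w', h⟩ | ⟨j, w', h⟩ <;>
    simp [unitVar, exoVar, endoVar] at h

theorem expect_components_mul (hI : UnitSelection.Valid I)
    (A : Term × ℕ → ℕ → (Var → ℕ) → Prop) (b : Var → ℕ) :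
    expect (I.L.zipIdx.flatMap fun c => (component I.G I.U I.L.length c.2 c.1).priors)
        (fun α => ind (Agrees ((I.U.map unitVar).zip u) α) *
          (I.L.zipIdx.map fun c => componentInd I.G I.U (A c) c.2 α).prod) b =
      ind (Agrees ((I.U.map unitVar).zip u) b) *
        (I.L.zipIdx.map fun c => expect (I.G.restPriors I.U) (fun ω => ind (A c (b mixVar) ω))
          (b ∘ copyVar I.G I.U c.2 3)).prod := by
  rw [expect_mul_left, expect_components hI]
  refine fun v hv => indepOf_ind_agrees fun hvU => ?_
  obtain ⟨w, -, rfl⟩ := List.mem_map.1 (vars_zip_subset _ _ hvU)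
  simp only [List.map_flatMap, List.mem_flatMap, unitVar_notMem_component, and_false,
    exists_false] at hv

theorem expect_model (hI : UnitSelection.Valid I) (hu : I.U.length = u.length)
    (A : Term × ℕ → ℕ → (Var → ℕ) → Prop) :
    expect (model I).priors (fun α => ind (Agrees ((I.U.map unitVar).zip u) α) *
        (I.L.zipIdx.map fun c => componentInd I.G I.U (A c) c.2 α).prod) 0 =
      ∑ s ∈ Finset.range (I.L.map Term.weight).length, (I.L.map Term.weight).getD s 0 *
        (I.G.unitProb I.U u *
          (I.L.zipIdx.map fun c => I.G.probGiven I.U u (A c s)).prod) := by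
  rw [priors_model, expect]
  refine Finset.sum_congr rfl fun s _ => congrArg _ ?_
  have hzero : Function.update (0 : Var → ℕ) mixVar s ∘ unitVar = 0 :=
    Function.update_comp_eq_of_forall_ne _ _ fun v => by simp [unitVar, mixVar]
  rw [expect_append, funext (expect_components_mul hI A), ← expect_unitPriors hzero, mul_comm,
    ← expect_mul_left
      (g := fun _ => (I.L.zipIdx.map fun c => I.G.probGiven I.U u (A c s)).prod)
      fun _ _ _ _ => rfl]
  have hnodup := ((wf_of_valid hI).nodup_unitPriors I.U).map unitVar_injective
  rw [List.map_map] at hnodup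
  refine expect_congr (by rwa [List.map_map]) fun b hb => ?_
  by_cases hA : Agrees ((I.U.map unitVar).zip u) b
  · have hmix : b mixVar = s := by
      rw [hb.1, Function.update_self]
      rw [List.map_map]
      intro h
      obtain ⟨p, -, hp⟩ := List.mem_map.1 h
      simp [unitVar, mixVar] at hp
    simp only [comp_copyVar_eq_assign hu hb hA, hmix, probGiven, mul_comm]
  · rw [ind_false hA, zero_mul, mul_zero]

end Objective

/-! ### The value of the objective model -/

theorem OptProblem.isPolyReduction_of {P Q : OptProblem} {f : P.Input → Q.Input}
    (hf : OptProblem.PolyTime P Q f) (hvalid : ∀ I, P.Valid I → Q.Valid (f I))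
    (hfeasible : ∀ I, P.Valid I → ∀ u, Q.Feasible (f I) u ↔ P.Feasible I u)
    (hvalue : ∀ I, P.Valid I → ∀ u, P.Feasible I u → Q.value (f I) u = P.value I u) :
    OptProblem.IsPolyReduction P Q f := by
  refine ⟨hf, fun I hI => ⟨hvalid I hI, fun u => ?_, hfeasible I hI, hvalue I hI⟩⟩
  unfold OptProblem.IsArgMax
  rw [hfeasible I hI]
  refine and_congr_right fun hu => forall_congr' fun u' => ?_
  rw [hfeasible I hI]
  exact forall_congr' fun hu' => by rw [hvalue I hI u hu, hvalue I hI u' hu']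

theorem prod_map_zipIdx {α M : Type*} [CommMonoid M] (l : List α) (f : α × ℕ → M) :
    (l.zipIdx.map f).prod = ∏ i : Fin l.length, f (l[i], i) := by
  rw [← List.prod_ofFn]
  exact congrArg List.prod (List.ext_getElem (by simp) (by simp))

theorem prod_ite_eq_mul_div {ι M : Type*} [Fintype ι] [DecidableEq ι] [CommGroupWithZero M]
    (a b : ι → M) {s : ι} (hb : b s ≠ 0) :
    ∏ i, (if s = i then a i else b i) = (∏ i, b i) * (a s / b s) := by
  have hrest : ∏ i ∈ Finset.univ.erase s, (if s = i then a i else b i) =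
      ∏ i ∈ Finset.univ.erase s, b i :=
    Finset.prod_congr rfl fun i hi => if_neg (Finset.ne_of_mem_erase hi).symm
  rw [← Finset.mul_prod_erase _ _ (Finset.mem_univ s), ← Finset.mul_prod_erase _ b
    (Finset.mem_univ s), if_pos rfl, hrest]
  field_simp

theorem sum_mul_prod_ite_div_prod {ι K : Type*} [Fintype ι] [DecidableEq ι] [Semifield K]
    (w a : ι → K) {b : ι → K} (hb : ∀ i, b i ≠ 0) :
    (∑ s, w s * ∏ i, if s = i then a i else b i) / ∏ i, b i = ∑ s, w s * (a s / b s) := by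
  rw [Finset.sum_div]
  refine Finset.sum_congr rfl fun s _ => ?_
  rw [prod_ite_eq_mul_div a b (hb s), mul_div_assoc,
    mul_div_cancel_left₀ _ (Finset.prod_ne_zero_iff.2 fun i _ => hb i)]

theorem eq_of_getD_pointMass_ne_zero {k s a : ℕ} (h : (pointMass k s).getD a 0 ≠ 0) : a = s := by
  by_contra hne
  refine h ?_
  by_cases ha : a < k <;> simp [pointMass, ha, hne]

theorem exists_of_lookup_mixRows {n i z h a : ℕ} {p : List ℕ} {rows : List (List ℕ × ℕ)}
    (hrows : (rows.map Prod.fst).Nodup) (ha : (mixRows n i z rows).lookup (h :: p) = some a) :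
    ∃ b, rows.lookup p = some b ∧ a = if h = i then b else z := by
  have hmem := mem_of_lookup_eq_some ha
  simp only [mixRows, List.mem_flatMap, List.mem_map, Prod.mk.injEq, List.cons.injEq] at hmem
  obtain ⟨r, hr, -, -, ⟨rfl, rfl⟩, rfl⟩ := hmem
  exact ⟨r.2, (lookup_eq_some_iff_mem hrows).2 hr, rfl⟩

namespace SCM

variable {G : SCM} {act out e : Inst} {ω x : Var → ℕ} {v : Var} {θ : List ℚ≥0}

theorem WF.lt_card_of_inSupport (h : G.WF) (hω : InSupport G.priors 0 ω) :
    ∀ v ∈ G.exoVars, ω v < G.card v := by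
  intro v hv
  obtain ⟨θ, hθ⟩ := mem_exoVars.1 hv
  rw [card_eq h.nodup hθ]
  exact lt_length_of_getD_ne_zero (hω.2 (v, θ) (mem_priors.2 hθ))

theorem WF.exists_sol_iff (h : G.WF) (hx : G.Sol act ω x) (hout : ∀ p ∈ out, p.1 ∈ G.vars) :
    (∃ y, G.Sol act ω y ∧ Agrees out y) ↔ Agrees out x :=
  ⟨fun ⟨_, hy, hagree⟩ p hp => (h.sol_unique hx hy _ (hout p hp)).trans (hagree p hp),
    fun hagree => ⟨x, hx, hagree⟩⟩

theorem holds_cons {w : Inst × Inst} {worlds : List (Inst × Inst)} :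
    G.Holds (w :: worlds) ω ↔ (∃ x, G.Sol w.1 ω x ∧ Agrees w.2 x) ∧ G.Holds worlds ω :=
  List.forall_mem_cons

theorem holds_singleton {w : Inst × Inst} :
    G.Holds [w] ω ↔ ∃ x, G.Sol w.1 ω x ∧ Agrees w.2 x :=
  List.forall_mem_singleton

theorem WF.obs_eq_expect (h : G.WF) (he : ∀ p ∈ e, p.1 ∈ G.vars) {F : (Var → ℕ) → ℚ≥0}
    (hF : ∀ ω x, InSupport G.priors 0 ω → G.Sol [] ω x → ind (Agrees e x) = F ω) :
    G.obs e = expect G.priors F 0 := by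
  rw [obs, h.prob_eq]
  refine expect_congr h.priors_nodup fun ω hω => ?_
  obtain ⟨x, hx, -⟩ := h.exists_sol (h.lt_card_of_inSupport hω)
  rw [holds_singleton, h.exists_sol_iff hx he, hF ω x hω hx]

theorem Sol.agrees_act (hx : G.Sol act ω x) (hact : G.IsInst act) : Agrees act x := by
  intro p hp
  obtain ⟨m, hm⟩ := mem_vars.1 (hact.2 p hp).1
  exact hx.eq_of_act hm ((lookup_eq_some_iff_mem hact.1).2 hp)

theorem IsEndoInst.lookup_eq_none (he : G.IsEndoInst e) (hG : G.vars.Nodup)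
    (hm : (v, Mech.exo θ) ∈ G) : e.lookup v = none := by
  rw [lookup_eq_none_iff_notMem]
  intro hv
  obtain ⟨p, hp, rfl⟩ := List.mem_map.1 hv
  exact notMem_exoVars_of_mem_endoVars hG (he.2 p hp) (mem_exoVars.2 ⟨θ, hm⟩)

end SCM

namespace Term

/-- The worlds in which the outcomes of `t` and its evidence are observed. -/
def worlds (t : Term) : List (Inst × Inst) := [(t.x, t.y), (t.v, t.w), ([], t.e)]

/-- The world in which the evidence of `t` is observed. -/
def evidenceWorlds (t : Term) : List (Inst × Inst) := [([], t.e)]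

end Term

namespace Objective

open SCM

variable {I : USInput} {α x : Var → ℕ} {c : Term × ℕ} {j s : ℕ} {u : List ℕ} {e : Inst} {v : Var}

theorem copyVar_eq_copyVar_of_mem_exoVars {G : SCM} (hv : v ∈ G.exoVars) (U : List Var)
    (i j j' : ℕ) : copyVar G U i j v = copyVar G U i j' v := by
  simp only [copyVar, hv, if_true]

/-- The intervention on the original model that world `j` of component `c` amounts to when the
mixture variable has state `s`: in the states of the other components, the outcome is imposed as
well. -/
def action (c : Term × ℕ) (j s : ℕ) : Inst := c.1.act j ++ if s = c.2 then [] else c.1.out j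

theorem action_self (c : Term × ℕ) (j : ℕ) : action c j c.2 = c.1.act j := by simp [action]

theorem action_of_ne (hs : s ≠ c.2) : action c j s = c.1.act j ++ c.1.out j := by
  rw [action, if_neg hs]

theorem action_zero (c : Term × ℕ) (s : ℕ) : action c 0 s = [] := by
  unfold action
  split_ifs <;> rfl

theorem lookup_action : (action c j s).lookup v =
    ((c.1.act j).lookup v).or (if s = c.2 then none else (c.1.out j).lookup v) := by
  rw [action, List.lookup_append]
  split_ifs <;> rfl

section Events

variable (hI : UnitSelection.Valid I) (hα : InSupport (model I).priors 0 α)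
  (hx : (model I).Sol [] α x) (hc : c ∈ I.L.zipIdx)
include hI

theorem agrees_copyInst (he : I.G.IsEndoInst e) (i j : ℕ) :
    Agrees (copyInst i j e) x ↔ Agrees e (x ∘ copyVar I.G I.U i j) := by
  unfold Agrees copyInst
  rw [List.forall_mem_map]
  refine forall₂_congr fun p hp => ?_
  rw [Function.comp_apply, copyVar_endo (mem_exoVars_of_valid hI)
    (notMem_exoVars_of_mem_endoVars (wf_of_valid hI).nodup (he.2 p hp))]

include hc in
theorem isEndoInst_action (j s : ℕ) : I.G.IsEndoInst (action c j s) := by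
  have ht := List.fst_mem_of_mem_zipIdx hc
  have hact := isEndoInst_act hI ht j
  have hout := isEndoInst_out hI ht j
  by_cases hs : s = c.2
  · rwa [hs, action_self]
  · rw [action_of_ne hs]
    exact ⟨hact.1.append hout.1 (disjoint_act_out hI ht j),
      List.forall_mem_append.2 ⟨hact.2, hout.2⟩⟩

include hα hx hc

theorem sol_copy (hj : j < 3) : I.G.Sol (action c j (α mixVar)) (α ∘ copyVar I.G I.U c.2 3)
    (x ∘ copyVar I.G I.U c.2 j) := by
  have hG := wf_of_valid hI
  rintro v (θ | ⟨pa, k, rows⟩) hm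
  · simp only [(isEndoInst_action hI hc j _).lookup_eq_none hG.nodup hm, Function.comp_apply]
    rw [hx.eq_of_exo (copyVar_mem_model_of_exo hc hm j) rfl,
      copyVar_eq_copyVar_of_mem_exoVars (mem_exoVars.2 ⟨θ, hm⟩)]
  have hnode := copyVar_mem_model_of_endo hI hc hj hm
  unfold worldMech at hnode
  rw [lookup_action]
  cases hact : (c.1.act j).lookup v with
  | some s =>
    simp only [hact] at hnode
    exact (hx.eq_of_exo hnode rfl).trans
      (eq_of_getD_pointMass_ne_zero (hα.2 _ (mem_priors.2 hnode)))
  | none =>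
    cases hout : (c.1.out j).lookup v with
    | none =>
      simp only [hact, hout] at hnode
      simpa using hx.lookup_eq hnode rfl
    | some z =>
      simp only [hact, hout] at hnode
      have hlookup := hx.lookup_eq hnode rfl
      rw [List.map_cons, hx.eq_of_exo (mixVar_mem_model I) rfl, List.map_map] at hlookup
      obtain ⟨a, ha, hxv⟩ := exists_of_lookup_mixRows (hG.isTable hm).2.2.2.1 hlookup
      by_cases hmix : α mixVar = c.2
      · simpa [hmix, hxv] using ha
      · simpa [hmix] using hxv

theorem agrees_copyInst_act (hj : j < 3) : Agrees (copyInst c.2 j (c.1.act j)) x := by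
  have hagree := (sol_copy hI hα hx hc hj).agrees_act (isEndoInst_action hI hc j _).1
  rw [agrees_copyInst hI (isEndoInst_act hI (List.fst_mem_of_mem_zipIdx hc) j)]
  exact (agrees_append.1 hagree).1

theorem agrees_copyInst_out_of_ne (hj : j < 3) (hmix : α mixVar ≠ c.2) :
    Agrees (copyInst c.2 j (c.1.out j)) x := by
  have hagree := (sol_copy hI hα hx hc hj).agrees_act (isEndoInst_action hI hc j _).1
  rw [action_of_ne hmix] at hagree
  rw [agrees_copyInst hI (isEndoInst_out hI (List.fst_mem_of_mem_zipIdx hc) j)]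
  exact (agrees_append.1 hagree).2

theorem agrees_copyInst_out_of_eq (hj : j < 3) (hmix : α mixVar = c.2) :
    Agrees (copyInst c.2 j (c.1.out j)) x ↔ ∃ y, I.G.Sol (c.1.act j)
      (α ∘ copyVar I.G I.U c.2 3) y ∧ Agrees (c.1.out j) y := by
  have hout := isEndoInst_out hI (List.fst_mem_of_mem_zipIdx hc) j
  have hsol := sol_copy hI hα hx hc hj
  rw [hmix, action_self] at hsol
  rw [agrees_copyInst hI hout,
    (wf_of_valid hI).exists_sol_iff hsol fun p hp => (hout.1.2 p hp).1]

theorem agrees_copyInst_e : Agrees (copyInst c.2 0 c.1.e) x ↔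
    I.G.Holds c.1.evidenceWorlds (α ∘ copyVar I.G I.U c.2 3) := by
  have he := isEndoInst_e hI (List.fst_mem_of_mem_zipIdx hc)
  have hsol := sol_copy hI hα hx hc (j := 0) (by norm_num)
  rw [action_zero] at hsol
  rw [agrees_copyInst hI he, Term.evidenceWorlds, holds_singleton,
    (wf_of_valid hI).exists_sol_iff hsol fun p hp => (he.1.2 p hp).1]

theorem agrees_copyInst_iff :
    Agrees (copyInst c.2 1 c.1.y ++ copyInst c.2 2 c.1.w) x ∧ Agrees (copyInst c.2 0 c.1.e) x ↔
      I.G.Holds (if α mixVar = c.2 then c.1.worlds else c.1.evidenceWorlds)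
        (α ∘ copyVar I.G I.U c.2 3) := by
  rw [agrees_append, agrees_copyInst_e hI hα hx hc]
  by_cases hmix : α mixVar = c.2
  · rw [if_pos hmix, Term.worlds, holds_cons, holds_cons, and_assoc]
    exact and_congr (agrees_copyInst_out_of_eq hI hα hx hc (j := 1) (by norm_num) hmix)
      (and_congr (agrees_copyInst_out_of_eq hI hα hx hc (j := 2) (by norm_num) hmix) Iff.rfl)
  · rw [if_neg hmix]
    exact and_iff_right ⟨agrees_copyInst_out_of_ne hI hα hx hc (j := 1) (by norm_num) hmix,
      agrees_copyInst_out_of_ne hI hα hx hc (j := 2) (by norm_num) hmix⟩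

omit hc

omit hα in
theorem agrees_zip_iff :
    Agrees ((toRMAP I).U.zip u) x ↔ Agrees ((I.U.map unitVar).zip u) α := by
  refine hx.agrees_zip_iff fun w hw => ?_
  obtain ⟨v, hv, rfl⟩ := List.mem_map.1 hw
  obtain ⟨θ, hθ⟩ := mem_exoVars.1 (mem_exoVars_of_valid hI v hv)
  exact mem_exoVars.2 ⟨θ, unitVar_mem_model hθ hv⟩

theorem agrees_e₂ : Agrees (toRMAP I).e₂ x ↔
    ∀ c ∈ I.L.zipIdx, Agrees (copyInst c.2 0 c.1.e) x := by
  refine List.forall_mem_flatMap.trans (forall₂_congr fun c hc => ?_)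
  refine agrees_append.trans (and_iff_right (agrees_append.2 ?_))
  exact ⟨agrees_copyInst_act hI hα hx hc (j := 1) (by norm_num),
    agrees_copyInst_act hI hα hx hc (j := 2) (by norm_num)⟩

end Events

section Value

variable (hI : UnitSelection.Valid I)
include hI

theorem mem_vars_of_mem_instances (u : List ℕ) :
    ∀ p ∈ (toRMAP I).e₁ ++ (toRMAP I).U.zip u ++ (toRMAP I).e₂, p.1 ∈ (model I).vars := by
  obtain ⟨-, -, hU, he₁, he₂, -⟩ := valid_toRMAP hI
  simp only [List.forall_mem_append]
  exact ⟨⟨fun p hp => (he₁.2 p hp).1, fun p hp => hU (vars_zip_subset _ _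
    (List.mem_map_of_mem hp))⟩, fun p hp => (he₂.2 p hp).1⟩

theorem obs_outcome (hu : I.U.length = u.length) :
    (model I).obs ((toRMAP I).e₁ ++ (toRMAP I).U.zip u ++ (toRMAP I).e₂) =
      ∑ s : Fin I.L.length, I.L[s].weight * (I.G.unitProb I.U u *
        ∏ i : Fin I.L.length, if s = i then I.G.probGiven I.U u (I.G.Holds I.L[i].worlds)
          else I.G.probGiven I.U u (I.G.Holds I.L[i].evidenceWorlds)) := by
  refine Eq.trans ?_ ((expect_model hI hu fun c s =>
    I.G.Holds (if s = c.2 then c.1.worlds else c.1.evidenceWorlds)).trans ?_)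
  · refine (wf_model hI).obs_eq_expect (mem_vars_of_mem_instances hI u) fun α x hα hx => ?_
    simp only [componentInd, ← ind_forall_mem, ← ind_and]
    refine congrArg ind (propext ?_)
    rw [agrees_append, agrees_append, and_right_comm, and_comm, agrees_zip_iff hI hx,
      agrees_e₂ hI hα hx]
    refine and_congr_right' ((and_congr_left' List.forall_mem_flatMap).trans ?_)
    rw [← forall₂_and]
    exact forall₂_congr fun c hc => agrees_copyInst_iff hI hα hx hc
  · simp [prod_map_zipIdx, Finset.sum_range, Fin.val_inj, apply_ite I.G.Holds,
      apply_ite (I.G.probGiven I.U u)]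

theorem obs_evidence (hu : I.U.length = u.length) :
    (model I).obs ((toRMAP I).U.zip u ++ (toRMAP I).e₂) = I.G.unitProb I.U u *
      ∏ i : Fin I.L.length, I.G.probGiven I.U u (I.G.Holds I.L[i].evidenceWorlds) := by
  have hexpect := expect_model hI hu fun c _ => I.G.Holds c.1.evidenceWorlds
  rw [← Finset.sum_mul, sum_range_getD, hI.2.2.2.2, one_mul, prod_map_zipIdx] at hexpect
  rw [← hexpect]
  refine (wf_model hI).obs_eq_expect (fun p hp => mem_vars_of_mem_instances hI u p ?_)
    fun α x hα hx => ?_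
  · rw [List.append_assoc]
    exact List.mem_append_right _ hp
  simp only [componentInd, ← ind_forall_mem, ← ind_and]
  refine congrArg ind (propext ?_)
  rw [agrees_append, agrees_zip_iff hI hx, agrees_e₂ hI hα hx]
  exact and_congr_right' (forall₂_congr fun c hc => agrees_copyInst_e hI hα hx hc)

theorem prob_worlds_zip (hu : I.U.length = u.length) (t : Term) :
    I.G.prob [(t.x, t.y), (t.v, t.w), ([], t.e ++ I.U.zip u)] =
      I.G.unitProb I.U u * I.G.probGiven I.U u (I.G.Holds t.worlds) := by
  rw [(wf_of_valid hI).prob_eq, ← (wf_of_valid hI).expect_and hu]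
  exact congrArg (expect _ · 0) (funext fun ω => congrArg ind (propext
    (holds_append_units (mem_exoVars_of_valid hI) [(t.x, t.y), (t.v, t.w)] t.e ω)))

theorem obs_e_zip (hu : I.U.length = u.length) (t : Term) :
    I.G.obs (t.e ++ I.U.zip u) =
      I.G.unitProb I.U u * I.G.probGiven I.U u (I.G.Holds t.evidenceWorlds) := by
  rw [SCM.obs, (wf_of_valid hI).prob_eq, ← (wf_of_valid hI).expect_and hu]
  exact congrArg (expect _ · 0) (funext fun ω => congrArg ind (propext
    (holds_append_units (mem_exoVars_of_valid hI) [] t.e ω)))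

theorem isStates_map_unitVar :
    (model I).IsStates u (I.U.map unitVar) ↔ I.G.IsStates u I.U := by
  refine isStates_map (fun v hv => ?_) u
  obtain ⟨θ, hθ⟩ := mem_exoVars.1 (mem_exoVars_of_valid hI v hv)
  rw [card_eq (wf_of_valid hI).nodup hθ,
    card_eq (wf_model hI).nodup (unitVar_mem_model hθ hv)]

theorem feasible_iff : RMAP.Feasible (toRMAP I) u ↔ UnitSelection.Feasible I u := by
  change ((model I).IsStates u (I.U.map unitVar) ∧ (model I).obs _ ≠ 0) ↔
    (I.G.IsStates u I.U ∧ ∀ t ∈ I.L, I.G.obs (t.e ++ I.U.zip u) ≠ 0)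
  rw [isStates_map_unitVar hI]
  refine and_congr_right fun hs => ?_
  have hu : I.U.length = u.length := hs.length_eq.symm
  have hL : 0 < I.L.length := List.length_pos_of_ne_nil (ne_nil_of_valid hI)
  simp only [obs_evidence hI hu, obs_e_zip hI hu, mul_ne_zero_iff, Finset.prod_ne_zero_iff,
    Finset.mem_univ, true_imp_iff, List.forall_mem_iff_getElem]
  exact ⟨fun h i hi => ⟨h.1, h.2 ⟨i, hi⟩⟩, fun h => ⟨(h 0 hL).1, fun i => (h i i.2).2⟩⟩

theorem value_toRMAP (hu : I.U.length = u.length) (hunit : I.G.unitProb I.U u ≠ 0) :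
    RMAP.value (toRMAP I) u =
      (∑ s : Fin I.L.length, I.L[s].weight *
        ∏ i : Fin I.L.length, if s = i then I.G.probGiven I.U u (I.G.Holds I.L[i].worlds)
          else I.G.probGiven I.U u (I.G.Holds I.L[i].evidenceWorlds)) /
        ∏ i : Fin I.L.length, I.G.probGiven I.U u (I.G.Holds I.L[i].evidenceWorlds) := by
  change (model I).obs _ / (model I).obs _ = _
  rw [obs_outcome hI hu, obs_evidence hI hu]
  simp only [mul_left_comm _ (I.G.unitProb I.U u), ← Finset.mul_sum, mul_div_mul_left _ _ hunit]

theorem value_unitSelection (hu : I.U.length = u.length) (hunit : I.G.unitProb I.U u ≠ 0) :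
    UnitSelection.value I u =
      ∑ i : Fin I.L.length, I.L[i].weight * (I.G.probGiven I.U u (I.G.Holds I.L[i].worlds) /
        I.G.probGiven I.U u (I.G.Holds I.L[i].evidenceWorlds)) := by
  refine Eq.trans ?_ (Fin.sum_univ_fun_getElem I.L fun t => t.weight *
    (I.G.probGiven I.U u (I.G.Holds t.worlds) /
      I.G.probGiven I.U u (I.G.Holds t.evidenceWorlds))).symm
  simp only [UnitSelection, prob_worlds_zip hI hu, obs_e_zip hI hu, mul_div_mul_left _ _ hunit]

theorem value_eq (hu : UnitSelection.Feasible I u) :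
    RMAP.value (toRMAP I) u = UnitSelection.value I u := by
  obtain ⟨hs, hevidence⟩ := hu
  have hu : I.U.length = u.length := hs.length_eq.symm
  simp only [obs_e_zip hI hu, mul_ne_zero_iff] at hevidence
  obtain ⟨t, ht⟩ := List.exists_mem_of_ne_nil _ (ne_nil_of_valid hI)
  have hunit : I.G.unitProb I.U u ≠ 0 := (hevidence t ht).1
  rw [value_toRMAP hI hu hunit, value_unitSelection hI hu hunit]
  exact sum_mul_prod_ite_div_prod _ _ fun i => (hevidence _ (List.getElem_mem i.2)).2

end Value

theorem isPolyReduction_toRMAP : OptProblem.IsPolyReduction UnitSelection RMAP toRMAP :=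
  OptProblem.isPolyReduction_of polyTime_toRMAP (fun _ => valid_toRMAP)
    (fun _ hI _ => feasible_iff hI) fun _ hI _ => value_eq hI

end Objective

/-! ### The unit selection problem with independent unit variables -/

theorem length_dyadicPrior {k : ℕ} (hk : 0 < k) : (dyadicPrior k).length = k := by
  simpa [dyadicPrior] using Nat.sub_add_cancel hk

theorem sum_dyadicPrior (k : ℕ) : (dyadicPrior k).sum = 1 := by
  unfold dyadicPrior
  rw [List.sum_cons]
  induction k - 1 with
  | zero => simp
  | succ n ih =>
    have halves : (1 / 2 : ℚ≥0) ^ (n + 1) + (1 / 2) ^ (n + 1) = (1 / 2) ^ n := by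
      rw [pow_succ, ← mul_add, add_halves, mul_one]
    rw [List.range_succ, List.map_append, List.sum_append, List.map_singleton, List.sum_singleton,
      add_left_comm, halves, add_comm, ih]

theorem ne_zero_of_mem_dyadicPrior {k : ℕ} {q : ℚ≥0} (hq : q ∈ dyadicPrior k) : q ≠ 0 := by
  rcases List.mem_cons.1 hq with rfl | hq
  · positivity
  · obtain ⟨i, -, rfl⟩ := List.mem_map.1 hq
    positivity

theorem getD_dyadicPrior_ne_zero {k s : ℕ} (hs : s < k) : (dyadicPrior k).getD s 0 ≠ 0 := by
  rw [← length_dyadicPrior (Nat.zero_lt_of_lt hs)] at hs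
  rw [List.getD_eq_getElem _ _ hs]
  exact ne_zero_of_mem_dyadicPrior (List.getElem_mem hs)

theorem eq_of_lookup_idTable {k a b : ℕ} (h : (idTable k).lookup [a] = some b) : b = a := by
  have hmem := mem_of_lookup_eq_some h
  simp only [idTable, List.mem_map, Prod.mk.injEq, List.cons.injEq, and_true] at hmem
  obtain ⟨c, -, rfl, rfl⟩ := hmem
  rfl

theorem eq_ite_of_lookup_eqTable {k a b c : ℕ} (h : (eqTable k).lookup [a, b] = some c) :
    c = if a = b then 1 else 0 := by
  have hmem := mem_of_lookup_eq_some h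
  simp only [eqTable, List.mem_flatMap, List.mem_map, Prod.mk.injEq, List.cons.injEq,
    and_true] at hmem
  obtain ⟨a', -, b', -, ⟨rfl, rfl⟩, rfl⟩ := hmem
  rfl

section Assign

variable {U : List Var} {u : List ℕ}

theorem agrees_assign (hU : U.Nodup) (hu : U.length = u.length) :
    Agrees (U.zip u) (assign U u) := by
  intro p hp
  have hkeys : ((U.zip u).map Prod.fst).Nodup := by rwa [List.map_fst_zip hu.le]
  rw [assign, (lookup_eq_some_iff_mem hkeys).2 hp, Option.getD_some]

theorem forall_eq_and_agrees_zip (hu : U.length = u.length) {a b : Var → ℕ} :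
    (∀ v ∈ U, a v = b v) ∧ Agrees (U.zip u) b ↔ Agrees (U.zip u) a ∧ Agrees (U.zip u) b := by
  refine and_congr_left fun hb => ⟨fun h p hp => ?_, fun h v hv => ?_⟩
  · rw [h _ (vars_zip_subset _ _ (List.mem_map_of_mem hp)), hb p hp]
  · rw [← List.map_fst_zip (l₁ := U) (l₂ := u) hu.le] at hv
    obtain ⟨p, hp, rfl⟩ := List.mem_map.1 hv
    rw [h p hp, hb p hp]

end Assign

namespace SCM

variable {G : SCM} {v w : Var} {U : List Var} {u : List ℕ} {e e' : Inst}

theorem isTable_idTable (hv : v ∈ G.vars) : G.IsTable [v] (G.card v) (idTable (G.card v)) := by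
  refine ⟨by simp, by simp, by simpa using hv, ?_, fun p => ?_, by simp [idTable]⟩
  · rw [idTable, List.map_map]
    exact List.nodup_range.map fun a b h => by simpa using h
  · unfold idTable IsStates
    rcases p with _ | ⟨a, _ | ⟨b, p⟩⟩ <;> simp

theorem nodup_map_fst_eqTable (k : ℕ) : ((eqTable k).map Prod.fst).Nodup := by
  rw [eqTable, List.map_flatMap, List.nodup_flatMap]
  refine ⟨fun a _ => ?_, List.nodup_range.imp fun {a b} hab p ha hb => ?_⟩
  · rw [List.map_map]
    exact List.nodup_range.map fun b b' h => by simpa using h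
  · simp only [List.map_map, List.mem_map, Function.comp_apply] at ha hb
    obtain ⟨c, -, rfl⟩ := ha
    obtain ⟨d, -, h⟩ := hb
    exact hab (List.cons.inj h).1.symm

theorem isTable_eqTable (hv : v ∈ G.vars) (hw : w ∈ G.vars) (hne : v ≠ w)
    (hcard : G.card w = G.card v) : G.IsTable [v, w] 2 (eqTable (G.card v)) := by
  refine ⟨by simp, by simpa using hne, by simp [hv, hw], nodup_map_fst_eqTable _, fun p => ?_, ?_⟩
  · unfold eqTable IsStates
    rcases p with _ | ⟨a, _ | ⟨b, _ | ⟨c, p⟩⟩⟩ <;> simp [hcard]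
  · simp only [eqTable, List.mem_flatMap, List.mem_map]
    rintro _ ⟨a, -, b, -, rfl⟩
    dsimp only
    split_ifs <;> norm_num

theorem obs_congr (h : ∀ x, Agrees e x ↔ Agrees e' x) : G.obs e = G.obs e' := by
  unfold obs prob
  congr! 3 with ω
  rw [List.forall_mem_singleton, List.forall_mem_singleton]
  exact exists_congr fun x => and_congr_right' (h x)

theorem WF.prob_map_nil_act (h : G.WF) {es : List Inst}
    (hes : ∀ e ∈ es, ∀ p ∈ e, p.1 ∈ G.vars) :
    G.prob (es.map fun e => ([], e)) = G.obs es.flatten := by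
  refine (h.prob_eq _).trans (h.obs_eq_expect (List.forall_mem_flatten.2 hes)
    fun ω x _ hx => congrArg ind (propext ?_)).symm
  unfold Agrees Holds
  rw [List.forall_mem_flatten, List.forall_mem_map]
  exact forall₂_congr fun e he => (h.exists_sol_iff hx (hes e he)).symm

theorem assign_lt_card (hG : G.WF) (hu : G.IsStates u U) (hv : v ∈ G.vars) :
    assign U u v < G.card v := by
  unfold assign
  cases hs : (U.zip u).lookup v with
  | none => exact hG.card_pos hv
  | some s =>
    refine (List.forall₂_iff_zip.1 hu).2 ?_
    rw [← List.zip_swap]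
    exact List.mem_map_of_mem (f := Prod.swap) (mem_of_lookup_eq_some hs)

end SCM

namespace Targets

open SCM

variable {G : SCM} {v w : Var} {m : Mech} {U : List Var} {u : List ℕ} {e : Inst}

theorem origVar_injective : Function.Injective origVar := List.cons_injective

theorem copyVar_injective : Function.Injective copyVar := List.cons_injective

theorem targetVar_injective : Function.Injective targetVar := List.cons_injective

theorem matchVar_injective : Function.Injective matchVar := List.cons_injective

theorem mem_model : (w, m) ∈ model G ↔ ∃ v m', (v, m') ∈ G ∧
    ((w = origVar v ∧ m = origMech m') ∨ (w = copyVar v ∧ m = copyMech v m'.card) ∨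
      (w = targetVar v ∧ m = Mech.exo (dyadicPrior m'.card)) ∨
      (w = matchVar v ∧ m = matchMech v m'.card)) := by
  simp only [model, List.mem_append, List.mem_map, Prod.mk.injEq, Prod.exists, and_or_left,
    exists_or, or_assoc, eq_comm]

theorem origVar_mem_model (h : (v, m) ∈ G) : (origVar v, origMech m) ∈ model G :=
  mem_model.2 ⟨v, m, h, Or.inl ⟨rfl, rfl⟩⟩

theorem copyVar_mem_model (h : (v, m) ∈ G) : (copyVar v, copyMech v m.card) ∈ model G :=
  mem_model.2 ⟨v, m, h, Or.inr (Or.inl ⟨rfl, rfl⟩)⟩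

theorem targetVar_mem_model (h : (v, m) ∈ G) :
    (targetVar v, Mech.exo (dyadicPrior m.card)) ∈ model G :=
  mem_model.2 ⟨v, m, h, Or.inr (Or.inr (Or.inl ⟨rfl, rfl⟩))⟩

theorem matchVar_mem_model (h : (v, m) ∈ G) : (matchVar v, matchMech v m.card) ∈ model G :=
  mem_model.2 ⟨v, m, h, Or.inr (Or.inr (Or.inr ⟨rfl, rfl⟩))⟩

theorem vars_model (G : SCM) : (model G).vars =
    G.vars.map origVar ++ G.vars.map copyVar ++ G.vars.map targetVar ++ G.vars.map matchVar := by
  simp [model, vars, Function.comp_def]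

theorem nodup_model (hG : G.vars.Nodup) : (model G).vars.Nodup := by
  rw [vars_model]
  refine (((hG.map origVar_injective).append (hG.map copyVar_injective) ?_).append
    (hG.map targetVar_injective) ?_).append (hG.map matchVar_injective) ?_
  all_goals
    simp only [List.disjoint_left, List.mem_append, List.mem_map]
    grind [origVar, copyVar, targetVar, matchVar]

theorem origVar_mem_vars (hv : v ∈ G.vars) : origVar v ∈ (model G).vars := by
  simp [vars_model, List.mem_map_of_mem hv]

theorem copyVar_mem_vars (hv : v ∈ G.vars) : copyVar v ∈ (model G).vars := by
  simp [vars_model, List.mem_map_of_mem hv]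

theorem targetVar_mem_vars (hv : v ∈ G.vars) : targetVar v ∈ (model G).vars := by
  simp [vars_model, List.mem_map_of_mem hv]

theorem matchVar_mem_vars (hv : v ∈ G.vars) : matchVar v ∈ (model G).vars := by
  simp [vars_model, List.mem_map_of_mem hv]

theorem card_origMech (m : Mech) : (origMech m).card = m.card := by cases m <;> rfl

theorem card_model_origVar (hG : G.vars.Nodup) (hv : v ∈ G.vars) :
    (model G).card (origVar v) = G.card v := by
  obtain ⟨m, hm⟩ := mem_vars.1 hv
  rw [card_eq (nodup_model hG) (origVar_mem_model hm), card_origMech, card_eq hG hm]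

theorem card_model_copyVar (hG : G.vars.Nodup) (hv : v ∈ G.vars) :
    (model G).card (copyVar v) = G.card v := by
  obtain ⟨m, hm⟩ := mem_vars.1 hv
  rw [card_eq (nodup_model hG) (copyVar_mem_model hm), card_eq hG hm]
  rfl

theorem card_model_targetVar (hG : G.WF) (hv : v ∈ G.vars) :
    (model G).card (targetVar v) = G.card v := by
  obtain ⟨m, hm⟩ := mem_vars.1 hv
  have hpos := hG.card_pos hv
  rw [card_eq hG.nodup hm] at hpos ⊢
  rw [card_eq (nodup_model hG.nodup) (targetVar_mem_model hm)]
  exact length_dyadicPrior hpos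

theorem card_model_matchVar (hG : G.vars.Nodup) (hv : v ∈ G.vars) :
    (model G).card (matchVar v) = 2 := by
  obtain ⟨m, hm⟩ := mem_vars.1 hv
  rw [card_eq (nodup_model hG) (matchVar_mem_model hm)]
  rfl

theorem sum_eq_one_of_mem_model (hG : G.WF) {θ : List ℚ≥0} (hw : (w, Mech.exo θ) ∈ model G) :
    θ.sum = 1 := by
  obtain ⟨v, m, hm, ⟨-, h⟩ | ⟨-, h⟩ | ⟨-, h⟩ | ⟨-, h⟩⟩ := mem_model.1 hw
  · cases m with
    | exo => cases h; exact hG.sum_eq_one hm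
    | endo => cases h
  · cases h
  · cases h; exact sum_dyadicPrior _
  · cases h

theorem isTable_of_mem_model (hG : G.WF) {pa : List Var} {k : ℕ} {rows : List (List ℕ × ℕ)}
    (hw : (w, Mech.endo pa k rows) ∈ model G) : (model G).IsTable pa k rows := by
  obtain ⟨v, m, hm, h⟩ := mem_model.1 hw
  have hv : v ∈ G.vars := mem_vars.2 ⟨m, hm⟩
  have hcard : m.card = (model G).card (origVar v) := by
    rw [card_model_origVar hG.nodup hv, card_eq hG.nodup hm]
  obtain ⟨-, h⟩ | ⟨-, h⟩ | ⟨-, h⟩ | ⟨-, h⟩ := h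
  · cases m with
    | exo => cases h
    | endo =>
      cases h
      have hpa := hG.parents_subset hm
      exact (hG.isTable hm).map origVar_injective (fun p hp => origVar_mem_vars (hpa hp))
        fun p hp => card_model_origVar hG.nodup (hpa hp)
  · cases h
    rw [hcard]
    exact isTable_idTable (origVar_mem_vars hv)
  · cases h
  · cases h
    rw [hcard]
    refine isTable_eqTable (origVar_mem_vars hv) (targetVar_mem_vars hv)
      (by simp [origVar, targetVar]) ?_
    rw [card_model_targetVar hG hv, card_model_origVar hG.nodup hv]

/-- A rank function of `model G`, given one of `G`. -/
def modelRank (rank : Var → ℕ) : Var → ℕ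
  | 0 :: v => rank v
  | 1 :: v => rank v + 1
  | 3 :: v => rank v + 1
  | _ => 0

theorem modelRank_lt {rank : Var → ℕ}
    (hrank : ∀ v pa k rows, (v, Mech.endo pa k rows) ∈ G → ∀ p ∈ pa, rank p < rank v)
    {pa : List Var} {k : ℕ} {rows : List (List ℕ × ℕ)} (hw : (w, Mech.endo pa k rows) ∈ model G) :
    ∀ p ∈ pa, modelRank rank p < modelRank rank w := by
  obtain ⟨v, m, hm, ⟨rfl, h⟩ | ⟨rfl, h⟩ | ⟨rfl, h⟩ | ⟨rfl, h⟩⟩ := mem_model.1 hw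
  · cases m with
    | exo => cases h
    | endo => cases h; exact List.forall_mem_map.2 fun p hp => hrank _ _ _ _ hm p hp
  · cases h; simp [modelRank, origVar, copyVar]
  · cases h
  · cases h; simp [modelRank, origVar, targetVar, matchVar]

theorem wf_model (hG : G.WF) : (model G).WF := by
  obtain ⟨⟨v, m⟩, hm⟩ := List.exists_mem_of_ne_nil _ hG.1
  obtain ⟨rank, hrank⟩ := hG.2.2.2.2
  exact ⟨List.ne_nil_of_mem (origVar_mem_model hm), nodup_model hG.nodup,
    fun _ _ => sum_eq_one_of_mem_model hG, fun _ _ _ _ => isTable_of_mem_model hG,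
    modelRank rank, fun _ _ _ _ => modelRank_lt hrank⟩

/-- The distributions of the independent variables. -/
def targetPriors (G : SCM) : List (Var × List ℚ≥0) :=
  G.map fun n => (n.1, dyadicPrior n.2.card)

theorem priors_model (G : SCM) : (model G).priors =
    (G.priors.map fun p => (origVar p.1, p.2)) ++
      (targetPriors G).map fun p => (targetVar p.1, p.2) := by
  have horig : SCM.priors (G.map fun n => (origVar n.1, origMech n.2)) =
      G.priors.map fun p => (origVar p.1, p.2) := by
    unfold priors
    rw [List.filterMap_map, List.map_filterMap]
    congr 1
    funext ⟨v, m⟩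
    cases m <;> rfl
  simp [model, priors_append, horig]
  simp [priors, targetPriors, List.filterMap_map, Function.comp_def, copyMech, matchMech]

theorem expect_model (F F' : (Var → ℕ) → ℚ≥0) :
    expect (model G).priors (fun α => F (α ∘ origVar) * F' (α ∘ targetVar)) 0 =
      expect G.priors F 0 * expect (targetPriors G) F' 0 := by
  rw [priors_model, expect_append_mul, expect_map origVar_injective,
    expect_map targetVar_injective]
  · rfl
  · simp only [List.map_map, List.forall_mem_map]
    refine fun p _ a s => congrArg F (Function.update_comp_eq_of_forall_ne _ _ fun v => ?_)
    simp [origVar, targetVar]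
  · simp only [List.map_map, List.forall_mem_map]
    refine fun p _ => ⟨fun a s => ?_, by simp [origVar, targetVar]⟩
    refine congrArg F' (Function.update_comp_eq_of_forall_ne _ _ fun v => ?_)
    simp [origVar, targetVar]

section Solution

variable {α x : Var → ℕ} (hx : (model G).Sol [] α x)
include hx

theorem sol_orig : G.Sol [] (α ∘ origVar) (x ∘ origVar) := by
  intro v m hm
  cases m with
  | exo => exact hx.eq_of_exo (origVar_mem_model hm) rfl
  | endo =>
    simpa only [List.map_map, List.lookup_nil, Function.comp_apply] using
      hx.lookup_eq (origVar_mem_model hm) rfl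

theorem eq_copy (hv : v ∈ G.vars) : x (copyVar v) = x (origVar v) := by
  obtain ⟨m, hm⟩ := mem_vars.1 hv
  exact eq_of_lookup_idTable (hx.lookup_eq (copyVar_mem_model hm) rfl)

theorem eq_target (hv : v ∈ G.vars) : x (targetVar v) = α (targetVar v) := by
  obtain ⟨m, hm⟩ := mem_vars.1 hv
  exact hx.eq_of_exo (targetVar_mem_model hm) rfl

theorem match_eq_one (hv : v ∈ G.vars) :
    x (matchVar v) = 1 ↔ x (origVar v) = x (targetVar v) := by
  obtain ⟨m, hm⟩ := mem_vars.1 hv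
  rw [eq_ite_of_lookup_eqTable (hx.lookup_eq (matchVar_mem_model hm) rfl), ite_eq_left_iff]
  simp

theorem agrees_copyInst (he : ∀ p ∈ e, p.1 ∈ G.vars) :
    Agrees (copyInst e) x ↔ Agrees e (x ∘ origVar) := by
  unfold Agrees copyInst
  rw [List.forall_mem_map]
  exact forall₂_congr fun p hp => Eq.congr_left (eq_copy hx (he p hp))

theorem agrees_matchInst_zip (hU : U ⊆ G.vars) (hu : U.length = u.length) :
    Agrees (matchInst U) x ∧ Agrees ((U.map targetVar).zip u) x ↔
      Agrees (U.zip u) (α ∘ targetVar) ∧ Agrees (U.zip u) (x ∘ origVar) := by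
  have hmatch : Agrees (matchInst U) x ↔ ∀ v ∈ U, (x ∘ origVar) v = (α ∘ targetVar) v := by
    unfold Agrees matchInst
    rw [List.forall_mem_map]
    refine forall₂_congr fun v hv => (match_eq_one hx (hU hv)).trans ?_
    rw [eq_target hx (hU hv)]
    rfl
  have htarget : Agrees ((U.map targetVar).zip u) x ↔ Agrees (U.zip u) (α ∘ targetVar) := by
    unfold Agrees
    rw [List.zip_map_left, List.forall_mem_map]
    exact forall₂_congr fun p hp => Eq.congr_left
      (eq_target hx (hU (vars_zip_subset _ _ (List.mem_map_of_mem hp))))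
  rw [hmatch, htarget, forall_eq_and_agrees_zip hu, and_comm]

end Solution

/-- The probability that the independent variables of `U` have states `u`. -/
noncomputable def targetProb (G : SCM) (U : List Var) (u : List ℕ) : ℚ≥0 :=
  expect (targetPriors G) (fun ω => ind (Agrees (U.zip u) ω)) 0

theorem targetProb_ne_zero (hG : G.WF) (hUn : U.Nodup) (hU : U ⊆ G.vars) (hu : G.IsStates u U) :
    targetProb G U u ≠ 0 := by
  have hlen := hu.length_eq.symm
  refine expect_ne_zero (b := assign U u) ⟨fun v hv => ?_, List.forall_mem_map.2 fun n hn => ?_⟩ ?_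
  · have hlookup : (U.zip u).lookup v = none := by
      rw [lookup_eq_none_iff_notMem, List.map_fst_zip hlen.le]
      refine fun hvU => hv ?_
      rw [targetPriors, List.map_map]
      exact hU hvU
    rw [assign, hlookup]
    rfl
  · refine getD_dyadicPrior_ne_zero ?_
    rw [← card_eq hG.nodup hn]
    exact assign_lt_card hG hu (mem_vars.2 ⟨_, hn⟩)
  · rw [ind_true (agrees_assign hUn hlen)]
    exact one_ne_zero

theorem evidence_subset_vars (hU : U ⊆ G.vars) (he : ∀ p ∈ e, p.1 ∈ G.vars) :
    ∀ p ∈ copyInst e ++ matchInst U ++ (U.map targetVar).zip u, p.1 ∈ (model G).vars := by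
  simp only [List.forall_mem_append, copyInst, matchInst, List.forall_mem_map]
  refine ⟨⟨fun p hp => copyVar_mem_vars (he p hp), fun v hv => matchVar_mem_vars (hU hv)⟩, ?_⟩
  rw [List.zip_map_left, List.forall_mem_map]
  exact fun p hp => targetVar_mem_vars (hU (vars_zip_subset _ _ (List.mem_map_of_mem hp)))

theorem obs_model (hG : G.WF) (hU : U ⊆ G.vars) (hu : U.length = u.length)
    (he : ∀ p ∈ e, p.1 ∈ G.vars) :
    (model G).obs (copyInst e ++ matchInst U ++ (U.map targetVar).zip u) =
      G.obs (e ++ U.zip u) * targetProb G U u := by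
  have hvars : ∀ p ∈ e ++ U.zip u, p.1 ∈ G.vars := List.forall_mem_append.2
    ⟨he, fun p hp => hU (vars_zip_subset _ _ (List.mem_map_of_mem hp))⟩
  rw [obs.eq_1 G, hG.prob_eq, targetProb, ← expect_model]
  refine (wf_model hG).obs_eq_expect (evidence_subset_vars hU he) fun α x _ hx => ?_
  rw [← ind_and, holds_singleton, hG.exists_sol_iff (sol_orig hx) hvars]
  refine congrArg ind (propext ?_)
  rw [agrees_append, agrees_append, and_assoc, agrees_matchInst_zip hx hU hu,
    agrees_copyInst hx he, agrees_append, and_assoc, and_comm (a := Agrees _ (α ∘ _))]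

theorem isEndoInst_copyInst (hG : G.WF) (he : G.IsInst e) :
    (model G).IsEndoInst (copyInst e) := by
  refine ⟨⟨?_, List.forall_mem_map.2 fun p hp => ⟨copyVar_mem_vars (he.2 p hp).1, ?_⟩⟩,
    List.forall_mem_map.2 fun p hp => ?_⟩
  · have hnodup := he.1.map copyVar_injective
    rw [Inst.vars, List.map_map] at hnodup
    rw [Inst.vars, copyInst, List.map_map]
    exact hnodup
  · rw [card_model_copyVar hG.nodup (he.2 p hp).1]
    exact (he.2 p hp).2
  · obtain ⟨m, hm⟩ := mem_vars.1 (he.2 p hp).1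
    exact mem_endoVars.2 ⟨_, _, _, copyVar_mem_model hm⟩

theorem isEndoInst_matchInst (hG : G.WF) (hUn : U.Nodup) (hU : U ⊆ G.vars) :
    (model G).IsEndoInst (matchInst U) := by
  refine ⟨⟨?_, List.forall_mem_map.2 fun v hv => ⟨matchVar_mem_vars (hU hv), ?_⟩⟩,
    List.forall_mem_map.2 fun v hv => ?_⟩
  · rw [Inst.vars, matchInst, List.map_map]
    exact hUn.map matchVar_injective
  · rw [card_model_matchVar hG.nodup (hU hv)]
    exact Nat.one_lt_two
  · obtain ⟨m, hm⟩ := mem_vars.1 (hU hv)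
    exact mem_endoVars.2 ⟨_, _, _, matchVar_mem_model hm⟩

theorem isEndoInst_copyInst_append_matchInst (hG : G.WF) (he : G.IsInst e) (hUn : U.Nodup)
    (hU : U ⊆ G.vars) : (model G).IsEndoInst (copyInst e ++ matchInst U) := by
  have hcopy := isEndoInst_copyInst hG he
  have hmatch := isEndoInst_matchInst hG hUn hU
  refine ⟨hcopy.1.append hmatch.1 ?_, List.forall_mem_append.2 ⟨hcopy.2, hmatch.2⟩⟩
  simp +contextual [List.disjoint_right, Inst.vars, copyInst, matchInst, copyVar, matchVar]

section Reduction

variable {I : RMAPInput} (hI : RMAP.Valid I)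
include hI

theorem valid_toUS : UnitSelection.Valid (toUS I) := by
  obtain ⟨hG, hUn, hU, he₁, he₂, -⟩ := hI
  have hnil : (model I.G).IsEndoInst [] := ⟨isInst_nil _, by simp⟩
  refine ⟨wf_model hG, hUn.map targetVar_injective, List.forall_mem_map.2 fun v hv => ?_,
    List.forall_mem_singleton.2 ?_, List.sum_singleton⟩
  · obtain ⟨m, hm⟩ := mem_vars.1 (hU hv)
    exact mem_exoVars.2 ⟨_, targetVar_mem_model hm⟩
  · exact ⟨hnil, isEndoInst_copyInst hG he₁, hnil, hnil,
      isEndoInst_copyInst_append_matchInst hG he₂ hUn hU, List.disjoint_nil_left _⟩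

theorem obs_evidence (hu : I.U.length = u.length) :
    (model I.G).obs (copyInst I.e₂ ++ matchInst I.U ++ (I.U.map targetVar).zip u) =
      I.G.obs (I.U.zip u ++ I.e₂) * targetProb I.G I.U u := by
  obtain ⟨hG, -, hU, -, he₂, -⟩ := hI
  rw [obs_model hG hU hu fun p hp => (he₂.2 p hp).1]
  exact congrArg (· * _) (obs_congr fun x => by simp only [agrees_append, and_comm])

theorem prob_outcome (hu : I.U.length = u.length) :
    (model I.G).prob [([], copyInst I.e₁), ([], []),
      ([], copyInst I.e₂ ++ matchInst I.U ++ (I.U.map targetVar).zip u)] =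
      I.G.obs (I.e₁ ++ I.U.zip u ++ I.e₂) * targetProb I.G I.U u := by
  obtain ⟨hG, -, hU, he₁, he₂, -⟩ := hI
  have hvars₁ (p) (hp : p ∈ I.e₁) : p.1 ∈ I.G.vars := (he₁.2 p hp).1
  have hvars₂ (p) (hp : p ∈ I.e₂) : p.1 ∈ I.G.vars := (he₂.2 p hp).1
  have hflatten := (wf_model hG).prob_map_nil_act (es := [copyInst I.e₁, [],
    copyInst I.e₂ ++ matchInst I.U ++ (I.U.map targetVar).zip u]) ?_
  · refine hflatten.trans ?_
    have happend : copyInst I.e₁ ++ copyInst I.e₂ = copyInst (I.e₁ ++ I.e₂) :=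
      List.map_append.symm
    simp only [List.flatten_cons, List.flatten_nil, List.append_nil, List.nil_append]
    rw [← List.append_assoc, ← List.append_assoc, happend,
      obs_model hG hU hu (List.forall_mem_append.2 ⟨hvars₁, hvars₂⟩)]
    exact congrArg (· * _) (obs_congr fun x => by simp only [agrees_append, and_right_comm])
  · simp only [List.forall_mem_cons]
    exact ⟨List.forall_mem_map.2 fun p hp => copyVar_mem_vars (hvars₁ p hp), by simp,
      evidence_subset_vars hU hvars₂, by simp⟩

theorem feasible_iff : UnitSelection.Feasible (toUS I) u ↔ RMAP.Feasible I u := by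
  have ⟨hG, hUn, hU, _⟩ := hI
  refine (and_congr (isStates_map (fun v hv => card_model_targetVar hG (hU hv)) u)
    List.forall_mem_singleton).trans (and_congr_right fun hu => ?_)
  refine (obs_evidence hI hu.length_eq.symm ▸ mul_ne_zero_iff).trans ?_
  exact and_iff_left (targetProb_ne_zero hG hUn hU hu)

theorem value_eq (hf : RMAP.Feasible I u) : UnitSelection.value (toUS I) u = RMAP.value I u := by
  have ⟨hG, hUn, hU, _⟩ := hI
  have hu := hf.1.length_eq.symm
  refine List.sum_singleton.trans ((one_mul _).trans ?_)
  refine (congrArg₂ _ (prob_outcome hI hu) (obs_evidence hI hu)).trans ?_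
  exact mul_div_mul_right _ _ (targetProb_ne_zero hG hUn hU hf.1)

end Reduction

theorem isPolyReduction_toUS : OptProblem.IsPolyReduction RMAP UnitSelection toUS :=
  OptProblem.isPolyReduction_of polyTime_toUS (fun _ => valid_toUS)
    (fun _ hI _ => feasible_iff hI) fun _ hI _ => value_eq hI

end Targets

theorem mainTheorem4 :
    (∃ f : RMAPInput → USInput, OptProblem.IsPolyReduction RMAP UnitSelection f) ∧
    OptProblem.IsPolyReduction UnitSelection RMAP Objective.toRMAP ∧
    (∃ C : ℕ, ∀ I : USInput, UnitSelection.Valid I →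
      (Objective.model I).size ≤ C * (I.L.length * I.G.size)) :=
  ⟨⟨_, Targets.isPolyReduction_toUS⟩, Objective.isPolyReduction_toRMAP, 10, fun _ hI =>
    Objective.size_model_le (Objective.wf_of_valid hI) (Objective.ne_nil_of_valid hI)⟩
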